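/- Let $R>0$, $a>0$, $d>R$, $k>0$ and $N\ge 1$. Let $\Omega=\{\mathbf x=(x,y,z)\in\mathbb R^3: |x|,|y|,|z|<R\}$, $\Gamma=\{\mathbf x: |x|,|y|<R,\ z=-R\}$ and $\mathbf x_\alpha=(\alpha,0,-d)$ for $\alpha\in[-a,a]$. Let $\{\Psi_n\}_{n\ge 0}$ be obtained by Gram–Schmidt orthonormalization in $L^2(-a,a)$ of the functions $\alpha^n e^\alpha$, $n=0,1,2,\dots$, and let $S_N=(s_{mn})_{m,n=0}^{N-1}$, $s_{mn}=\int_{-a}^a\Psi_n'\Psi_m\,d\alpha$ (an invertible matrix). Put $$\tilde{\mathbf x}_\alpha=\frac{ik(\mathbf x-\mathbf x_\alpha)}{|\mathbf x-\mathbf x_\alpha|}-\frac{\mathbf x-\mathbf x_\alpha}{|\mathbf x-\mathbf x_\alpha|^2},$$ $$\hat{\mathbf x}_\alpha=\partial_\alpha\tilde{\mathbf x}_\alpha=\frac{ik}{|\mathbf x-\mathbf x_\alpha|^3}\big(-y^2-(z+d)^2,\,(x-\alpha)y,\,(x-\alpha)(z+d)\big)-\frac{1}{|\mathbf x-\mathbf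 x_\alpha|^4}\big((x-\alpha)^2-y^2-(z+d)^2,\,2(x-\alpha)y,\,2(x-\alpha)(z+d)\big).$$ For $V=(v_0,\dots,v_{N-1}):\Omega\to\mathbb C^N$ let $K(\nabla V)=S_N^{-1}f(\nabla V)$, where for $0\le m\le N-1$, with $p\cdot q=\sum_i p_iq_i$ (no conjugation), $$f_m(\nabla V)=2\sum_{n,l=0}^{N-1}\nabla v_n\cdot\nabla v_l\int_{-a}^a\Psi_m\Psi_n\Psi_l'\,d\alpha+2\sum_{n=0}^{N-1}\int_{-a}^a\Psi_m\Psi_n'\,\nabla v_n\cdot\tilde{\mathbf x}_\alpha\,d\alpha+2\sum_{n=0}^{N-1}\int_{-a}^a\Psi_m\Psi_n\,\hat{\mathbf x}_\alpha\cdot\nabla v_n\,d\alpha .$$ Consider the overdetermined boundary value problem $$\Delta V+K(\nabla V)=0\ \text{ in }\Omega,\qquad V=\psi_0\ \text{ on }\partial\Omega,\qquad \partial_zV=\psi_1\ \text{ on }\Gamma. \qquad (\ast)$$ Here $H^m_N(\Omega)$ is the space of $\mathbb C^N$-valued functions with components in $H^m(\Omega)$, with norm $\big(\sum_j\|U_j\|_{H^m(\Omega)}^2\big)^{1/2}$;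 the equation is understood almost everywhere, and the boundary values of $H^3$ functions and of their first derivatives are those of their continuous representatives on $\overline\Omega$. **Theorem 3.2** (Lipschitz stability). For every $M>0$ let $G(M)=\{W\in H^3_N(\Omega):\|W\|_{H^3_N(\Omega)}<M\}$. There is a constant $C>0$, depending only on $\Omega$, $N$, $M$ and the parameters $a,d,k$ of the equation, such that the following holds. Let $V^{(1)},V^{(2)}\in G(M)$ be solutions of $(\ast)$ with boundary data $(\psi_0^{(1)},\psi_1^{(1)})$ and $(\psi_0^{(2)},\psi_1^{(2)})$ respectively, and let $F_1,F_2\in G(M)$ satisfy $F_i=\psi_0^{(i)}$ on $\partial\Omega$ and $\partial_zF_i=\psi_1^{(i)}$ on $\Gamma$ for $i=1,2$. Then $$\|V^{(1)}-V^{(2)}\|_{H^2_N(\Omega)}\le C\,\|F_1-F_2\|_{H^2_N(\Omega)} .$$ In particular, for given boundary data $\psi_0,\psi_1$, problem $(\ast)$ has at most one solution in $H^3_N(\Omega)$ (up to equality almost everywhere). -/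

import Mathlib

open MeasureTheory Filter Topology
open scoped ContDiff

namespace HelmholtzCIP

noncomputable section

/-- The Euclidean space `ℝ³`; the coordinates `x, y, z` are the entries `0, 1, 2`. -/
abbrev E3 : Type := EuclideanSpace ℝ (Fin 3)

/-! ### Sobolev spaces `H^m(Ω) = W^{m,2}(Ω)` of complex valued functions -/

/-- Classical partial derivative `∂_i φ`. -/
def partialDeriv (i : Fin 3) (φ : E3 → ℝ) : E3 → ℝ :=
  fun x => fderiv ℝ φ x (EuclideanSpace.single i 1)

/-- Classical derivative `D^β φ = ∂_0^{β 0} ∂_1^{β 1} ∂_2^{β 2} φ` for a multi-index `β`. -/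
def multiDeriv (β : Fin 3 → ℕ) (φ : E3 → ℝ) : E3 → ℝ :=
  (partialDeriv 0)^[β 0] ((partialDeriv 1)^[β 1] ((partialDeriv 2)^[β 2] φ))

/-- `g` is a weak derivative `D^β u` in the open set `Ω`:
`∫_Ω u D^β φ = (-1)^{|β|} ∫_Ω g φ` for all `φ ∈ C_c^∞(Ω)`. -/
def HasWeakDeriv (Ω : Set E3) (β : Fin 3 → ℕ) (u g : E3 → ℂ) : Prop :=
  LocallyIntegrableOn u Ω ∧ LocallyIntegrableOn g Ω ∧
    ∀ φ : E3 → ℝ, ContDiff ℝ ∞ φ → HasCompactSupport φ → tsupport φ ⊆ Ω →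
      ∫ x in Ω, (multiDeriv β φ x : ℂ) * u x =
        (-1 : ℂ) ^ (∑ i, β i) * ∫ x in Ω, (φ x : ℂ) * g x

open Classical in
/-- The weak derivative `D^β u` in `Ω` (a representative; it is unique almost everywhere in `Ω`),
and `0` if there is none. -/
def weakDeriv (Ω : Set E3) (β : Fin 3 → ℕ) (u : E3 → ℂ) : E3 → ℂ :=
  if h : ∃ g, HasWeakDeriv Ω β u g then h.choose else 0

/-- The multi-indices `β` with `|β| ≤ m`. -/
def multiIndices (m : ℕ) : Finset (Fin 3 → ℕ) :=
  (Fintype.piFinset fun _ => Finset.range (m + 1)).filter fun β => ∑ i, β i ≤ m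

/-- `u ∈ H^m(Ω)`: all weak derivatives of order at most `m` (including `u` itself, `β = 0`)
exist and lie in `L²(Ω)`. -/
def MemH (m : ℕ) (Ω : Set E3) (u : E3 → ℂ) : Prop :=
  ∀ β ∈ multiIndices m, ∃ g, HasWeakDeriv Ω β u g ∧ MemLp g 2 (volume.restrict Ω)

/-- `‖u‖_{H^m(Ω)}² = ∑_{|β| ≤ m} ∫_Ω |D^β u|²`. -/
def normSqH (m : ℕ) (Ω : Set E3) (u : E3 → ℂ) : ℝ :=
  ∑ β ∈ multiIndices m, ∫ x in Ω, ‖weakDeriv Ω β u x‖ ^ 2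

/-- `U ∈ H^m_N(Ω) = H^m(Ω) × ⋯ × H^m(Ω)`. -/
def MemHVec (m : ℕ) {N : ℕ} (Ω : Set E3) (U : Fin N → E3 → ℂ) : Prop :=
  ∀ j, MemH m Ω (U j)

/-- `‖U‖_{H^m_N(Ω)} = (∑_j ‖U_j‖_{H^m(Ω)}²)^{1/2}`. -/
def normHVec (m : ℕ) {N : ℕ} (Ω : Set E3) (U : Fin N → E3 → ℂ) : ℝ :=
  √(∑ j, normSqH m Ω (U j))

/-- Weak first derivative `∂_i u`. -/
def weakPartial (Ω : Set E3) (i : Fin 3) (u : E3 → ℂ) : E3 → ℂ :=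
  weakDeriv Ω (Pi.single i 1) u

/-- Weak Laplacian `Δu = ∑_i ∂_i² u`. -/
def weakLaplacian (Ω : Set E3) (u : E3 → ℂ) : E3 → ℂ :=
  fun x => ∑ i, weakDeriv Ω (Pi.single i 2) u x

/-- `u = ψ` on a subset `S` of the boundary of `Ω`, where `u` is defined almost everywhere in `Ω`:
at each point `p` of `S` the essential limit of `u(x)` as `x → p`, `x ∈ Ω`, is `ψ p`. If `u` has a
continuous representative on `closure Ω`, this says that it equals `ψ` on `S`. -/
def HasBoundaryValues (Ω S : Set E3) (u ψ : E3 → ℂ) : Prop :=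
  ∀ p ∈ S, Tendsto u (𝓝 p ⊓ ae (volume.restrict Ω)) (𝓝 (ψ p))

/-! ### The domain -/

/-- The open cube `{|x|, |y|, |z| < R}`. -/
def cube (R : ℝ) : Set E3 := {x | ∀ i, |x i| < R}

/-- The lower face `{|x|, |y| < R, z = -R}`. -/
def lowerFace (R : ℝ) : Set E3 := {x | |x 0| < R ∧ |x 1| < R ∧ x 2 = -R}

/-! ### The orthonormal basis of `L²(-a,a)` -/

/-- `φ_n(α) = α^n e^α`. -/
def phi (n : ℕ) : ℝ → ℝ := fun α => α ^ n * Real.exp α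

/-- The scalar product of `L²(-a,a)` (for real functions). -/
def ip (a : ℝ) (f g : ℝ → ℝ) : ℝ := ∫ α in (-a)..a, f α * g α

/-- The orthogonal, not yet normalized, Gram–Schmidt functions obtained from `φ_0, φ_1, …`. -/
def gramSchmidtPhi (a : ℝ) (n : ℕ) : ℝ → ℝ := fun α =>
  phi n α - ∑ i : Fin n, ip a (phi n) (gramSchmidtPhi a i) /
    ip a (gramSchmidtPhi a i) (gramSchmidtPhi a i) * gramSchmidtPhi a i α
termination_by n
decreasing_by all_goals exact i.2

/-- The orthonormal functions `Ψ_n`. -/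
def Psi (a : ℝ) (n : ℕ) : ℝ → ℝ := fun α =>
  gramSchmidtPhi a n α / √(ip a (gramSchmidtPhi a n) (gramSchmidtPhi a n))

/-- The matrix `S_N`, with entries `s_{mn} = ⟨Ψ_n', Ψ_m⟩`. -/
def matS (a : ℝ) (N : ℕ) : Matrix (Fin N) (Fin N) ℝ :=
  Matrix.of fun m n => ip a (deriv (Psi a n)) (Psi a m)

/-! ### The nonlinearity -/

/-- The source position `x_α = (α, 0, -d)`. -/
def source (d α : ℝ) : E3 := !₂[α, 0, -d]

/-- The vector `x̃_α = ik (x - x_α) / |x - x_α| - (x - x_α) / |x - x_α|²`,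
the gradient in `x` of `log u₀(x, α) = ik |x - x_α| - ln (4π |x - x_α|)`. -/
def tildeX (k d α : ℝ) (x : E3) : Fin 3 → ℂ := fun i =>
  Complex.I * k * ((x - source d α) i : ℝ) / (‖x - source d α‖ : ℝ) -
    ((x - source d α) i : ℝ) / (‖x - source d α‖ : ℝ) ^ 2

/-- The vector `x̂_α = ∂_α x̃_α`, explicitly, with `x - x_α = (x - α, y, z + d)`. -/
def hatX (k d α : ℝ) (x : E3) : Fin 3 → ℂ := fun i =>
  Complex.I * k / (‖x - source d α‖ : ℝ) ^ 3 *
      ((![-(x 1) ^ 2 - (x 2 + d) ^ 2, (x 0 - α) * x 1, (x 0 - α) * (x 2 + d)] i : ℝ) : ℂ) -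
    1 / (‖x - source d α‖ : ℝ) ^ 4 *
      ((![(x 0 - α) ^ 2 - (x 1) ^ 2 - (x 2 + d) ^ 2, 2 * (x 0 - α) * x 1,
        2 * (x 0 - α) * (x 2 + d)] i : ℝ) : ℂ)

/-- The bilinear (not sesquilinear) product `p · q = ∑_i p_i q_i` on `ℂ³`. -/
def bdot (p q : Fin 3 → ℂ) : ℂ := ∑ i, p i * q i

/-- `f_m`, at the point `x`, as a function of the gradients `P n = ∇v_n(x)`. -/
def fNonlin (a d k : ℝ) {N : ℕ} (x : E3) (P : Fin N → Fin 3 → ℂ) (m : Fin N) : ℂ :=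
  (2 * ∑ n : Fin N, ∑ l : Fin N, bdot (P n) (P l) *
      ((∫ α in (-a)..a, Psi a m α * Psi a n α * deriv (Psi a l) α : ℝ) : ℂ))
  + (2 * ∑ n : Fin N, (∫ α in (-a)..a,
      ((Psi a m α * deriv (Psi a n) α : ℝ) : ℂ) * bdot (P n) (tildeX k d α x)))
  + (2 * ∑ n : Fin N, (∫ α in (-a)..a,
      ((Psi a m α * Psi a n α : ℝ) : ℂ) * bdot (hatX k d α x) (P n)))

/-- `K = S_N⁻¹ f`, at the point `x`, as a function of the gradients. -/
def KNonlin (a d k : ℝ) {N : ℕ} (x : E3) (P : Fin N → Fin 3 → ℂ) : Fin N → ℂ :=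
  ((matS a N)⁻¹.map fun s : ℝ => (s : ℂ)).mulVec (fNonlin a d k x P)

/-- `V` satisfies `ΔV + K(∇V) = 0` almost everywhere in the cube. -/
def SolvesSystem (R a d k : ℝ) {N : ℕ} (V : Fin N → E3 → ℂ) : Prop :=
  ∀ᵐ x ∂(volume.restrict (cube R)), ∀ m : Fin N,
    weakLaplacian (cube R) (V m) x +
      KNonlin a d k x (fun n i => weakPartial (cube R) i (V n) x) m = 0

/-- `U = ψ₀` on the boundary of the cube and `∂_z U = ψ₁` on its lower face. -/
def HasBoundaryData (R : ℝ) {N : ℕ} (U ψ₀ ψ₁ : Fin N → E3 → ℂ) : Prop :=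
  ∀ j, HasBoundaryValues (cube R) (frontier (cube R)) (U j) (ψ₀ j) ∧
    HasBoundaryValues (cube R) (lowerFace R) (weakPartial (cube R) 2 (U j)) (ψ₁ j)

/-- The open ball `G(M)` of radius `M` in `H³_N` of the cube. -/
def InBallG (R M : ℝ) {N : ℕ} (U : Fin N → E3 → ℂ) : Prop :=
  MemHVec 3 (cube R) U ∧ normHVec 3 (cube R) U < M

end

end HelmholtzCIP

open HelmholtzCIP

/-!
The proof is a Carleman estimate for the Laplacian in the cube, combined with the boundedness of
the gradients of functions in `H³`.

Let `Φ = F₁ - F₂` and `U = V₁ - V₂ - Φ`. Every component of `U` vanishes on the boundary of the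
cube, and its `z`-derivative vanishes on the lower face (`CauchyData`). By the embedding
`H² ⊂ L^∞` (`exists_ae_norm_le_of_isWeakPartial`), the gradients of `V₁` and `V₂` are bounded in
terms of `M`. The nonlinearity is a polynomial of degree two in the gradients with bounded
coefficients, because the sources stay away from the cube; hence it is Lipschitz on bounded sets
(`exists_KNonlin_lipschitz`) and
`|ΔU| ≤ C (|∇U| + |∇Φ|) + |ΔΦ|` almost everywhere.

The Carleman estimate, with the weight `w = exp(2λ(R + 1 - z)²)`, reads
`λ ∫ w (|U|² + |∇U|²) ≤ C ∫ w |ΔU|²` and `∫ w |D²U|² ≤ C λ ∫ w |ΔU|²`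
(`CauchyData.carleman_lower`, `CauchyData.carleman_second`). For large `λ` the gradient of `U` is
absorbed, which bounds `U` in `H²` by `Φ` (`exists_stability_of_laplacian_le`). Uniqueness is the
case `F₁ = F₂ = V₁`.

The Carleman estimate is proved mode by mode. As `U` vanishes on the vertical faces, it is expanded
in products of sines in `x` and `y`; horizontal derivatives replace sines by cosines, and Parseval's
identity holds for both systems (`hasSum_sq_integral_trig`). The `(m, n)`-th coefficient `y` of `U`,
a function of `z`, solves `y'' - μ² y = G`, with `G` the coefficient of `ΔU`, and
`y(-R) = y'(-R) = 0`, `y(R) = 0`. Factoring the operator as `(d/dz + μ)(d/dz - μ)`, the estimate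
follows from two applications of a first order estimate with constants independent of `μ`
(`carleman_first_order`, `WeakOde.carleman`). No traces are needed: all boundary conditions enter
through integrations by parts against products of smooth functions of one coordinate, cut off near
the faces (`IsWeakPartial.integral_prodT`).

The embedding is proved by averaging `f` over the dilations about `x₀` of a bump function in the
cube. The average is twice differentiable in the scale `s`; its second derivative is an average of
second derivatives of `f`, bounded by `C s^{-3/2}`, which is twice integrable at `s = 0`; and the
averages tend to `f(x₀)` as `s → 0` at Lebesgue points (`ae_tendsto_scaledMean`).
-/

namespace HelmholtzCIP

/-! ### The cube, classical derivatives and weak derivatives -/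

lemma isOpen_cube (R : ℝ) : IsOpen (cube R) := by
  have : cube R = ⋂ i : Fin 3, {x : E3 | |x i| < R} := by ext x; simp [cube]
  rw [this]
  exact isOpen_iInter_of_finite fun i => isOpen_lt (by fun_prop) continuous_const

lemma measurableSet_cube (R : ℝ) : MeasurableSet (cube R) := (isOpen_cube R).measurableSet

lemma norm_le_of_mem_cube {R : ℝ} {x : E3} (hx : x ∈ cube R) : ‖x‖ ≤ 3 * R := by
  have hR : 0 ≤ R := (abs_nonneg _).trans (hx 0).le
  rw [EuclideanSpace.norm_eq]
  apply Real.sqrt_le_iff.2 ⟨by positivity, ?_⟩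
  simp only [Fin.sum_univ_three, Real.norm_eq_abs]
  have h i : |x i| ^ 2 ≤ R ^ 2 := pow_le_pow_left₀ (abs_nonneg _) (hx i).le 2
  nlinarith [h 0, h 1, h 2, sq_nonneg R]

lemma isBounded_cube (R : ℝ) : Bornology.IsBounded (cube R) :=
  isBounded_iff_forall_norm_le.2 ⟨3 * R, fun _ hx => norm_le_of_mem_cube hx⟩

instance isFiniteMeasure_cube (R : ℝ) : IsFiniteMeasure (volume.restrict (cube R)) :=
  ⟨by rw [Measure.restrict_apply_univ]; exact (isBounded_cube R).measure_lt_top⟩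

lemma contDiff_partialDeriv {φ : E3 → ℝ} (hφ : ContDiff ℝ ∞ φ) (i : Fin 3) :
    ContDiff ℝ ∞ (partialDeriv i φ) :=
  (hφ.fderiv_right (m := ∞) (by simp)).clm_apply contDiff_const

lemma tsupport_partialDeriv_subset (φ : E3 → ℝ) (i : Fin 3) :
    tsupport (partialDeriv i φ) ⊆ tsupport φ :=
  tsupport_fderiv_apply_subset ℝ _

lemma hasCompactSupport_partialDeriv {φ : E3 → ℝ} (hφ : HasCompactSupport φ) (i : Fin 3) :
    HasCompactSupport (partialDeriv i φ) :=
  hφ.mono' (subset_tsupport _ |>.trans (tsupport_partialDeriv_subset φ i))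

lemma partialDeriv_comm {φ : E3 → ℝ} (hφ : ContDiff ℝ ∞ φ) (i j : Fin 3) :
    partialDeriv i (partialDeriv j φ) = partialDeriv j (partialDeriv i φ) := by
  have hd : Differentiable ℝ (fderiv ℝ φ) :=
    (hφ.fderiv_right (m := 1) (by norm_cast)).differentiable (by simp)
  have key : ∀ (l m : Fin 3) x, partialDeriv l (partialDeriv m φ) x =
      fderiv ℝ (fderiv ℝ φ) x (EuclideanSpace.single l 1) (EuclideanSpace.single m 1) := by
    intro l m x
    unfold partialDeriv
    rw [fderiv_clm_apply (hd x) (by fun_prop)]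
    simp
  funext x
  rw [key, key]
  exact (hφ.contDiffAt.isSymmSndFDerivAt (by simp; exact WithTop.coe_le_coe.2 le_top)) _ _

lemma contDiff_iterate_partialDeriv {φ : E3 → ℝ} (hφ : ContDiff ℝ ∞ φ) (i : Fin 3) (n : ℕ) :
    ContDiff ℝ ∞ ((partialDeriv i)^[n] φ) := by
  induction n with
  | zero => exact hφ
  | succ n ih => rw [Function.iterate_succ_apply']; exact contDiff_partialDeriv ih i

lemma partialDeriv_iterate_comm {φ : E3 → ℝ} (hφ : ContDiff ℝ ∞ φ) (i j : Fin 3) (n : ℕ) :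
    partialDeriv i ((partialDeriv j)^[n] φ) = (partialDeriv j)^[n] (partialDeriv i φ) := by
  induction n with
  | zero => rfl
  | succ n ih =>
    rw [Function.iterate_succ_apply', Function.iterate_succ_apply',
      partialDeriv_comm (contDiff_iterate_partialDeriv hφ j n), ih]

lemma multiDeriv_add_single {φ : E3 → ℝ} (hφ : ContDiff ℝ ∞ φ) (β : Fin 3 → ℕ) (i : Fin 3) :
    multiDeriv (β + Pi.single i 1) φ = multiDeriv β (partialDeriv i φ) := by
  unfold multiDeriv
  fin_cases i
  · simp [partialDeriv_iterate_comm (contDiff_iterate_partialDeriv hφ 2 _),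
      partialDeriv_iterate_comm hφ]
  · simp [partialDeriv_iterate_comm hφ]
  · simp

lemma contDiff_multiDeriv {φ : E3 → ℝ} (hφ : ContDiff ℝ ∞ φ) (β : Fin 3 → ℕ) :
    ContDiff ℝ ∞ (multiDeriv β φ) :=
  contDiff_iterate_partialDeriv (contDiff_iterate_partialDeriv
    (contDiff_iterate_partialDeriv hφ _ _) _ _) _ _

lemma tsupport_iterate_partialDeriv_subset (φ : E3 → ℝ) (i : Fin 3) (n : ℕ) :
    tsupport ((partialDeriv i)^[n] φ) ⊆ tsupport φ := by
  induction n with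
  | zero => rfl
  | succ n ih =>
    rw [Function.iterate_succ_apply']; exact (tsupport_partialDeriv_subset _ _).trans ih

lemma tsupport_multiDeriv_subset (φ : E3 → ℝ) (β : Fin 3 → ℕ) :
    tsupport (multiDeriv β φ) ⊆ tsupport φ :=
  ((tsupport_iterate_partialDeriv_subset _ _ _).trans
    (tsupport_iterate_partialDeriv_subset _ _ _)).trans
    (tsupport_iterate_partialDeriv_subset _ _ _)

/-- A locally integrable function times a continuous test function is integrable. -/
lemma integrable_test_mul {Ω : Set E3} {u : E3 → ℂ} (hu : LocallyIntegrableOn u Ω)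
    {φ : E3 → ℝ} (hφ : Continuous φ) (hc : HasCompactSupport φ) (hs : tsupport φ ⊆ Ω) :
    Integrable (fun x => (φ x : ℂ) * u x) (volume.restrict Ω) := by
  have h1 : IntegrableOn u (tsupport φ) := hu.integrableOn_compact_subset hs hc
  have h2 : IntegrableOn (fun x => (φ x : ℂ) * u x) (tsupport φ) :=
    h1.continuousOn_mul (by fun_prop) hc
  refine (integrableOn_iff_integrable_of_support_subset ?_).1 h2 |>.integrableOn
  intro x hx
  apply subset_tsupport
  simp only [Function.mem_support] at hx ⊢
  intro h; apply hx; simp [h]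

lemma ae_eq_zero_of_integral_test {Ω : Set E3} (hΩ : IsOpen Ω) {g : E3 → ℂ}
    (hg : LocallyIntegrableOn g Ω)
    (h : ∀ φ : E3 → ℝ, ContDiff ℝ ∞ φ → HasCompactSupport φ → tsupport φ ⊆ Ω →
      ∫ x in Ω, (φ x : ℂ) * g x = 0) : g =ᵐ[volume.restrict Ω] 0 := by
  have := hΩ.ae_eq_zero_of_integral_contDiff_smul_eq_zero (μ := volume) hg (fun φ h1 h2 h3 => ?_)
  · rw [EventuallyEq, ae_restrict_iff' hΩ.measurableSet]
    exact this
  · rw [← h φ h1 h2 h3, setIntegral_eq_integral_of_forall_compl_eq_zero]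
    · simp
    · intro x hx
      rw [image_eq_zero_of_notMem_tsupport (fun h' => hx (h3 h'))]; simp

/-- Weak derivatives are unique almost everywhere. -/
lemma HasWeakDeriv.unique {Ω : Set E3} (hΩ : IsOpen Ω) {β : Fin 3 → ℕ} {u g g' : E3 → ℂ}
    (h : HasWeakDeriv Ω β u g) (h' : HasWeakDeriv Ω β u g') : g =ᵐ[volume.restrict Ω] g' := by
  have : (g - g') =ᵐ[volume.restrict Ω] 0 := by
    refine ae_eq_zero_of_integral_test hΩ (h.2.1.sub h'.2.1) fun φ h1 h2 h3 => ?_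
    have e1 := h.2.2 φ h1 h2 h3
    rw [h'.2.2 φ h1 h2 h3] at e1
    have e2 := mul_left_cancel₀ (pow_ne_zero _ (by norm_num)) e1
    simp only [Pi.sub_apply, mul_sub]
    rw [integral_sub (integrable_test_mul h.2.1 h1.continuous h2 h3)
      (integrable_test_mul h'.2.1 h1.continuous h2 h3), e2, sub_self]
  filter_upwards [this] with x hx
  exact sub_eq_zero.1 hx

lemma HasWeakDeriv.sub {Ω : Set E3} {β : Fin 3 → ℕ} {u v g h : E3 → ℂ}
    (hu : HasWeakDeriv Ω β u g) (hv : HasWeakDeriv Ω β v h) :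
    HasWeakDeriv Ω β (u - v) (g - h) := by
  refine ⟨hu.1.sub hv.1, hu.2.1.sub hv.2.1, fun φ h1 h2 h3 => ?_⟩
  have hs := (tsupport_multiDeriv_subset φ β).trans h3
  have hc : HasCompactSupport (multiDeriv β φ) :=
    h2.mono' ((subset_tsupport _).trans (tsupport_multiDeriv_subset φ β))
  have hd := (contDiff_multiDeriv h1 β).continuous
  simp only [Pi.sub_apply, mul_sub]
  rw [integral_sub (integrable_test_mul hu.1 hd hc hs)
      (integrable_test_mul hv.1 hd hc hs),
    integral_sub (integrable_test_mul hu.2.1 h1.continuous h2 h3)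
      (integrable_test_mul hv.2.1 h1.continuous h2 h3), hu.2.2 φ h1 h2 h3, hv.2.2 φ h1 h2 h3,
    mul_sub]

lemma HasWeakDeriv.zero_order {Ω : Set E3} {u : E3 → ℂ} (hu : LocallyIntegrableOn u Ω) :
    HasWeakDeriv Ω 0 u u :=
  ⟨hu, hu, fun φ _ _ _ => by simp [multiDeriv]⟩

lemma hasWeakDeriv_weakDeriv {Ω : Set E3} {β : Fin 3 → ℕ} {u : E3 → ℂ}
    (h : ∃ g, HasWeakDeriv Ω β u g) : HasWeakDeriv Ω β u (weakDeriv Ω β u) := by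
  unfold weakDeriv
  rw [dif_pos h]
  exact h.choose_spec

lemma HasWeakDeriv.weakDeriv_ae_eq {Ω : Set E3} (hΩ : IsOpen Ω) {β : Fin 3 → ℕ} {u g : E3 → ℂ}
    (h : HasWeakDeriv Ω β u g) : weakDeriv Ω β u =ᵐ[volume.restrict Ω] g :=
  (hasWeakDeriv_weakDeriv ⟨g, h⟩).unique hΩ h

section MemH

variable {m : ℕ} {Ω : Set E3} {u v : E3 → ℂ} {β : Fin 3 → ℕ}

lemma mem_multiIndices : β ∈ multiIndices m ↔ ∑ i, β i ≤ m := by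
  unfold multiIndices
  simp only [Finset.mem_filter, Fintype.mem_piFinset, Finset.mem_range, and_iff_right_iff_imp]
  intro h i
  exact Nat.lt_succ_of_le ((Finset.single_le_sum (fun _ _ => Nat.zero_le _)
    (Finset.mem_univ i)).trans h)

lemma MemH.hasWeakDeriv (hu : MemH m Ω u) (hβ : β ∈ multiIndices m) :
    HasWeakDeriv Ω β u (weakDeriv Ω β u) := by
  obtain ⟨g, hg, -⟩ := hu β hβ
  exact hasWeakDeriv_weakDeriv ⟨g, hg⟩

lemma MemH.memLp_weakDeriv (hΩ : IsOpen Ω) (hu : MemH m Ω u) (hβ : β ∈ multiIndices m) :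
    MemLp (weakDeriv Ω β u) 2 (volume.restrict Ω) := by
  obtain ⟨g, hg, hg'⟩ := hu β hβ
  exact (memLp_congr_ae (hg.weakDeriv_ae_eq hΩ)).2 hg'

lemma MemH.mono {m' : ℕ} (h : m' ≤ m) (hu : MemH m Ω u) : MemH m' Ω u := fun β hβ =>
  hu β (mem_multiIndices.2 ((mem_multiIndices.1 hβ).trans h))

lemma MemH.sub (hΩ : IsOpen Ω) (hu : MemH m Ω u) (hv : MemH m Ω v) : MemH m Ω (u - v) :=
  fun β hβ => ⟨weakDeriv Ω β u - weakDeriv Ω β v,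
    (hu.hasWeakDeriv hβ).sub (hv.hasWeakDeriv hβ),
    (hu.memLp_weakDeriv hΩ hβ).sub (hv.memLp_weakDeriv hΩ hβ)⟩

lemma MemH.weakDeriv_sub (hΩ : IsOpen Ω) (hu : MemH m Ω u) (hv : MemH m Ω v)
    (hβ : β ∈ multiIndices m) :
    weakDeriv Ω β (u - v) =ᵐ[volume.restrict Ω] weakDeriv Ω β u - weakDeriv Ω β v :=
  ((hu.hasWeakDeriv hβ).sub (hv.hasWeakDeriv hβ)).weakDeriv_ae_eq hΩ

lemma MemH.weakDeriv_zero_order (hΩ : IsOpen Ω) (hu : MemH m Ω u) :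
    weakDeriv Ω 0 u =ᵐ[volume.restrict Ω] u := by
  have h := hu.hasWeakDeriv (β := 0) (mem_multiIndices.2 (by simp))
  exact (HasWeakDeriv.zero_order h.1).weakDeriv_ae_eq hΩ

end MemH

/-- `g ∈ L²` is the weak partial derivative `∂_i f` of `f ∈ L²` in the cube. -/
structure IsWeakPartial (R : ℝ) (i : Fin 3) (f g : E3 → ℂ) : Prop where
  memLp : MemLp f 2 (volume.restrict (cube R))
  memLp_deriv : MemLp g 2 (volume.restrict (cube R))
  integral_eq : ∀ φ : E3 → ℝ, ContDiff ℝ ∞ φ → HasCompactSupport φ → tsupport φ ⊆ cube R →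
      ∫ x in cube R, (partialDeriv i φ x : ℂ) * f x = -∫ x in cube R, (φ x : ℂ) * g x

/-- Weak derivatives of consecutive orders are weak partial derivatives of one another. -/
lemma MemH.isWeakPartial {m : ℕ} {R : ℝ} {u : E3 → ℂ} (hu : MemH m (cube R) u)
    (β : Fin 3 → ℕ) (i : Fin 3) (hβ : β + Pi.single i 1 ∈ multiIndices m) :
    IsWeakPartial R i (weakDeriv (cube R) β u) (weakDeriv (cube R) (β + Pi.single i 1) u) := by
  have hβ' : β ∈ multiIndices m := by
    rw [mem_multiIndices] at hβ ⊢
    simp [Finset.sum_add_distrib] at hβ; omega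
  refine ⟨hu.memLp_weakDeriv (isOpen_cube R) hβ', hu.memLp_weakDeriv (isOpen_cube R) hβ,
    fun φ h1 h2 h3 => ?_⟩
  have e1 := (hu.hasWeakDeriv hβ).2.2 φ h1 h2 h3
  have e2 := (hu.hasWeakDeriv hβ').2.2 (partialDeriv i φ) (contDiff_partialDeriv h1 i)
    (hasCompactSupport_partialDeriv h2 i) ((tsupport_partialDeriv_subset φ i).trans h3)
  rw [← multiDeriv_add_single h1, e1] at e2
  have : ∑ j, (β + Pi.single i 1 : Fin 3 → ℕ) j = ∑ j, β j + 1 := by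
    simp [Finset.sum_add_distrib]
  rw [this, pow_succ, mul_assoc] at e2
  have e3 := mul_left_cancel₀ (pow_ne_zero _ (by norm_num)) e2
  rw [← e3]; ring

lemma IsWeakPartial.congr {R : ℝ} {i : Fin 3} {f f' g g' : E3 → ℂ} (h : IsWeakPartial R i f g)
    (hf : f =ᵐ[volume.restrict (cube R)] f') (hg : g =ᵐ[volume.restrict (cube R)] g') :
    IsWeakPartial R i f' g' := by
  refine ⟨(memLp_congr_ae hf).1 h.memLp, (memLp_congr_ae hg).1 h.memLp_deriv,
    fun φ h1 h2 h3 => ?_⟩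
  have e1 : ∫ x in cube R, (partialDeriv i φ x : ℂ) * f' x =
      ∫ x in cube R, (partialDeriv i φ x : ℂ) * f x :=
    integral_congr_ae (by filter_upwards [hf] with x hx; rw [hx])
  have e2 : ∫ x in cube R, (φ x : ℂ) * g' x = ∫ x in cube R, (φ x : ℂ) * g x :=
    integral_congr_ae (by filter_upwards [hg] with x hx; rw [hx])
  rw [e1, e2, h.integral_eq φ h1 h2 h3]

/-! ### Products of functions of one coordinate -/

/-- The product `x ↦ a₀(x₀) a₁(x₁) a₂(x₂)`. -/
def prodT (a : Fin 3 → ℝ → ℝ) (x : E3) : ℝ := ∏ i, a i (x i)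

lemma contDiff_prodT {a : Fin 3 → ℝ → ℝ} (ha : ∀ i, ContDiff ℝ ∞ (a i)) :
    ContDiff ℝ ∞ (prodT a) := by
  unfold prodT
  refine contDiff_prod fun i _ => (ha i).comp ?_
  fun_prop

lemma prodT_update (a : Fin 3 → ℝ → ℝ) (i : Fin 3) (p : ℝ → ℝ) (x : E3) :
    prodT (Function.update a i p) x = p (x i) * ∏ j ∈ Finset.univ.erase i, a j (x j) := by
  unfold prodT
  rw [← Finset.mul_prod_erase _ _ (Finset.mem_univ i), Function.update_self]
  congr 1
  refine Finset.prod_congr rfl fun j hj => ?_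
  rw [Function.update_of_ne (Finset.ne_of_mem_erase hj)]

lemma partialDeriv_prodT {a : Fin 3 → ℝ → ℝ} (ha : ∀ i, ContDiff ℝ ∞ (a i)) (i : Fin 3) :
    partialDeriv i (prodT a) = prodT (Function.update a i (deriv (a i))) := by
  funext x
  rw [prodT_update]
  have h : ∀ j ∈ Finset.univ, HasFDerivAt (fun x : E3 => a j (x j))
      ((deriv (a j) (x j)) • (EuclideanSpace.proj j : E3 →L[ℝ] ℝ)) x := by
    intro j _
    have h1 : HasDerivAt (a j) (deriv (a j) (x j)) (x j) :=
      (((ha j).differentiable (by simp)) _).hasDerivAt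
    have h2 : HasFDerivAt (fun x : E3 => x j) (EuclideanSpace.proj j : E3 →L[ℝ] ℝ) x :=
      (EuclideanSpace.proj j : E3 →L[ℝ] ℝ).hasFDerivAt
    exact h1.comp_hasFDerivAt x h2
  unfold partialDeriv
  have := (HasFDerivAt.finsetProd h).fderiv
  unfold prodT
  rw [this]
  simp [mul_comm]

/-! ### Smooth cutoffs -/

/-- A smooth step from `0` on `(-∞, 1]` to `1` on `[2, ∞)`. -/
noncomputable def smoothStep (t : ℝ) : ℝ := Real.smoothTransition (t - 1)

lemma contDiff_smoothStep : ContDiff ℝ ∞ smoothStep :=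
  Real.smoothTransition.contDiff.comp (by fun_prop)

lemma smoothStep_nonneg (t : ℝ) : 0 ≤ smoothStep t := Real.smoothTransition.nonneg _
lemma smoothStep_le_one (t : ℝ) : smoothStep t ≤ 1 := Real.smoothTransition.le_one _
lemma smoothStep_of_le {t : ℝ} (h : t ≤ 1) : smoothStep t = 0 :=
  Real.smoothTransition.zero_of_nonpos (by linarith)
lemma smoothStep_of_ge {t : ℝ} (h : 2 ≤ t) : smoothStep t = 1 :=
  Real.smoothTransition.one_of_one_le (by linarith)

lemma mem_of_deriv_smoothStep_ne {t : ℝ} (h : deriv smoothStep t ≠ 0) : 1 ≤ t ∧ t ≤ 2 := by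
  constructor
  · by_contra! ht
    apply h
    have : smoothStep =ᶠ[𝓝 t] fun _ => 0 := by
      filter_upwards [Iio_mem_nhds ht] with s hs using smoothStep_of_le (le_of_lt hs)
    rw [this.deriv_eq]; simp
  · by_contra! ht
    apply h
    have : smoothStep =ᶠ[𝓝 t] fun _ => 1 := by
      filter_upwards [Ioi_mem_nhds ht] with s hs using smoothStep_of_ge (le_of_lt hs)
    rw [this.deriv_eq]; simp

lemma contDiff_deriv {f : ℝ → ℝ} (hf : ContDiff ℝ ∞ f) : ContDiff ℝ ∞ (deriv f) :=
  (contDiff_infty_iff_deriv.1 hf).2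

lemma exists_deriv_smoothStep_le : ∃ C, 0 ≤ C ∧ ∀ t, |deriv smoothStep t| ≤ C := by
  obtain ⟨C, hC⟩ := (isCompact_Icc (a := (1 : ℝ)) (b := 2)).exists_bound_of_continuousOn
    (f := deriv smoothStep) (contDiff_deriv contDiff_smoothStep).continuous.continuousOn
  refine ⟨C, (norm_nonneg _).trans (hC 1 (by norm_num)), fun t => ?_⟩
  by_cases h : deriv smoothStep t = 0
  · rw [h, abs_zero]; exact (norm_nonneg _).trans (hC 1 (by norm_num))
  · exact hC t (mem_of_deriv_smoothStep_ne h)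

/-- A smooth cutoff, compactly supported in `(-R, R)`, that tends to `1` there as `k → ∞`. -/
noncomputable def cutoff (R : ℝ) (k : ℕ) (t : ℝ) : ℝ :=
  smoothStep (k * (R + t)) * smoothStep (k * (R - t))

/-- The part of the derivative of `cutoff R k` that lives near the end point `-σ R`, for
`σ = ±1`. -/
noncomputable def edge (R σ : ℝ) (k : ℕ) (t : ℝ) : ℝ :=
  k * deriv smoothStep (k * (R + σ * t)) * smoothStep (k * (R - σ * t))

lemma contDiff_cutoff (R : ℝ) (k : ℕ) : ContDiff ℝ ∞ (cutoff R k) :=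
  (contDiff_smoothStep.comp (by fun_prop)).mul (contDiff_smoothStep.comp (by fun_prop))

lemma contDiff_edge (R σ : ℝ) (k : ℕ) : ContDiff ℝ ∞ (edge R σ k) :=
  (contDiff_const.mul ((contDiff_deriv contDiff_smoothStep).comp (by fun_prop))).mul
    (contDiff_smoothStep.comp (by fun_prop))

lemma deriv_cutoff (R : ℝ) (k : ℕ) (t : ℝ) :
    deriv (cutoff R k) t = edge R 1 k t - edge R (-1) k t := by
  have hd : ∀ s, HasDerivAt smoothStep (deriv smoothStep s) s := fun s =>
    ((contDiff_smoothStep.differentiable (by simp)) s).hasDerivAt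
  have h1 : HasDerivAt (fun t => smoothStep (k * (R + t)))
      (deriv smoothStep (k * (R + t)) * (k * 1)) t :=
    (hd _).comp t (((hasDerivAt_id t).const_add R).const_mul (k : ℝ))
  have h2 : HasDerivAt (fun t => smoothStep (k * (R - t)))
      (deriv smoothStep (k * (R - t)) * (k * (-1))) t :=
    (hd _).comp t (((hasDerivAt_id t).const_sub R).const_mul (k : ℝ))
  have := (h1.mul h2).deriv
  unfold cutoff edge
  simp only [Pi.mul_def] at this
  rw [this]; simp only [one_mul, neg_mul, sub_neg_eq_add, ← sub_eq_add_neg]; ring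

lemma abs_cutoff_le (R : ℝ) (k : ℕ) (t : ℝ) : |cutoff R k t| ≤ 1 := by
  unfold cutoff
  rw [abs_of_nonneg (mul_nonneg (smoothStep_nonneg _) (smoothStep_nonneg _))]
  exact mul_le_one₀ (smoothStep_le_one _) (smoothStep_nonneg _) (smoothStep_le_one _)

lemma cutoff_eq_zero {R : ℝ} {k : ℕ} (hk : 0 < k) {t : ℝ} (ht : R - 1 / k ≤ |t|) :
    cutoff R k t = 0 := by
  have hk' : (0 : ℝ) < k := by exact_mod_cast hk
  unfold cutoff
  rcases le_abs.1 ht with h | h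
  · rw [smoothStep_of_le (t := k * (R - t)), mul_zero]
    calc k * (R - t) ≤ k * (1 / k) := by gcongr; linarith
      _ = 1 := by field_simp
  · rw [smoothStep_of_le (t := k * (R + t)), zero_mul]
    calc k * (R + t) ≤ k * (1 / k) := by gcongr; linarith
      _ = 1 := by field_simp

lemma eventually_cutoff_eq_one {R t : ℝ} (ht : |t| < R) : ∀ᶠ k in atTop, cutoff R k t = 1 := by
  obtain ⟨h1, h2⟩ := abs_lt.1 ht
  have l1 : Tendsto (fun k : ℕ => (k : ℝ) * (R + t)) atTop atTop :=
    tendsto_natCast_atTop_atTop.atTop_mul_const (by linarith)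
  have l2 : Tendsto (fun k : ℕ => (k : ℝ) * (R - t)) atTop atTop :=
    tendsto_natCast_atTop_atTop.atTop_mul_const (by linarith)
  filter_upwards [l1.eventually_ge_atTop 2, l2.eventually_ge_atTop 2] with k h3 h4
  rw [cutoff, smoothStep_of_ge h3, smoothStep_of_ge h4, one_mul]

lemma abs_add_le_of_edge_ne {R σ : ℝ} {k : ℕ} {t : ℝ} (h : edge R σ k t ≠ 0) :
    0 < k ∧ |R + σ * t| ≤ 2 / k := by
  unfold edge at h
  have hk : k ≠ 0 := by rintro rfl; simp at h
  have hk' : (0 : ℝ) < k := by exact_mod_cast Nat.pos_of_ne_zero hk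
  obtain ⟨h1, h2⟩ := mem_of_deriv_smoothStep_ne (right_ne_zero_of_mul (left_ne_zero_of_mul h))
  refine ⟨Nat.pos_of_ne_zero hk, ?_⟩
  rw [abs_of_nonneg (by by_contra! h3; nlinarith), le_div_iff₀ hk']
  linarith

lemma abs_edge_le {C : ℝ} (hC : ∀ t, |deriv smoothStep t| ≤ C) (R σ : ℝ) (k : ℕ) (t : ℝ) :
    |edge R σ k t| ≤ C * k := by
  unfold edge
  rw [abs_mul, abs_mul, Nat.abs_cast, abs_of_nonneg (smoothStep_nonneg _)]
  have h1 := hC (k * (R + σ * t))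
  have h2 := smoothStep_le_one (k * (R - σ * t))
  have h3 := smoothStep_nonneg (k * (R - σ * t))
  calc k * |deriv smoothStep (k * (R + σ * t))| * smoothStep (k * (R - σ * t))
      ≤ k * |deriv smoothStep (k * (R + σ * t))| * 1 := by gcongr
    _ ≤ C * k := by rw [mul_one, mul_comm]; gcongr

lemma tendsto_edge {R σ t : ℝ} (ht : 0 < R + σ * t) :
    Tendsto (fun k => edge R σ k t) atTop (𝓝 0) := by
  have l1 : Tendsto (fun k : ℕ => (k : ℝ) * (R + σ * t)) atTop atTop :=
    tendsto_natCast_atTop_atTop.atTop_mul_const ht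
  apply tendsto_const_nhds.congr'
  filter_upwards [l1.eventually_gt_atTop 2] with k h3
  by_contra h
  obtain ⟨h1, h2⟩ := abs_add_le_of_edge_ne (Ne.symm h)
  have hk' : (0 : ℝ) < k := by exact_mod_cast h1
  rw [abs_of_pos ht, le_div_iff₀ hk'] at h2
  linarith

/-! ### Limits of integrals against cutoffs -/

lemma volume_box_le (l u : Fin 3 → ℝ) (h : ∀ i, l i ≤ u i) :
    (volume {x : E3 | ∀ i, x i ∈ Set.Icc (l i) (u i)}) = ENNReal.ofReal (∏ i, (u i - l i)) := by
  have h1 : {x : E3 | ∀ i, x i ∈ Set.Icc (l i) (u i)} =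
      (WithLp.ofLp : E3 → (Fin 3 → ℝ)) ⁻¹' (Set.Icc l u) := by
    ext x; simp [Set.mem_Icc, Pi.le_def, forall_and]
  rw [h1, (PiLp.volume_preserving_ofLp (Fin 3)).measure_preimage
    measurableSet_Icc.nullMeasurableSet, Real.volume_Icc_pi,
    ENNReal.ofReal_prod_of_nonneg fun i _ => by linarith [h i]]

/-- If `f` has essential limit `0` at the points of a compact part of a face of the cube, then the
integrals of functions `F k`, of size `k |f|` and living in strips of width `1 / k` along that part
of the face, tend to `0`. -/
lemma tendsto_integral_strip {R r : ℝ} (hr : r ≤ R) (i : Fin 3) {s : ℝ} (hs : |s| = R)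
    {f : E3 → ℂ} (hf : ∀ p : E3, p i = s → (∀ j ≠ i, |p j| ≤ r) →
      Tendsto f (𝓝 p ⊓ ae (volume.restrict (cube R))) (𝓝 0))
    {C : ℝ} (hC : 0 ≤ C) (F : ℕ → E3 → ℂ) (hF : ∀ k, ∀ x ∈ cube R, ‖F k x‖ ≤ C * k * ‖f x‖)
    (hF0 : ∀ k, ∀ x ∈ cube R, F k x ≠ 0 → |x i - s| ≤ 2 / k ∧ ∀ j ≠ i, |x j| ≤ r) :
    Tendsto (fun k => ∫ x in cube R, F k x) atTop (𝓝 0) := by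
  have hR : 0 ≤ R := hs ▸ abs_nonneg s
  set K : Set E3 := {p | p i = s ∧ ∀ j ≠ i, |p j| ≤ r} with hK
  have hKc : IsCompact K := by
    apply Metric.isCompact_of_isClosed_isBounded
    · have : K = {p | p i = s} ∩ ⋂ j, ⋂ (_ : j ≠ i), {p : E3 | |p j| ≤ r} := by
        ext p; simp [hK]
      rw [this]
      refine (isClosed_eq (by fun_prop) continuous_const).inter (isClosed_iInter fun j =>
        isClosed_iInter fun _ => isClosed_le (by fun_prop) continuous_const)
    · refine (isBounded_cube (R + 1)).subset fun p hp j => ?_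
      by_cases hj : j = i
      · rw [hj, hp.1, hs]; linarith
      · linarith [hp.2 j hj]
  rw [Metric.tendsto_atTop]
  intro ε hε
  set η : ℝ := ε / (16 * (C + 1) * (R + 1) ^ 2 + 1) with hη
  have hηpos : 0 < η := by positivity
  -- near `K`, the function `f` is uniformly small
  obtain ⟨O, hO, hKO, hfO⟩ : ∃ O : Set E3, IsOpen O ∧ K ⊆ O ∧
      ∀ᵐ x ∂(volume.restrict (cube R)), x ∈ O → ‖f x‖ ≤ η := by
    refine hKc.induction_on (p := fun K => ∃ O : Set E3, IsOpen O ∧ K ⊆ O ∧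
      ∀ᵐ x ∂(volume.restrict (cube R)), x ∈ O → ‖f x‖ ≤ η) ⟨∅, isOpen_empty, le_rfl, by simp⟩
      ?_ ?_ ?_
    · rintro s t hst ⟨O, h1, h2, h3⟩
      exact ⟨O, h1, hst.trans h2, h3⟩
    · rintro s t ⟨O, h1, h2, h3⟩ ⟨O', h1', h2', h3'⟩
      refine ⟨O ∪ O', h1.union h1', Set.union_subset_union h2 h2', ?_⟩
      filter_upwards [h3, h3'] with x hx hx' h
      exact h.elim hx hx'
    · intro p hp
      have := (hf p hp.1 hp.2).eventually (Metric.closedBall_mem_nhds (0 : ℂ) hηpos)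
      rw [eventually_inf] at this
      obtain ⟨A, hA, B, hB, hAB⟩ := this
      obtain ⟨O, hOA, hO, hpO⟩ := mem_nhds_iff.1 hA
      refine ⟨O, mem_nhdsWithin_of_mem_nhds (hO.mem_nhds hpO), O, hO, le_rfl, ?_⟩
      filter_upwards [hB] with x hxB hxO
      have := hAB x ⟨hOA hxO, hxB⟩
      simpa using this
  obtain ⟨δ, hδ, hδO⟩ := hKc.exists_cthickening_subset_open hO hKO
  obtain ⟨k₀, hk₀⟩ := exists_nat_gt (2 / δ)
  refine ⟨k₀ + 1, fun k hk => ?_⟩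
  have hkpos : (0 : ℝ) < k := by exact_mod_cast (by omega : 0 < k)
  have hk2 : 2 / (k : ℝ) ≤ δ := by
    rw [div_le_iff₀ hkpos]
    have : (k₀ : ℝ) ≤ k := by exact_mod_cast (by omega : k₀ ≤ k)
    rw [div_lt_iff₀ hδ] at hk₀
    nlinarith
  set St : Set E3 := {x | ∀ j, x j ∈ Set.Icc (if j = i then s - 2 / k else -R)
    (if j = i then s + 2 / k else R)} with hSt
  have hStm : MeasurableSet St := by
    have : St = ⋂ j, {x : E3 | x j ∈ Set.Icc (if j = i then s - 2 / k else -R)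
        (if j = i then s + 2 / k else R)} := by ext x; simp [hSt]
    rw [this]
    exact MeasurableSet.iInter fun j => measurableSet_Icc.preimage (by fun_prop)
  have hvol : volume St ≤ ENNReal.ofReal (4 / k * (2 * R) ^ 2) := by
    rw [hSt, volume_box_le _ _ (by
      intro j; split_ifs
      · have : 0 < 2 / (k : ℝ) := by positivity
        linarith
      · linarith)]
    apply ENNReal.ofReal_le_ofReal
    rw [← Finset.mul_prod_erase _ _ (Finset.mem_univ i)]
    rw [Finset.prod_congr rfl (g := fun _ => 2 * R) (by
      intro j hj; rw [if_neg (Finset.ne_of_mem_erase hj), if_neg (Finset.ne_of_mem_erase hj)]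
      ring)]
    simp only [if_true, Finset.prod_const, Finset.card_erase_of_mem (Finset.mem_univ i),
      Finset.card_univ, Fintype.card_fin]
    apply le_of_eq; ring
  have hbound : ∀ᵐ x ∂(volume.restrict (cube R)),
      ‖F k x‖ ≤ St.indicator (fun _ => C * k * η) x := by
    filter_upwards [hfO, ae_restrict_mem (measurableSet_cube R)] with x hx hxc
    by_cases h0 : F k x = 0
    · rw [h0, norm_zero]
      exact Set.indicator_nonneg (fun _ _ => by positivity) _
    · obtain ⟨h1, h2⟩ := hF0 k x hxc h0
      have hxS : x ∈ St := by
        intro j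
        by_cases hj : j = i
        · subst hj; simp only [if_true]; rw [abs_le] at h1; constructor <;> linarith
        · simp only [hj, if_false]; exact abs_le.1 ((h2 j hj).trans hr)
      have hxO : x ∈ O := by
        apply hδO
        -- move `x` to the face along the `i`-th coordinate
        have hp : x + EuclideanSpace.single i (s - x i) ∈ K := by
          refine ⟨by simp, fun j hj => ?_⟩
          simpa [hj] using h2 j hj
        refine Metric.mem_cthickening_of_dist_le x _ δ K hp ?_
        rw [dist_comm, dist_eq_norm]
        simp only [add_sub_cancel_left, PiLp.norm_single, Real.norm_eq_abs]
        rw [abs_sub_comm]; exact h1.trans hk2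
      rw [Set.indicator_of_mem hxS]
      refine (hF k x hxc).trans ?_
      gcongr
      exact hx hxO
  rw [dist_zero_right]
  have hint : Integrable (St.indicator (fun _ => C * k * η)) (volume.restrict (cube R)) :=
    (integrable_const _).indicator hStm
  refine (norm_integral_le_of_norm_le hint hbound).trans_lt ?_
  rw [integral_indicator hStm, setIntegral_const, smul_eq_mul]
  have hm : (volume.restrict (cube R)).real St ≤ 4 / k * (2 * R) ^ 2 := by
    apply ENNReal.toReal_le_of_le_ofReal (by positivity)
    exact (Measure.restrict_apply_le _ _).trans hvol
  calc (volume.restrict (cube R)).real St * (C * k * η)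
      ≤ (4 / k * (2 * R) ^ 2) * (C * k * η) := by gcongr
    _ = (16 * C * R ^ 2) * η := by field_simp; ring
    _ < (16 * (C + 1) * (R + 1) ^ 2 + 1) * η := by
        apply mul_lt_mul_of_pos_right _ hηpos
        nlinarith [mul_nonneg hC (sq_nonneg R), mul_nonneg hC hR]
    _ = ε := by rw [hη]; field_simp

/-- Dominated convergence for integrals against products of functions of one coordinate. -/
lemma tendsto_integral_prodT {R B : ℝ} {f : E3 → ℂ} (hf : Integrable f (volume.restrict (cube R)))
    (c : ℕ → Fin 3 → ℝ → ℝ) (c' : Fin 3 → ℝ → ℝ) (hc : ∀ k j, Continuous (c k j))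
    (hB : ∀ k j t, |t| < R → |c k j t| ≤ B)
    (hlim : ∀ j t, |t| < R → Tendsto (fun k => c k j t) atTop (𝓝 (c' j t))) :
    Tendsto (fun k => ∫ x in cube R, (prodT (c k) x : ℂ) * f x) atTop
      (𝓝 (∫ x in cube R, (prodT c' x : ℂ) * f x)) := by
  have hcont : ∀ k, Continuous (prodT (c k)) := fun k => by
    unfold prodT
    exact continuous_finsetProd _ fun j _ => (hc k j).comp (by fun_prop)
  refine tendsto_integral_of_dominated_convergence (fun x => B ^ 3 * ‖f x‖) (fun k => ?_)
    (hf.norm.const_mul _) (fun k => ?_) ?_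
  · exact (Complex.continuous_ofReal.comp (hcont k)).aestronglyMeasurable.mul hf.1
  · filter_upwards [ae_restrict_mem (measurableSet_cube R)] with x hx
    rw [norm_mul, Complex.norm_real, Real.norm_eq_abs]
    gcongr
    unfold prodT
    rw [Finset.abs_prod]
    calc ∏ i, |c k i (x i)| ≤ ∏ _i : Fin 3, B :=
          Finset.prod_le_prod (fun _ _ => abs_nonneg _) fun i _ => hB k i _ (hx i)
      _ = B ^ 3 := by simp
  · filter_upwards [ae_restrict_mem (measurableSet_cube R)] with x hx
    refine Tendsto.mul ?_ tendsto_const_nhds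
    refine (Complex.continuous_ofReal.tendsto _).comp ?_
    unfold prodT
    exact tendsto_finsetProd _ fun i _ => hlim i _ (hx i)

/-! ### Integration by parts in the cube -/

lemma exists_bound_of_continuous {a : Fin 3 → ℝ → ℝ} (ha : ∀ i, Continuous (a i)) (R : ℝ) :
    ∃ B, 0 ≤ B ∧ ∀ i t, |t| < R → |a i t| ≤ B := by
  have h : ∀ i, ∃ B, ∀ t ∈ Set.Icc (-R) R, ‖a i t‖ ≤ B := fun i =>
    isCompact_Icc.exists_bound_of_continuousOn (ha i).continuousOn
  choose B hB using h
  refine ⟨∑ i, |B i|, Finset.sum_nonneg fun _ _ => abs_nonneg _, fun i t ht => ?_⟩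
  exact ((hB i t (abs_le.1 ht.le)).trans (le_abs_self _)).trans
    (Finset.single_le_sum (f := fun i => |B i|) (fun _ _ => abs_nonneg _) (Finset.mem_univ i))

lemma contDiff_update {a : Fin 3 → ℝ → ℝ} (ha : ∀ i, ContDiff ℝ ∞ (a i)) (i : Fin 3) {p : ℝ → ℝ}
    (hp : ContDiff ℝ ∞ p) (j : Fin 3) : ContDiff ℝ ∞ (Function.update a i p j) := by
  by_cases hj : j = i
  · subst hj; simpa using hp
  · simpa [hj] using ha j

lemma IsWeakPartial.integrable {R : ℝ} {i : Fin 3} {f g : E3 → ℂ} (h : IsWeakPartial R i f g) :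
    Integrable f (volume.restrict (cube R)) := h.memLp.integrable one_le_two

lemma IsWeakPartial.integrable_deriv {R : ℝ} {i : Fin 3} {f g : E3 → ℂ}
    (h : IsWeakPartial R i f g) : Integrable g (volume.restrict (cube R)) :=
  h.memLp_deriv.integrable one_le_two

lemma integrable_prodT_mul {R : ℝ} {f : E3 → ℂ} (hf : Integrable f (volume.restrict (cube R)))
    {a : Fin 3 → ℝ → ℝ} (ha : ∀ i, Continuous (a i)) :
    Integrable (fun x => (prodT a x : ℂ) * f x) (volume.restrict (cube R)) := by
  obtain ⟨B, hB0, hB⟩ := exists_bound_of_continuous ha R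
  have hcont : Continuous (prodT a) := by
    unfold prodT
    exact continuous_finsetProd _ fun j _ => (ha j).comp (by fun_prop)
  refine hf.bdd_mul (c := B ^ 3) (Complex.continuous_ofReal.comp hcont).aestronglyMeasurable ?_
  filter_upwards [ae_restrict_mem (measurableSet_cube R)] with x hx
  simp only [Complex.norm_real, Real.norm_eq_abs]
  unfold prodT
  rw [Finset.abs_prod]
  calc ∏ i, |a i (x i)| ≤ ∏ _i : Fin 3, B :=
        Finset.prod_le_prod (fun _ _ => abs_nonneg _) fun i _ => hB i _ (hx i)
    _ = B ^ 3 := by simp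

lemma IsWeakPartial.integral_prodT_of_compact {R r : ℝ} (hr : r < R) {i : Fin 3} {f g : E3 → ℂ}
    (h : IsWeakPartial R i f g) {a : Fin 3 → ℝ → ℝ} (ha : ∀ i, ContDiff ℝ ∞ (a i))
    (hz : ∀ j t, r ≤ |t| → a j t = 0) :
    ∫ x in cube R, (prodT (Function.update a i (deriv (a i))) x : ℂ) * f x =
      -∫ x in cube R, (prodT a x : ℂ) * g x := by
  have hsub : tsupport (prodT a) ⊆ {x : E3 | ∀ j, |x j| ≤ r} := by
    apply closure_minimal
    · intro x hx j
      by_contra! hj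
      exact hx (Finset.prod_eq_zero (Finset.mem_univ j) (hz j _ hj.le))
    · have : {x : E3 | ∀ j, |x j| ≤ r} = ⋂ j, {x : E3 | |x j| ≤ r} := by ext x; simp
      rw [this]
      exact isClosed_iInter fun j => isClosed_le (by fun_prop) continuous_const
  have hsub' : tsupport (prodT a) ⊆ cube R := fun x hx j => (hsub hx j).trans_lt hr
  rw [← partialDeriv_prodT ha]
  refine h.integral_eq _ (contDiff_prodT ha) ?_ hsub'
  exact Metric.isCompact_of_isClosed_isBounded (isClosed_tsupport _)
    ((isBounded_cube R).subset hsub')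

/-- The functions `a j`, cut off near `±R` for `j ≠ i`. -/
noncomputable def cutOthers (R : ℝ) (i : Fin 3) (a : Fin 3 → ℝ → ℝ) (k : ℕ) (j : Fin 3) : ℝ → ℝ :=
  if j = i then a i else fun t => cutoff R k t * a j t

lemma cutOthers_self (R : ℝ) (i : Fin 3) (a : Fin 3 → ℝ → ℝ) (k : ℕ) :
    cutOthers R i a k i = a i := by simp [cutOthers]

lemma cutOthers_of_ne (R : ℝ) {i j : Fin 3} (hj : j ≠ i) (a : Fin 3 → ℝ → ℝ) (k : ℕ) (t : ℝ) :
    cutOthers R i a k j t = cutoff R k t * a j t := by simp [cutOthers, hj]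

lemma contDiff_cutOthers (R : ℝ) (i : Fin 3) {a : Fin 3 → ℝ → ℝ} (ha : ∀ i, ContDiff ℝ ∞ (a i))
    (k : ℕ) (j : Fin 3) : ContDiff ℝ ∞ (cutOthers R i a k j) := by
  unfold cutOthers
  split_ifs
  · exact ha i
  · exact (contDiff_cutoff R k).mul (ha j)

/-- Cutoffs in the directions in which no derivative is taken can be removed. -/
lemma IsWeakPartial.integral_prodT_of_cutOthers {R : ℝ} {i : Fin 3} {f g : E3 → ℂ}
    (h : IsWeakPartial R i f g) {a : Fin 3 → ℝ → ℝ} (ha : ∀ i, ContDiff ℝ ∞ (a i))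
    (H : ∀ k : ℕ, 0 < k →
      ∫ x in cube R, (prodT (Function.update (cutOthers R i a k) i (deriv (a i))) x : ℂ) * f x =
      -∫ x in cube R, (prodT (cutOthers R i a k) x : ℂ) * g x) :
    ∫ x in cube R, (prodT (Function.update a i (deriv (a i))) x : ℂ) * f x =
      -∫ x in cube R, (prodT a x : ℂ) * g x := by
  obtain ⟨B, hB0, hB⟩ := exists_bound_of_continuous (fun j => (ha j).continuous) R
  obtain ⟨B', hB0', hB'⟩ := exists_bound_of_continuous
    (fun j => (contDiff_deriv (ha j)).continuous) R
  have hbB : ∀ k j t, |t| < R → |cutOthers R i a k j t| ≤ B := by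
    intro k j t ht
    unfold cutOthers; split_ifs
    · exact hB i t ht
    · rw [abs_mul]
      calc |cutoff R k t| * |a j t| ≤ 1 * B :=
            mul_le_mul (abs_cutoff_le R k t) (hB j t ht) (abs_nonneg _) zero_le_one
        _ = B := one_mul B
  have hblim : ∀ j t, |t| < R → Tendsto (fun k => cutOthers R i a k j t) atTop (𝓝 (a j t)) := by
    intro j t ht
    unfold cutOthers; split_ifs with hj
    · subst hj; exact tendsto_const_nhds
    · apply tendsto_const_nhds.congr'
      filter_upwards [eventually_cutoff_eq_one ht] with k hk
      rw [hk, one_mul]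
  have L1 := tendsto_integral_prodT h.integrable_deriv (cutOthers R i a) a
    (fun k j => (contDiff_cutOthers R i ha k j).continuous) hbB hblim
  have L2 := tendsto_integral_prodT (B := max B B') h.integrable
    (fun k => Function.update (cutOthers R i a k) i (deriv (a i)))
    (Function.update a i (deriv (a i)))
    (fun k j => (contDiff_update (contDiff_cutOthers R i ha k) i
      (contDiff_deriv (ha i)) j).continuous)
    (fun k j t ht => by
      by_cases hj : j = i
      · subst hj; simp only [Function.update_self]; exact (hB' j t ht).trans (le_max_right _ _)
      · simp only [Function.update_of_ne hj]; exact (hbB k j t ht).trans (le_max_left _ _))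
    (fun j t ht => by
      by_cases hj : j = i
      · subst hj; simp only [Function.update_self]; exact tendsto_const_nhds
      · simp only [Function.update_of_ne hj]; exact hblim j t ht)
  refine tendsto_nhds_unique L2 (L1.neg.congr' ?_)
  filter_upwards [eventually_gt_atTop 0] with k hk using (H k hk).symm

/-- The test function has to vanish near the two faces `x_i = ±R` only. -/
lemma IsWeakPartial.integral_prodT_of_vanish {R r : ℝ} (hr : r < R) {i : Fin 3} {f g : E3 → ℂ}
    (h : IsWeakPartial R i f g) {a : Fin 3 → ℝ → ℝ} (ha : ∀ i, ContDiff ℝ ∞ (a i))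
    (hz : ∀ t, r ≤ |t| → a i t = 0) :
    ∫ x in cube R, (prodT (Function.update a i (deriv (a i))) x : ℂ) * f x =
      -∫ x in cube R, (prodT a x : ℂ) * g x := by
  refine h.integral_prodT_of_cutOthers ha fun k hk => ?_
  have := h.integral_prodT_of_compact (r := max r (R - 1 / k)) (max_lt hr (by simp [hk]))
    (contDiff_cutOthers R i ha k) (by
      intro j t ht
      by_cases hj : j = i
      · subst hj; rw [cutOthers_self]; exact hz t ((le_max_left _ _).trans ht)
      · rw [cutOthers_of_ne R hj, cutoff_eq_zero hk ((le_max_right _ _).trans ht), zero_mul])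
  rwa [cutOthers_self] at this

/-- Integration by parts in direction `i` against a smooth product holds as soon as the two boundary
terms, at the faces `x_i = ∓R`, vanish in the limit. -/
lemma IsWeakPartial.integral_prodT {R : ℝ} {i : Fin 3} {f g : E3 → ℂ}
    (h : IsWeakPartial R i f g) {a : Fin 3 → ℝ → ℝ} (ha : ∀ i, ContDiff ℝ ∞ (a i))
    (hbd : ∀ σ : ℝ, σ = 1 ∨ σ = -1 → Tendsto (fun k => ∫ x in cube R,
      (prodT (Function.update a i (fun t => edge R σ k t * a i t)) x : ℂ) * f x) atTop (𝓝 0)) :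
    ∫ x in cube R, (prodT (Function.update a i (deriv (a i))) x : ℂ) * f x =
      -∫ x in cube R, (prodT a x : ℂ) * g x := by
  obtain ⟨B, hB0, hB⟩ := exists_bound_of_continuous (fun j => (ha j).continuous) R
  obtain ⟨B', hB0', hB'⟩ := exists_bound_of_continuous
    (fun j => (contDiff_deriv (ha j)).continuous) R
  have key : ∀ p : ℝ → ℝ, ContDiff ℝ ∞ p → ∀ B', (∀ t, |t| < R → |p t| ≤ B') → ∀ {f : E3 → ℂ},
      Integrable f (volume.restrict (cube R)) →
      Tendsto (fun k => ∫ x in cube R,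
        (prodT (Function.update a i (fun t => cutoff R k t * p t)) x : ℂ) * f x) atTop
        (𝓝 (∫ x in cube R, (prodT (Function.update a i p) x : ℂ) * f x)) := by
    intro p hp B' hB' f hf
    refine tendsto_integral_prodT (B := max B B') hf _ _ (fun k j =>
      (contDiff_update ha i ((contDiff_cutoff R k).mul hp) j).continuous) ?_ ?_
    · intro k j t ht
      by_cases hj : j = i
      · subst hj; simp only [Function.update_self]
        rw [abs_mul]
        refine le_trans ?_ (le_max_right B B')
        calc |cutoff R k t| * |p t| ≤ 1 * B' :=
            mul_le_mul (abs_cutoff_le R k t) (hB' t ht) (abs_nonneg _) zero_le_one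
          _ = B' := one_mul B'
      · simp only [Function.update_of_ne hj]
        exact (hB j t ht).trans (le_max_left _ _)
    · intro j t ht
      by_cases hj : j = i
      · subst hj; simp only [Function.update_self]
        apply tendsto_const_nhds.congr'
        filter_upwards [eventually_cutoff_eq_one ht] with k hk
        rw [hk, one_mul]
      · simp only [Function.update_of_ne hj]; exact tendsto_const_nhds
  have L1 := key (a i) (ha i) B (hB i) h.integrable_deriv
  have L2 := key (deriv (a i)) (contDiff_deriv (ha i)) B' (hB' i) h.integrable
  have L3 := ((hbd 1 (Or.inl rfl)).sub (hbd (-1) (Or.inr rfl))).add L2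
  rw [sub_zero, zero_add] at L3
  rw [Function.update_eq_self] at L1
  refine tendsto_nhds_unique L3 (L1.neg.congr' ?_)
  filter_upwards [eventually_gt_atTop 0] with k hk
  have hk' : (0 : ℝ) < k := by exact_mod_cast hk
  have hcs : ∀ j, ContDiff ℝ ∞ (Function.update a i (fun t => cutoff R k t * a i t) j) :=
    contDiff_update ha i ((contDiff_cutoff R k).mul (ha i))
  have := h.integral_prodT_of_vanish (r := R - 1 / k) (by simp [hk]) hcs (by
    intro t ht
    simp [cutoff_eq_zero hk ht])
  rw [← this]
  have hint : ∀ p : ℝ → ℝ, ContDiff ℝ ∞ p →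
      Integrable (fun x => (prodT (Function.update a i p) x : ℂ) * f x)
        (volume.restrict (cube R)) := fun p hp =>
    integrable_prodT_mul h.integrable fun j => (contDiff_update ha i hp j).continuous
  have i1 := hint _ ((contDiff_edge R 1 k).mul (ha i))
  have i2 := hint _ ((contDiff_edge R (-1) k).mul (ha i))
  have i3 := hint _ ((contDiff_cutoff R k).mul (contDiff_deriv (ha i)))
  have i12 := i1.sub i2
  simp only [Pi.sub_def] at i12
  rw [← integral_sub i1 i2, ← integral_add i12 i3]
  congr 1
  funext x
  simp only [Function.update_idem, Function.update_self, prodT_update]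
  have hd : deriv (fun t => cutoff R k t * a i t) (x i) =
      (edge R 1 k (x i) - edge R (-1) k (x i)) * a i (x i) +
        cutoff R k (x i) * deriv (a i) (x i) := by
    rw [← deriv_cutoff]
    exact deriv_fun_mul ((contDiff_cutoff R k).differentiable (by simp) _)
      ((ha i).differentiable (by simp) _)
  rw [hd]
  push_cast
  ring

/-- The boundary term vanishes if the test function vanishes on the face `x_i = -σ R`. -/
lemma tendsto_edge_of_eq_zero {R : ℝ} (hR : 0 < R) {i : Fin 3} {f : E3 → ℂ}
    (hf : Integrable f (volume.restrict (cube R))) {a : Fin 3 → ℝ → ℝ}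
    (ha : ∀ i, ContDiff ℝ ∞ (a i)) {σ : ℝ} (hσ : σ = 1 ∨ σ = -1) (h0 : a i (-σ * R) = 0) :
    Tendsto (fun k => ∫ x in cube R,
      (prodT (Function.update a i (fun t => edge R σ k t * a i t)) x : ℂ) * f x) atTop (𝓝 0) := by
  obtain ⟨B, hB0, hB⟩ := exists_bound_of_continuous (fun j => (ha j).continuous) R
  obtain ⟨C, hC0, hC⟩ := exists_deriv_smoothStep_le
  obtain ⟨M, hM⟩ := (isCompact_Icc (a := -R) (b := R)).exists_bound_of_continuousOn
    (f := deriv (a i)) (contDiff_deriv (ha i)).continuous.continuousOn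
  have hM0 : 0 ≤ M := (norm_nonneg _).trans (hM 0 ⟨by linarith, hR.le⟩)
  have hLip : ∀ t, |t| < R → |a i t| ≤ M * |R + σ * t| := by
    intro t ht
    have h1 := (convex_Icc (-R) R).norm_image_sub_le_of_norm_deriv_le (f := a i) (C := M)
      (x := -σ * R) (y := t)
      (fun x _ => (ha i).differentiable (by simp) x) hM
      (by rcases hσ with rfl | rfl <;> constructor <;> linarith) (abs_le.1 ht.le)
    rw [h0, sub_zero, Real.norm_eq_abs, Real.norm_eq_abs] at h1
    convert h1 using 2
    rcases hσ with rfl | rfl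
    · congr 1; ring
    · rw [abs_sub_comm]; congr 1; ring
  have := tendsto_integral_prodT (B := max B (2 * C * M)) hf
    (fun k => Function.update a i (fun t => edge R σ k t * a i t))
    (Function.update a i (fun _ => 0))
    (fun k j => (contDiff_update ha i ((contDiff_edge R σ k).mul (ha i)) j).continuous)
    (fun k j t ht => by
      by_cases hj : j = i
      · subst hj; simp only [Function.update_self]
        refine le_trans ?_ (le_max_right _ _)
        by_cases he : edge R σ k t = 0
        · rw [he, zero_mul, abs_zero]; positivity
        · obtain ⟨h1, h2⟩ := abs_add_le_of_edge_ne he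
          have hk' : (0 : ℝ) < k := by exact_mod_cast h1
          rw [abs_mul]
          calc |edge R σ k t| * |a j t| ≤ (C * k) * (M * (2 / k)) :=
                mul_le_mul (abs_edge_le hC R σ k t) ((hLip t ht).trans (by gcongr)) (abs_nonneg _)
                  (by positivity)
            _ = 2 * C * M := by field_simp
      · simp only [Function.update_of_ne hj]
        exact (hB j t ht).trans (le_max_left _ _))
    (fun j t ht => by
      by_cases hj : j = i
      · subst hj; simp only [Function.update_self]
        have hpos : 0 < R + σ * t := by
          obtain ⟨h1, h2⟩ := abs_lt.1 ht
          rcases hσ with rfl | rfl <;> linarith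
        simpa using (tendsto_edge hpos).mul_const (a j t)
      · simp only [Function.update_of_ne hj]; exact tendsto_const_nhds)
  convert this using 2
  simp [prodT_update]

/-- The boundary term vanishes if `f` tends to zero at the part of the face `x_i = -σ R` that meets
the support of the test function. -/
lemma tendsto_edge_of_tendsto {R r : ℝ} (hR : 0 < R) (hr : r ≤ R) {i : Fin 3} {f : E3 → ℂ}
    {a : Fin 3 → ℝ → ℝ} (ha : ∀ i, ContDiff ℝ ∞ (a i)) {σ : ℝ} (hσ : σ = 1 ∨ σ = -1)
    (hz : ∀ j ≠ i, ∀ t, r < |t| → |t| < R → a j t = 0)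
    (hf : ∀ p : E3, p i = -σ * R → (∀ j ≠ i, |p j| ≤ r) →
      Tendsto f (𝓝 p ⊓ ae (volume.restrict (cube R))) (𝓝 0)) :
    Tendsto (fun k => ∫ x in cube R,
      (prodT (Function.update a i (fun t => edge R σ k t * a i t)) x : ℂ) * f x) atTop (𝓝 0) := by
  obtain ⟨B, hB0, hB⟩ := exists_bound_of_continuous (fun j => (ha j).continuous) R
  obtain ⟨C, hC0, hC⟩ := exists_deriv_smoothStep_le
  refine tendsto_integral_strip hr i (s := -σ * R) ?_ hf (C := C * B * B ^ 2)
    (by positivity) _ ?_ ?_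
  · rcases hσ with rfl | rfl <;> simp [abs_of_pos hR]
  · intro k x hx
    rw [norm_mul, Complex.norm_real, Real.norm_eq_abs, prodT_update, abs_mul, abs_mul,
      Finset.abs_prod]
    refine mul_le_mul_of_nonneg_right ?_ (norm_nonneg _)
    have h1 : ∏ j ∈ Finset.univ.erase i, |a j (x j)| ≤ B ^ 2 := by
      calc ∏ j ∈ Finset.univ.erase i, |a j (x j)| ≤ ∏ _j ∈ Finset.univ.erase i, B :=
          Finset.prod_le_prod (fun _ _ => abs_nonneg _) fun j _ => hB j _ (hx j)
        _ = B ^ 2 := by simp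
    calc |edge R σ k (x i)| * |a i (x i)| * ∏ j ∈ Finset.univ.erase i, |a j (x j)|
        ≤ (C * k) * B * B ^ 2 := by
          gcongr
          · exact abs_edge_le hC _ _ _ _
          · exact hB i _ (hx i)
      _ = C * B * B ^ 2 * k := by ring
  · intro k x hx hne
    have hp : prodT (Function.update a i fun t => edge R σ k t * a i t) x ≠ 0 := by
      intro h; apply hne; rw [h]; simp
    rw [prodT_update] at hp
    constructor
    · have := (abs_add_le_of_edge_ne (left_ne_zero_of_mul (left_ne_zero_of_mul hp))).2
      convert this using 1
      rcases hσ with rfl | rfl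
      · congr 1; ring
      · rw [abs_sub_comm]; congr 1; ring
    · intro j hj
      by_contra! hlt
      exact Finset.prod_ne_zero_iff.1 (right_ne_zero_of_mul hp) j (by simp [hj])
        (hz j hj _ hlt (hx j))

lemma mem_frontier_cube {R : ℝ} (hR : 0 < R) {p : E3} {i : Fin 3} (hi : |p i| = R)
    (hp : ∀ j ≠ i, |p j| ≤ R) : p ∈ frontier (cube R) := by
  rw [(isOpen_cube R).frontier_eq]
  refine ⟨?_, fun h => (h i).ne hi⟩
  have hle : ∀ j, |p j| ≤ R := fun j => by
    by_cases hj : j = i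
    · rw [hj, hi]
    · exact hp j hj
  have hlim : Tendsto (fun n : ℕ => (1 - 1 / ((n : ℝ) + 1)) • p) atTop (𝓝 p) := by
    have : Tendsto (fun n : ℕ => (1 - 1 / ((n : ℝ) + 1))) atTop (𝓝 (1 - 0)) :=
      tendsto_const_nhds.sub tendsto_one_div_add_atTop_nhds_zero_nat
    simpa using this.smul_const p
  refine mem_closure_of_tendsto hlim (Eventually.of_forall fun n j => ?_)
  have h1 : (0 : ℝ) < 1 / ((n : ℝ) + 1) := by positivity
  have h2 : 1 / ((n : ℝ) + 1) ≤ 1 := by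
    rw [div_le_one (by positivity)]; linarith [(Nat.cast_nonneg n : (0 : ℝ) ≤ n)]
  rw [PiLp.smul_apply, smul_eq_mul, abs_mul, abs_of_nonneg (by linarith)]
  calc (1 - 1 / ((n : ℝ) + 1)) * |p j| ≤ (1 - 1 / ((n : ℝ) + 1)) * R := by
        refine mul_le_mul_of_nonneg_left (hle j) (by linarith)
    _ < R := by nlinarith

/-- `u` has zero boundary values on the boundary of the cube. -/
def VanishesOnBoundary (R : ℝ) (u : E3 → ℂ) : Prop :=
  ∀ p ∈ frontier (cube R), Tendsto u (𝓝 p ⊓ ae (volume.restrict (cube R))) (𝓝 0)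

lemma VanishesOnBoundary.tendsto_edge {R : ℝ} (hR : 0 < R) {u : E3 → ℂ}
    (hu : VanishesOnBoundary R u) {i : Fin 3} {a : Fin 3 → ℝ → ℝ} (ha : ∀ i, ContDiff ℝ ∞ (a i))
    (σ : ℝ) (hσ : σ = 1 ∨ σ = -1) :
    Tendsto (fun k => ∫ x in cube R,
      (prodT (Function.update a i (fun t => edge R σ k t * a i t)) x : ℂ) * u x) atTop (𝓝 0) := by
  refine tendsto_edge_of_tendsto hR le_rfl ha hσ (fun j _ t h1 h2 => absurd h1 h2.not_gt)
    fun p hp hp' => hu p (mem_frontier_cube hR (i := i) ?_ hp')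
  rw [hp]
  rcases hσ with rfl | rfl <;> simp [abs_of_pos hR]

/-- Integration by parts for functions with zero boundary values. -/
lemma IsWeakPartial.integral_prodT_of_vanishes {R : ℝ} (hR : 0 < R) {i : Fin 3} {f g : E3 → ℂ}
    (h : IsWeakPartial R i f g) (hf : VanishesOnBoundary R f) {a : Fin 3 → ℝ → ℝ}
    (ha : ∀ i, ContDiff ℝ ∞ (a i)) :
    ∫ x in cube R, (prodT (Function.update a i (deriv (a i))) x : ℂ) * f x =
      -∫ x in cube R, (prodT a x : ℂ) * g x :=
  h.integral_prodT ha (hf.tendsto_edge hR ha)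

/-- Integration by parts against test functions that vanish on the faces `x_i = ±R`. -/
lemma IsWeakPartial.integral_prodT_of_test_vanishes {R : ℝ} (hR : 0 < R) {i : Fin 3}
    {f g : E3 → ℂ} (h : IsWeakPartial R i f g) {a : Fin 3 → ℝ → ℝ}
    (ha : ∀ i, ContDiff ℝ ∞ (a i)) (h0 : a i (-R) = 0) (h1 : a i R = 0) :
    ∫ x in cube R, (prodT (Function.update a i (deriv (a i))) x : ℂ) * f x =
      -∫ x in cube R, (prodT a x : ℂ) * g x :=
  h.integral_prodT ha fun σ hσ => tendsto_edge_of_eq_zero hR h.integrable ha hσ (by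
    rcases hσ with rfl | rfl <;> simpa)

/-- Integration by parts for mixed derivatives of functions with zero boundary values. That the
tangential derivative `∂_i u` vanishes on the faces `x_j = ±R` is seen by moving `∂_i` to the
boundary term. -/
lemma IsWeakPartial.integral_prodT_mixed {R : ℝ} (hR : 0 < R) {i j : Fin 3} (hij : i ≠ j)
    {u ui uij : E3 → ℂ} (h : IsWeakPartial R i u ui) (h' : IsWeakPartial R j ui uij)
    (hu : VanishesOnBoundary R u) {a : Fin 3 → ℝ → ℝ} (ha : ∀ i, ContDiff ℝ ∞ (a i)) :
    ∫ x in cube R,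
        (prodT (Function.update (Function.update a j (deriv (a j))) i (deriv (a i))) x : ℂ) * u x =
      ∫ x in cube R, (prodT a x : ℂ) * uij x := by
  have e1 := h'.integral_prodT ha fun σ hσ => ?_
  · have e2 := h.integral_prodT_of_vanishes hR hu
      (contDiff_update ha j (contDiff_deriv (ha j)))
    rw [e1, neg_neg, Function.update_of_ne hij] at e2
    exact e2
  · have : ∀ k, ∫ x in cube R,
        (prodT (Function.update a j (fun t => edge R σ k t * a j t)) x : ℂ) * ui x =
        -∫ x in cube R, (prodT (Function.update (Function.update a i (deriv (a i))) j
          (fun t => edge R σ k t * (Function.update a i (deriv (a i)) j) t)) x : ℂ) * u x := by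
      intro k
      have e := h.integral_prodT_of_vanishes hR hu
        (contDiff_update ha j ((contDiff_edge R σ k).mul (ha j)))
      rw [Function.update_of_ne hij, Function.update_comm hij.symm] at e
      rw [Function.update_of_ne hij.symm, e, neg_neg]
    simp_rw [this]
    simpa using (hu.tendsto_edge hR (i := j)
      (contDiff_update ha i (contDiff_deriv (ha i))) σ hσ).neg

/-- Integration by parts in the direction `z` for functions that vanish on the lower face, against
test functions that vanish on the upper face. -/
lemma IsWeakPartial.integral_prodT_of_lowerFace {R : ℝ} (hR : 0 < R)
    {f g : E3 → ℂ} (h : IsWeakPartial R 2 f g)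
    (hf : ∀ p ∈ lowerFace R, Tendsto f (𝓝 p ⊓ ae (volume.restrict (cube R))) (𝓝 0))
    {a : Fin 3 → ℝ → ℝ} (ha : ∀ i, ContDiff ℝ ∞ (a i)) (h1 : a 2 R = 0) :
    ∫ x in cube R, (prodT (Function.update a 2 (deriv (a 2))) x : ℂ) * f x =
      -∫ x in cube R, (prodT a x : ℂ) * g x := by
  -- the horizontal cutoffs keep the test function away from the edges of the lower face
  refine h.integral_prodT_of_cutOthers ha fun k hk => ?_
  have hk' : (0 : ℝ) < k := by exact_mod_cast hk
  have := h.integral_prodT (contDiff_cutOthers R 2 ha k) (by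
    rintro σ (rfl | rfl)
    · refine tendsto_edge_of_tendsto (r := R - 1 / k) hR (by simp) (contDiff_cutOthers R 2 ha k)
        (Or.inl rfl) (fun j hj t ht _ => ?_) fun p hp hp' => hf p ?_
      · rw [cutOthers_of_ne R hj, cutoff_eq_zero hk ht.le, zero_mul]
      · have hlt : R - 1 / (k : ℝ) < R := by simp [hk]
        exact ⟨(hp' 0 (by decide)).trans_lt hlt, (hp' 1 (by decide)).trans_lt hlt, by
          rw [hp]; ring⟩
    · exact tendsto_edge_of_eq_zero hR h.integrable (contDiff_cutOthers R 2 ha k) (Or.inr rfl) (by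
        rw [cutOthers_self]; simpa using h1))
  rwa [cutOthers_self] at this

/-! ### The Carleman estimate in one dimension -/

/-- Half of the absolute value of the logarithmic derivative of `carlemanWeight`. -/
noncomputable def carlemanSlope (R lam z : ℝ) : ℝ := 2 * lam * (R + 1 - z)

/-- The weight `exp(2λ(R + 1 - z)²)`, which is largest at the lower end `z = -R`, where both the
function and its derivative vanish. -/
noncomputable def carlemanWeight (R lam z : ℝ) : ℝ := Real.exp (2 * lam * (R + 1 - z) ^ 2)

lemma carlemanWeight_pos (R lam z : ℝ) : 0 < carlemanWeight R lam z := Real.exp_pos _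

lemma contDiff_carlemanWeight (R lam : ℝ) : ContDiff ℝ ∞ (carlemanWeight R lam) := by
  unfold carlemanWeight; fun_prop

lemma continuous_carlemanWeight (R lam : ℝ) : Continuous (carlemanWeight R lam) :=
  (contDiff_carlemanWeight R lam).continuous

lemma continuous_carlemanSlope (R lam : ℝ) : Continuous (carlemanSlope R lam) := by
  unfold carlemanSlope; fun_prop

lemma hasDerivAt_carlemanWeight (R lam z : ℝ) : HasDerivAt (carlemanWeight R lam)
    (-2 * carlemanSlope R lam z * carlemanWeight R lam z) z := by
  have h0 : HasDerivAt (fun x : ℝ => R + 1 - x) (-1) z := (hasDerivAt_id z).const_sub (R + 1)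
  have h : HasDerivAt (carlemanWeight R lam) _ z := ((h0.fun_pow 2).const_mul (2 * lam)).exp
  convert h using 1
  simp [carlemanSlope, carlemanWeight]; ring

lemma integrable_continuous_mul {R : ℝ} {p h : ℝ → ℝ} (hp : Continuous p)
    (hh : Integrable h (volume.restrict (Set.Ioo (-R) R))) :
    Integrable (fun z => p z * h z) (volume.restrict (Set.Ioo (-R) R)) := by
  obtain ⟨B, hB⟩ := (isCompact_Icc (a := -R) (b := R)).exists_bound_of_continuousOn
    (f := p) hp.continuousOn
  refine hh.bdd_mul (c := B) hp.aestronglyMeasurable ?_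
  filter_upwards [ae_restrict_mem measurableSet_Ioo] with z hz using
    hB z (Set.Ioo_subset_Icc_self hz)

lemma memLp_continuous_mul {R : ℝ} {p h : ℝ → ℝ} (hp : Continuous p)
    (hh : MemLp h 2 (volume.restrict (Set.Ioo (-R) R))) :
    MemLp (fun z => p z * h z) 2 (volume.restrict (Set.Ioo (-R) R)) := by
  obtain ⟨B, hB⟩ := (isCompact_Icc (a := -R) (b := R)).exists_bound_of_continuousOn
    (f := p) hp.continuousOn
  refine hh.of_le_mul (c := B) (hp.aestronglyMeasurable.mul hh.1) ?_
  filter_upwards [ae_restrict_mem measurableSet_Ioo] with z hz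
  rw [norm_mul]
  gcongr
  exact hB z (Set.Ioo_subset_Icc_self hz)

lemma memLp_of_continuousOn {R : ℝ} {f : ℝ → ℝ} (hf : ContinuousOn f (Set.Icc (-R) R)) :
    MemLp f 2 (volume.restrict (Set.Ioo (-R) R)) := by
  obtain ⟨B, hB⟩ := isCompact_Icc.exists_bound_of_continuousOn hf
  refine MemLp.of_bound ((hf.mono Set.Ioo_subset_Icc_self).aestronglyMeasurable measurableSet_Ioo) B
    ?_
  filter_upwards [ae_restrict_mem measurableSet_Ioo] with z hz using
    hB z (Set.Ioo_subset_Icc_self hz)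

lemma integral_Ioo_eq {R : ℝ} (hR : 0 < R) (h : ℝ → ℝ) :
    ∫ z in Set.Ioo (-R) R, h z = ∫ z in (-R)..R, h z := by
  rw [intervalIntegral.integral_of_le (by linarith), integral_Ioc_eq_integral_Ioo]

lemma intervalIntegrable_of_memLp {R : ℝ} (hR : 0 < R) {g : ℝ → ℝ}
    (hg : MemLp g 2 (volume.restrict (Set.Ioo (-R) R))) : IntervalIntegrable g volume (-R) R := by
  rw [intervalIntegrable_iff_integrableOn_Ioo_of_le (by linarith)]
  exact hg.integrable one_le_two

section Primitive

variable {R : ℝ} {g : ℝ → ℝ}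

lemma absolutelyContinuous_primitive (hR : 0 < R)
    (hg : MemLp g 2 (volume.restrict (Set.Ioo (-R) R))) :
    AbsolutelyContinuousOnInterval (fun z => ∫ t in (-R)..z, g t) (-R) R :=
  (intervalIntegrable_of_memLp hR hg).absolutelyContinuousOnInterval_intervalIntegral (by simp)

lemma continuousOn_primitive (hR : 0 < R) (hg : MemLp g 2 (volume.restrict (Set.Ioo (-R) R))) :
    ContinuousOn (fun z => ∫ t in (-R)..z, g t) (Set.Icc (-R) R) := by
  have := (absolutelyContinuous_primitive hR hg).continuousOn
  rwa [Set.uIcc_of_le (by linarith)] at this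

lemma ae_hasDerivAt_primitive (hR : 0 < R) (hg : MemLp g 2 (volume.restrict (Set.Ioo (-R) R))) :
    ∀ᵐ z ∂volume.restrict (Set.Ioo (-R) R), HasDerivAt (fun z => ∫ t in (-R)..z, g t) (g z) z := by
  rw [ae_restrict_iff' measurableSet_Ioo]
  filter_upwards [(intervalIntegrable_of_memLp hR hg).ae_hasDerivAt_integral] with z hz hzI
  refine hz ?_ (-R) (by simp)
  rw [Set.uIcc_of_le (by linarith)]
  exact Set.Ioo_subset_Icc_self hzI

/-- The Carleman estimate for `f' + μ f`, where `f` is the primitive of `g` that vanishes at `-R`;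
for `μ < 0` it is needed that `f` vanishes at `R` as well. It comes from the identity
`(f' + μf)² = (f' - βf)² + 2(β + μ)f(f' - βf) + (β + μ)²f²`, with `β` the slope of the weight `w`,
for which `2wf(f' - βf) = (wf²)'`. -/
lemma carleman_first_order (hR : 0 < R) {lam : ℝ} (hlam : 0 ≤ lam) (mu : ℝ)
    (hg : MemLp g 2 (volume.restrict (Set.Ioo (-R) R)))
    (hbd : 0 ≤ mu ∨ ∫ t in (-R)..R, g t = 0) :
    ∫ z in Set.Ioo (-R) R, (carlemanWeight R lam z * ((carlemanSlope R lam z + mu) ^ 2 + 2 * lam)) *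
        (∫ t in (-R)..z, g t) ^ 2 ≤
      ∫ z in Set.Ioo (-R) R, carlemanWeight R lam z * (g z + mu * ∫ t in (-R)..z, g t) ^ 2 := by
  set w := carlemanWeight R lam with hw
  set b := carlemanSlope R lam with hb
  set f : ℝ → ℝ := fun z => ∫ t in (-R)..z, g t with hf
  have hwc : Continuous w := continuous_carlemanWeight R lam
  have hbc : Continuous b := continuous_carlemanSlope R lam
  have hfL : MemLp f 2 _ := memLp_of_continuousOn (continuousOn_primitive hR hg)
  have hfac : AbsolutelyContinuousOnInterval f (-R) R := absolutelyContinuous_primitive hR hg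
  -- the exact differential
  have hPd : ∀ z, HasDerivAt (fun z => (b z + mu) * w z)
      (-2 * lam * w z + (b z + mu) * (-2 * b z * w z)) z := by
    intro z
    have h1 : HasDerivAt b (-2 * lam) z := by
      have h0 : HasDerivAt (fun x : ℝ => R + 1 - x) (-1) z := (hasDerivAt_id z).const_sub (R + 1)
      have : HasDerivAt b _ z := h0.const_mul (2 * lam)
      convert this using 1; ring
    exact (h1.add_const mu).mul (hasDerivAt_carlemanWeight R lam z)
  have hPac : AbsolutelyContinuousOnInterval (fun z => (b z + mu) * w z) (-R) R := by
    apply ContDiffOn.absolutelyContinuousOnInterval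
    apply ContDiff.contDiffOn
    have : ContDiff ℝ 1 b := by rw [hb]; unfold carlemanSlope; fun_prop
    exact (this.add contDiff_const).mul ((contDiff_carlemanWeight R lam).of_le (by
      exact_mod_cast le_top))
  have key := hPac.integral_deriv_mul_eq_sub (hfac.fun_mul hfac)
  have hfR : f (-R) = 0 := by simp [hf]
  rw [hfR, mul_zero, mul_zero, sub_zero, ← integral_Ioo_eq hR] at key
  have hff : Integrable (fun z => f z * f z) _ := hfL.integrable_mul hfL
  have hfg : Integrable (fun z => f z * g z) _ := hfL.integrable_mul hg
  have hbdry : 0 ≤ (b R + mu) * w R * (f R * f R) := by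
    rcases hbd with h | h
    · have : 0 ≤ b R := by rw [hb]; unfold carlemanSlope; nlinarith
      exact mul_nonneg (mul_nonneg (by linarith) (carlemanWeight_pos R lam R).le)
        (mul_self_nonneg _)
    · have : f R = 0 := h
      rw [this]; simp
  have hL : Integrable (fun z => (w z * ((b z + mu) ^ 2 + 2 * lam)) * (f z) ^ 2)
      (volume.restrict (Set.Ioo (-R) R)) := by
    refine integrable_continuous_mul (by fun_prop) ?_
    simpa [sq] using hff
  have hS : MemLp (fun z => g z - b z * f z) 2 (volume.restrict (Set.Ioo (-R) R)) :=
    hg.sub (memLp_continuous_mul hbc hfL)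
  have hSq : Integrable (fun z => w z * (g z - b z * f z) ^ 2)
      (volume.restrict (Set.Ioo (-R) R)) :=
    integrable_continuous_mul hwc hS.integrable_sq
  have hD : Integrable (fun z => deriv (fun z => (b z + mu) * w z) z * (f z * f z) +
      (b z + mu) * w z * deriv (fun z => f z * f z) z) (volume.restrict (Set.Ioo (-R) R)) := by
    have h1 : Integrable (fun z => (-2 * lam * w z + (b z + mu) * (-2 * b z * w z)) * (f z * f z) +
        (2 * ((b z + mu) * w z)) * (f z * g z)) (volume.restrict (Set.Ioo (-R) R)) :=
      (integrable_continuous_mul (by fun_prop) hff).add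
        (integrable_continuous_mul (by fun_prop) hfg)
    refine h1.congr ?_
    filter_upwards [ae_hasDerivAt_primitive hR hg] with z hz
    rw [(hPd z).deriv, (hz.fun_mul hz).deriv]
    ring
  have hnn : 0 ≤ ∫ z in Set.Ioo (-R) R, w z * (g z - b z * f z) ^ 2 :=
    integral_nonneg fun z => mul_nonneg (carlemanWeight_pos R lam z).le (sq_nonneg _)
  have hsum : ∫ z in Set.Ioo (-R) R, w z * (g z + mu * f z) ^ 2 =
      ∫ z in Set.Ioo (-R) R, (((w z * ((b z + mu) ^ 2 + 2 * lam)) * (f z) ^ 2 +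
        w z * (g z - b z * f z) ^ 2) + (deriv (fun z => (b z + mu) * w z) z * (f z * f z) +
      (b z + mu) * w z * deriv (fun z => f z * f z) z)) := by
    apply integral_congr_ae
    filter_upwards [ae_hasDerivAt_primitive hR hg] with z hz
    rw [(hPd z).deriv, (hz.fun_mul hz).deriv]
    ring
  have hLS := hL.add hSq
  simp only [Pi.add_def] at hLS
  rw [hsum, integral_add hLS hD, integral_add hL hSq, key]
  linarith

end Primitive

/-- Smooth functions have smooth primitives. -/
lemma exists_contDiff_primitive {φ : ℝ → ℝ} (hφ : ContDiff ℝ ∞ φ) (R : ℝ) :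
    ∃ c : ℝ → ℝ, ContDiff ℝ ∞ c ∧ c R = 0 ∧ deriv c = φ := by
  have hd : ∀ x, HasDerivAt (fun x => ∫ t in R..x, φ t) (φ x) x := fun x =>
    intervalIntegral.integral_hasDerivAt_right (hφ.continuous.intervalIntegrable _ _)
      hφ.continuous.stronglyMeasurable.stronglyMeasurableAtFilter hφ.continuous.continuousAt
  have hd' : deriv (fun x => ∫ t in R..x, φ t) = φ := funext fun x => (hd x).deriv
  refine ⟨fun x => ∫ t in R..x, φ t, ?_, by simp, hd'⟩
  rw [contDiff_infty_iff_deriv, hd']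
  exact ⟨fun x => (hd x).differentiableAt, hφ⟩

/-- A function on an interval that is orthogonal to all smooth functions vanishes. -/
lemma ae_eq_zero_of_integral_smooth {R : ℝ} {h : ℝ → ℝ}
    (hh : Integrable h (volume.restrict (Set.Ioo (-R) R)))
    (h0 : ∀ φ : ℝ → ℝ, ContDiff ℝ ∞ φ → ∫ z in Set.Ioo (-R) R, h z * φ z = 0) :
    h =ᵐ[volume.restrict (Set.Ioo (-R) R)] 0 := by
  have := isOpen_Ioo.ae_eq_zero_of_integral_contDiff_smul_eq_zero (μ := volume)
    (f := h) (U := Set.Ioo (-R) R) (IntegrableOn.locallyIntegrableOn hh) (fun φ h1 _ h3 => ?_)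
  · rw [EventuallyEq, ae_restrict_iff' measurableSet_Ioo]
    exact this
  · rw [← h0 φ h1, setIntegral_eq_integral_of_forall_compl_eq_zero]
    · simp [mul_comm]
    · intro x hx
      rw [image_eq_zero_of_notMem_tsupport (fun h' => hx (h3 h'))]; simp

section Ode

variable {R : ℝ} {y y1 y2 : ℝ → ℝ}

/-- The weak form of `y' = y1`, `y'' = y2`, `y(-R) = y'(-R) = 0`, `y(R) = 0`. -/
structure WeakOde (R : ℝ) (y y1 y2 : ℝ → ℝ) : Prop where
  memLp : MemLp y 2 (volume.restrict (Set.Ioo (-R) R))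
  memLp_one : MemLp y1 2 (volume.restrict (Set.Ioo (-R) R))
  memLp_two : MemLp y2 2 (volume.restrict (Set.Ioo (-R) R))
  integral_one : ∀ c : ℝ → ℝ, ContDiff ℝ ∞ c →
    ∫ z in Set.Ioo (-R) R, y1 z * c z = -∫ z in Set.Ioo (-R) R, y z * deriv c z
  integral_two : ∀ c : ℝ → ℝ, ContDiff ℝ ∞ c → c R = 0 →
    ∫ z in Set.Ioo (-R) R, y2 z * c z = ∫ z in Set.Ioo (-R) R, y z * deriv (deriv c) z

lemma integral_mul_eq_of_primitive (hR : 0 < R) {g c : ℝ → ℝ}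
    (hg : MemLp g 2 (volume.restrict (Set.Ioo (-R) R))) (hc : ContDiff ℝ ∞ c) :
    ∫ z in Set.Ioo (-R) R, g z * c z = (∫ t in (-R)..R, g t) * c R -
      ∫ z in Set.Ioo (-R) R, (∫ t in (-R)..z, g t) * deriv c z := by
  have hcac : AbsolutelyContinuousOnInterval c (-R) R :=
    (hc.of_le (by exact_mod_cast le_top)).contDiffOn.absolutelyContinuousOnInterval
  have := hcac.integral_mul_deriv_eq_deriv_mul (absolutelyContinuous_primitive hR hg)
  rw [intervalIntegral.integral_same, mul_zero, sub_zero, ← integral_Ioo_eq hR,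
    ← integral_Ioo_eq hR (fun z => deriv c z * _)] at this
  rw [mul_comm (∫ t in (-R)..R, g t)]
  simp_rw [mul_comm _ (deriv c _)]
  rw [← this]
  apply integral_congr_ae
  filter_upwards [ae_hasDerivAt_primitive hR hg] with z hz
  rw [hz.deriv, mul_comm]

lemma WeakOde.eq_primitive (hR : 0 < R) (h : WeakOde R y y1 y2) :
    y1 =ᵐ[volume.restrict (Set.Ioo (-R) R)] (fun z => ∫ t in (-R)..z, y2 t) ∧
    y =ᵐ[volume.restrict (Set.Ioo (-R) R)] (fun z => ∫ s in (-R)..z, ∫ t in (-R)..s, y2 t) ∧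
    ∫ s in (-R)..R, ∫ t in (-R)..s, y2 t = 0 := by
  set Y1 : ℝ → ℝ := fun z => ∫ t in (-R)..z, y2 t with hY1
  set Y : ℝ → ℝ := fun z => ∫ s in (-R)..z, Y1 s with hY
  have hY1L : MemLp Y1 2 (volume.restrict (Set.Ioo (-R) R)) :=
    memLp_of_continuousOn (continuousOn_primitive hR h.memLp_two)
  have hYL : MemLp Y 2 (volume.restrict (Set.Ioo (-R) R)) :=
    memLp_of_continuousOn (continuousOn_primitive hR hY1L)
  have two : ∀ c : ℝ → ℝ, ContDiff ℝ ∞ c → c R = 0 →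
      ∫ z in Set.Ioo (-R) R, y z * deriv (deriv c) z =
        -(Y R * deriv c R) + ∫ z in Set.Ioo (-R) R, Y z * deriv (deriv c) z := by
    intro c hc hcR
    rw [← h.integral_two c hc hcR, integral_mul_eq_of_primitive hR h.memLp_two hc, hcR, mul_zero,
      zero_sub, integral_mul_eq_of_primitive hR hY1L (contDiff_deriv hc)]
    ring
  have hYR : Y R = 0 := by
    have h1 : deriv (fun z : ℝ => z - R) = fun _ => 1 := by funext z; simp
    have := two (fun z => z - R) (by fun_prop) (by simp)
    rw [h1] at this
    simpa using this
  have hyY : y =ᵐ[volume.restrict (Set.Ioo (-R) R)] Y := by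
    have : (fun z => y z - Y z) =ᵐ[volume.restrict (Set.Ioo (-R) R)] 0 := by
      refine ae_eq_zero_of_integral_smooth ((h.memLp.sub hYL).integrable one_le_two)
        fun φ hφ => ?_
      obtain ⟨c1, hc1, -, hd1⟩ := exists_contDiff_primitive hφ R
      obtain ⟨c, hc, hcR, hd⟩ := exists_contDiff_primitive hc1 R
      have e := two c hc hcR
      rw [hd, hd1, hYR, zero_mul, neg_zero, zero_add] at e
      obtain ⟨hφL⟩ : Nonempty (MemLp φ 2 (volume.restrict (Set.Ioo (-R) R))) :=
        ⟨memLp_of_continuousOn hφ.continuous.continuousOn⟩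
      simp_rw [sub_mul]
      have e2 := integral_sub (h.memLp.integrable_mul hφL) (hYL.integrable_mul hφL)
      simp only [Pi.mul_apply] at e2
      rw [e2, e, sub_self]
    filter_upwards [this] with z hz
    exact sub_eq_zero.1 hz
  refine ⟨?_, hyY, hYR⟩
  have : (fun z => y1 z - Y1 z) =ᵐ[volume.restrict (Set.Ioo (-R) R)] 0 := by
    refine ae_eq_zero_of_integral_smooth ((h.memLp_one.sub hY1L).integrable one_le_two)
      fun φ hφ => ?_
    have hφL : MemLp φ 2 (volume.restrict (Set.Ioo (-R) R)) :=
      memLp_of_continuousOn hφ.continuous.continuousOn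
    simp_rw [sub_mul]
    have e2 := integral_sub (h.memLp_one.integrable_mul hφL) (hY1L.integrable_mul hφL)
    simp only [Pi.mul_apply] at e2
    rw [e2, h.integral_one φ hφ, integral_mul_eq_of_primitive hR hY1L hφ]
    have : Y R = ∫ t in (-R)..R, Y1 t := rfl
    rw [← this, hYR, zero_mul, zero_sub, sub_neg_eq_add, neg_add_eq_zero]
    apply integral_congr_ae
    filter_upwards [hyY] with z hz
    rw [hz]
  filter_upwards [this] with z hz
  exact sub_eq_zero.1 hz

/-- The combination of the two first order estimates. -/
lemma carleman_arithmetic {lam mu S A A1 A2 V G : ℝ} (hlam : 1 ≤ lam) (hmu : 0 ≤ mu) (hS0 : 0 ≤ S)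
    (hV0 : 0 ≤ V) (hG0 : 0 ≤ G) (B1 : (2 * lam + mu) ^ 2 * V ≤ G)
    (B2 : 2 * lam * A ≤ V) (B3 : mu ^ 2 * A ≤ 2 * V + 4 * S * lam * (2 * lam * A))
    (B4 : A1 ≤ 2 * V + 2 * mu ^ 2 * A) (B5 : A2 ≤ 2 * G + 2 * mu ^ 4 * A) :
    lam * (A + mu ^ 2 * A + A1) ≤ 4 * G ∧
      mu ^ 4 * A + mu ^ 2 * A1 + A2 ≤ (14 + 20 * S) * lam * G := by
  have hl0 : 0 ≤ lam := by linarith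
  have D1 : mu ^ 2 * V ≤ G := by
    refine le_trans (mul_le_mul_of_nonneg_right ?_ hV0) B1
    exact pow_le_pow_left₀ hmu (by linarith) 2
  have D2 : 4 * (lam * V) ≤ G := by
    rw [← mul_assoc]
    refine le_trans (mul_le_mul_of_nonneg_right ?_ hV0) B1
    nlinarith [mul_nonneg hl0 hmu, sq_nonneg mu]
  have D3 : lam * (mu ^ 2 * A) ≤ G / 2 := by
    have := mul_le_mul_of_nonneg_left B2 (sq_nonneg mu)
    linarith
  have D0 : V ≤ lam * V := le_mul_of_one_le_left hV0 hlam
  have D4 : lam * A ≤ G / 8 := by linarith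
  have D5 : lam * A1 ≤ 2 * (lam * V) + 2 * (lam * (mu ^ 2 * A)) := by
    have := mul_le_mul_of_nonneg_left B4 hl0
    linarith
  have D6 : mu ^ 2 * A ≤ (2 + 4 * S * lam) * V := by
    have := mul_le_mul_of_nonneg_left B2 (by positivity : 0 ≤ 4 * S * lam)
    linarith
  have D7 : mu ^ 4 * A ≤ (2 + 4 * S * lam) * G := by
    have h1 := mul_le_mul_of_nonneg_left D6 (sq_nonneg mu)
    have h2 := mul_le_mul_of_nonneg_left D1 (by positivity : 0 ≤ 2 + 4 * S * lam)
    calc mu ^ 4 * A = mu ^ 2 * (mu ^ 2 * A) := by ring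
      _ ≤ _ := h1
      _ = (2 + 4 * S * lam) * (mu ^ 2 * V) := by ring
      _ ≤ _ := h2
  have D8 : mu ^ 2 * A1 ≤ 2 * (mu ^ 2 * V) + 2 * (mu ^ 4 * A) := by
    have := mul_le_mul_of_nonneg_left B4 (sq_nonneg mu)
    linarith
  have D9 : G ≤ lam * G := le_mul_of_one_le_left hG0 hlam
  constructor <;> linarith

/-- The Carleman estimate for `y'' - μ²y`, uniform in the frequency `μ`; it results from the
factorization `y'' - μ²y = (∂ + μ)(∂ - μ)y` and two first order estimates. -/
lemma WeakOde.carleman (hR : 0 < R) {lam mu : ℝ} (hlam : 1 ≤ lam) (hmu : 0 ≤ mu)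
    (h : WeakOde R y y1 y2) :
    lam * ((∫ z in Set.Ioo (-R) R, carlemanWeight R lam z * y z ^ 2) +
        mu ^ 2 * (∫ z in Set.Ioo (-R) R, carlemanWeight R lam z * y z ^ 2) +
        ∫ z in Set.Ioo (-R) R, carlemanWeight R lam z * y1 z ^ 2) ≤
      4 * ∫ z in Set.Ioo (-R) R, carlemanWeight R lam z * (y2 z - mu ^ 2 * y z) ^ 2 ∧
    mu ^ 4 * (∫ z in Set.Ioo (-R) R, carlemanWeight R lam z * y z ^ 2) +
        mu ^ 2 * (∫ z in Set.Ioo (-R) R, carlemanWeight R lam z * y1 z ^ 2) +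
        ∫ z in Set.Ioo (-R) R, carlemanWeight R lam z * y2 z ^ 2 ≤
      (14 + 20 * (2 * R + 1) ^ 2) * lam *
        ∫ z in Set.Ioo (-R) R, carlemanWeight R lam z * (y2 z - mu ^ 2 * y z) ^ 2 := by
  obtain ⟨e1, e0, eR⟩ := h.eq_primitive hR
  set w := carlemanWeight R lam with hw
  set b := carlemanSlope R lam with hb
  have hwc : Continuous w := continuous_carlemanWeight R lam
  have hbc : Continuous b := continuous_carlemanSlope R lam
  have hwpos : ∀ z, 0 < w z := carlemanWeight_pos R lam
  set Y1 : ℝ → ℝ := fun z => ∫ t in (-R)..z, y2 t with hY1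
  set Y : ℝ → ℝ := fun z => ∫ s in (-R)..z, Y1 s with hY
  have hY1L : MemLp Y1 2 (volume.restrict (Set.Ioo (-R) R)) :=
    memLp_of_continuousOn (continuousOn_primitive hR h.memLp_two)
  have hYL : MemLp Y 2 (volume.restrict (Set.Ioo (-R) R)) :=
    memLp_of_continuousOn (continuousOn_primitive hR hY1L)
  set v : ℝ → ℝ := fun z => Y1 z - mu * Y z with hv
  have hvL : MemLp v 2 (volume.restrict (Set.Ioo (-R) R)) := hY1L.sub (hYL.const_mul mu)
  have hgL : MemLp (fun z => y2 z - mu * Y1 z) 2 (volume.restrict (Set.Ioo (-R) R)) :=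
    h.memLp_two.sub (hY1L.const_mul mu)
  -- everything in terms of the representatives
  have i0 : ∫ z in Set.Ioo (-R) R, w z * y z ^ 2 = ∫ z in Set.Ioo (-R) R, w z * Y z ^ 2 :=
    integral_congr_ae (by filter_upwards [e0] with z hz; rw [hz])
  have i1 : ∫ z in Set.Ioo (-R) R, w z * y1 z ^ 2 = ∫ z in Set.Ioo (-R) R, w z * Y1 z ^ 2 :=
    integral_congr_ae (by filter_upwards [e1] with z hz; rw [hz])
  have i2 : ∫ z in Set.Ioo (-R) R, w z * (y2 z - mu ^ 2 * y z) ^ 2 =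
      ∫ z in Set.Ioo (-R) R, w z * (y2 z - mu ^ 2 * Y z) ^ 2 :=
    integral_congr_ae (by filter_upwards [e0] with z hz; rw [hz])
  rw [i0, i1, i2]
  have hvprim : ∀ z ∈ Set.Ioo (-R) R, ∫ t in (-R)..z, (y2 t - mu * Y1 t) = v z := by
    intro z hz
    have hsub : Set.uIcc (-R) z ⊆ Set.uIcc (-R) R := by
      rw [Set.uIcc_of_le hz.1.le, Set.uIcc_of_le (by linarith)]
      exact Set.Icc_subset_Icc_right hz.2.le
    rw [intervalIntegral.integral_sub ((intervalIntegrable_of_memLp hR h.memLp_two).mono_set hsub)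
      (((intervalIntegrable_of_memLp hR hY1L).mono_set hsub).const_mul mu),
      intervalIntegral.integral_const_mul]
  have C1 := carleman_first_order hR (lam := lam) (by linarith) mu hgL (Or.inl hmu)
  have C2 := carleman_first_order hR (lam := lam) (by linarith) (-mu) hY1L (Or.inr eR)
  rw [← hw, ← hb] at C1 C2
  set A := ∫ z in Set.Ioo (-R) R, w z * Y z ^ 2 with hA
  set A1 := ∫ z in Set.Ioo (-R) R, w z * Y1 z ^ 2 with hA1
  set V := ∫ z in Set.Ioo (-R) R, w z * v z ^ 2 with hV
  set G := ∫ z in Set.Ioo (-R) R, w z * (y2 z - mu ^ 2 * Y z) ^ 2 with hG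
  have sqint : ∀ {p f : ℝ → ℝ}, Continuous p → MemLp f 2 (volume.restrict (Set.Ioo (-R) R)) →
      Integrable (fun z => p z * f z ^ 2) (volume.restrict (Set.Ioo (-R) R)) := fun hp hf =>
    integrable_continuous_mul hp hf.integrable_sq
  have mono : ∀ {p q : ℝ → ℝ}, Integrable p (volume.restrict (Set.Ioo (-R) R)) →
      Integrable q (volume.restrict (Set.Ioo (-R) R)) → (∀ z ∈ Set.Ioo (-R) R, p z ≤ q z) →
      ∫ z in Set.Ioo (-R) R, p z ≤ ∫ z in Set.Ioo (-R) R, q z := fun hp hq hpq =>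
    setIntegral_mono_on hp hq measurableSet_Ioo hpq
  have nn : ∀ f : ℝ → ℝ, 0 ≤ ∫ z in Set.Ioo (-R) R, w z * f z ^ 2 := fun f =>
    integral_nonneg fun z => mul_nonneg (hwpos z).le (sq_nonneg _)
  have hV0 : 0 ≤ V := nn _
  have hG0 : 0 ≤ G := nn _
  have hbl : ∀ z ∈ Set.Ioo (-R) R, 2 * lam ≤ b z := by
    intro z hz; rw [hb]; unfold carlemanSlope; nlinarith [hz.2]
  have hbu : ∀ z ∈ Set.Ioo (-R) R, b z ≤ 2 * (2 * R + 1) * lam := by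
    intro z hz; rw [hb]; unfold carlemanSlope; nlinarith [hz.1]
  have B1 : (2 * lam + mu) ^ 2 * V ≤ G := by
    refine le_trans ?_ (C1.trans (le_of_eq ?_))
    · rw [hV, ← integral_const_mul]
      refine (mono ((sqint hwc hvL).const_mul _) (sqint (p := fun z => w z * ((b z + mu) ^ 2 +
        2 * lam)) (by fun_prop) hvL) fun z hz => ?_).trans (le_of_eq ?_)
      · have : (2 * lam + mu) ^ 2 ≤ (b z + mu) ^ 2 + 2 * lam := by
          have := pow_le_pow_left₀ (by positivity) (add_le_add_left (hbl z hz) mu) 2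
          linarith
        have h2 : 0 ≤ w z * v z ^ 2 := mul_nonneg (hwpos z).le (sq_nonneg _)
        nlinarith
      · apply setIntegral_congr_fun measurableSet_Ioo
        intro z hz
        simp only [hvprim z hz]
    · apply setIntegral_congr_fun measurableSet_Ioo
      intro z hz
      simp only [hvprim z hz, hv]
      ring
  have C2' : ∫ z in Set.Ioo (-R) R, (w z * ((b z + -mu) ^ 2 + 2 * lam)) * Y z ^ 2 ≤ V := by
    refine C2.trans (le_of_eq (integral_congr_ae (Eventually.of_forall fun z => ?_)))
    simp only [hv, hY]; ring
  have B2 : 2 * lam * A ≤ V := by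
    refine le_trans ?_ C2'
    rw [hA, ← integral_const_mul]
    refine mono ((sqint hwc hYL).const_mul _) (sqint (p := fun z => w z * ((b z + -mu) ^ 2 +
        2 * lam)) (by fun_prop) hYL) fun z hz => ?_
    have h2 : 0 ≤ w z * Y z ^ 2 := mul_nonneg (hwpos z).le (sq_nonneg _)
    nlinarith [mul_nonneg h2 (sq_nonneg (b z + -mu))]
  have B3 : mu ^ 2 * A ≤ 2 * V + 2 * (2 * (2 * R + 1) * lam) ^ 2 * A := by
    have : (mu ^ 2 - 2 * (2 * (2 * R + 1) * lam) ^ 2) * A ≤ 2 * V := by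
      refine le_trans ?_ (mul_le_mul_of_nonneg_left C2' zero_le_two)
      rw [hA, ← integral_const_mul, ← integral_const_mul]
      refine mono ((sqint hwc hYL).const_mul _) ((sqint (p := fun z => w z * ((b z + -mu) ^ 2 +
        2 * lam)) (by fun_prop) hYL).const_mul _) fun z hz => ?_
      have h2 : 0 ≤ w z * Y z ^ 2 := mul_nonneg (hwpos z).le (sq_nonneg _)
      have h3 : mu ^ 2 - 2 * (2 * (2 * R + 1) * lam) ^ 2 ≤ 2 * ((b z + -mu) ^ 2 + 2 * lam) := by
        have h4 : b z ^ 2 ≤ (2 * (2 * R + 1) * lam) ^ 2 :=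
          pow_le_pow_left₀ (by linarith [hbl z hz]) (hbu z hz) 2
        nlinarith [sq_nonneg (2 * b z - mu)]
      nlinarith
    linarith
  have B4 : A1 ≤ 2 * V + 2 * mu ^ 2 * A := by
    rw [hA1, hV, hA, mul_assoc, ← integral_const_mul, ← integral_const_mul, ← integral_const_mul,
      ← integral_add ((sqint hwc hvL).const_mul 2)
      (((sqint hwc hYL).const_mul (mu ^ 2)).const_mul 2)]
    refine mono (sqint hwc hY1L) (((sqint hwc hvL).const_mul 2).add
      (((sqint hwc hYL).const_mul (mu ^ 2)).const_mul 2)) fun z hz => ?_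
    have : Y1 z = v z + mu * Y z := by simp only [hv]; ring
    rw [this]
    nlinarith [mul_nonneg (hwpos z).le (sq_nonneg (v z - mu * Y z))]
  have hGL : MemLp (fun z => y2 z - mu ^ 2 * Y z) 2 (volume.restrict (Set.Ioo (-R) R)) :=
    h.memLp_two.sub (hYL.const_mul _)
  have B5 : ∫ z in Set.Ioo (-R) R, w z * y2 z ^ 2 ≤ 2 * G + 2 * mu ^ 4 * A := by
    rw [hG, hA, mul_assoc, ← integral_const_mul, ← integral_const_mul, ← integral_const_mul,
      ← integral_add ((sqint hwc hGL).const_mul 2)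
      (((sqint hwc hYL).const_mul (mu ^ 4)).const_mul 2)]
    refine mono (sqint hwc h.memLp_two) (((sqint hwc hGL).const_mul 2).add
      (((sqint hwc hYL).const_mul (mu ^ 4)).const_mul 2)) fun z hz => ?_
    nlinarith [mul_nonneg (hwpos z).le (sq_nonneg (y2 z - mu ^ 2 * Y z - mu ^ 2 * Y z))]
  exact carleman_arithmetic hlam hmu (sq_nonneg (2 * R + 1)) hV0 hG0 B1 B2
    (B3.trans (le_of_eq (by ring))) B4 B5

end Ode

/-! ### Sine and cosine series -/

/-- The frequencies of the sine and cosine series on `(-R, R)`. -/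
noncomputable def freq (R : ℝ) (n : ℤ) : ℝ := Real.pi * n / (2 * R)

/-- The functions `cos(κₙ(t + R))` (if `c`) and `sin(κₙ(t + R))` (otherwise), for `n ∈ ℤ`. Each of
the two families is redundant, since `n` and `-n` give the same function up to sign, but in this
way Parseval's identity has the same form for both. -/
noncomputable def trig (R : ℝ) (c : Bool) (n : ℤ) (t : ℝ) : ℝ :=
  if c then Real.cos (freq R n * (t + R)) else Real.sin (freq R n * (t + R))

lemma contDiff_trig (R : ℝ) (c : Bool) (n : ℤ) : ContDiff ℝ ∞ (trig R c n) := by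
  cases c
  · exact Real.contDiff_sin.comp (by fun_prop)
  · exact Real.contDiff_cos.comp (by fun_prop)

lemma abs_trig_le (R : ℝ) (c : Bool) (n : ℤ) (t : ℝ) : |trig R c n t| ≤ 1 := by
  cases c
  · exact Real.abs_sin_le_one _
  · exact Real.abs_cos_le_one _

lemma deriv_trig_true (R : ℝ) (n : ℤ) :
    deriv (trig R true n) = fun t => -freq R n * trig R false n t := by
  funext t
  have h0 : HasDerivAt (fun t => freq R n * (t + R)) (freq R n) t := by
    simpa using ((hasDerivAt_id t).add_const R).const_mul (freq R n)
  have : HasDerivAt (trig R true n) _ t := h0.cos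
  rw [this.deriv]; simp [trig]; ring

lemma deriv_trig_false (R : ℝ) (n : ℤ) :
    deriv (trig R false n) = fun t => freq R n * trig R true n t := by
  funext t
  have h0 : HasDerivAt (fun t => freq R n * (t + R)) (freq R n) t := by
    simpa using ((hasDerivAt_id t).add_const R).const_mul (freq R n)
  have : HasDerivAt (trig R false n) _ t := h0.sin
  rw [this.deriv]; simp [trig]; ring

lemma trig_false_neg (R : ℝ) (n : ℤ) : trig R false n (-R) = 0 := by simp [trig]

lemma trig_false_self {R : ℝ} (hR : 0 < R) (n : ℤ) : trig R false n R = 0 := by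
  have : freq R n * (R + R) = n * Real.pi := by unfold freq; field_simp; ring
  simp only [trig, Bool.false_eq_true, if_false]
  rw [this, Real.sin_int_mul_pi]

/-- Parseval's identity for sine and cosine series, from that for the Fourier series of the odd or
even reflection. -/
lemma hasSum_sq_integral_trig {R : ℝ} (hR : 0 < R) (c : Bool) {f : ℝ → ℂ}
    (hf : MemLp f 2 (volume.restrict (Set.Ioo (-R) R))) :
    HasSum (fun n : ℤ => ‖∫ t in Set.Ioo (-R) R, (trig R c n t : ℂ) * f t‖ ^ 2)
      (2 * R * ∫ t in Set.Ioo (-R) R, ‖f t‖ ^ 2) := by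
  set s : ℂ := if c then 1 else -1 with hs
  set f' : ℝ → ℂ := (Set.Ioo (-R) R).indicator f with hf'
  have hf'L : MemLp f' 2 volume := (memLp_indicator_iff_restrict measurableSet_Ioo).2 hf
  have hmp : MeasurePreserving (fun t : ℝ => -2 * R - t) volume volume :=
    Measure.measurePreserving_sub_left volume (-2 * R)
  have hrL : MemLp (fun t => f' (-2 * R - t)) 2 volume := hf'L.comp_measurePreserving hmp
  set F : ℝ → ℂ := fun t => f' t + s * f' (-2 * R - t) with hF
  have hFL : MemLp F 2 volume := hf'L.add (hrL.const_mul s)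
  have hab : -3 * R < R := by linarith
  have hsupp : ∀ t, t ∉ Set.Ioc (-3 * R) R → F t = 0 := by
    intro t ht
    have h1 : t ∉ Set.Ioo (-R) R := fun h => ht ⟨by linarith [h.1], h.2.le⟩
    have h2 : -2 * R - t ∉ Set.Ioo (-R) R := fun h => ht ⟨by linarith [h.2], by linarith [h.1]⟩
    simp only [hF, hf', Set.indicator_of_notMem h1, Set.indicator_of_notMem h2, mul_zero, add_zero]
  have hnorm : ∀ t, ‖F t‖ ^ 2 = ‖f' t‖ ^ 2 + ‖f' (-2 * R - t)‖ ^ 2 := by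
    intro t
    by_cases h1 : t ∈ Set.Ioo (-R) R
    · have h2 : -2 * R - t ∉ Set.Ioo (-R) R := fun h => by linarith [h.1, h1.1]
      simp only [hF, hf', Set.indicator_of_notMem h2, mul_zero, add_zero, norm_zero]
      ring
    · have hs1 : ‖s‖ = 1 := by rw [hs]; split_ifs <;> simp
      simp [hF, hf', Set.indicator_of_notMem h1, hs1]
  have hsq : ∫ t in (-3 * R)..R, ‖F t‖ ^ 2 = 2 * ∫ t in Set.Ioo (-R) R, ‖f t‖ ^ 2 := by
    have e1 : ∫ t, ‖f' t‖ ^ 2 = ∫ t in Set.Ioo (-R) R, ‖f t‖ ^ 2 := by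
      rw [← integral_indicator measurableSet_Ioo]
      congr 1; funext t
      by_cases h : t ∈ Set.Ioo (-R) R <;> simp [hf', h]
    rw [intervalIntegral.integral_of_le hab.le, setIntegral_eq_integral_of_forall_compl_eq_zero
      (fun t ht => by rw [hsupp t ht]; simp)]
    simp_rw [hnorm]
    have e2 : ∫ t, ‖f' (-2 * R - t)‖ ^ 2 = ∫ t, ‖f' t‖ ^ 2 :=
      integral_sub_left_eq_self (fun t => ‖f' t‖ ^ 2) volume (-2 * R)
    rw [integral_add hf'L.norm.integrable_sq hrL.norm.integrable_sq, e2, e1]; ring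
  have hcoef : ∀ n : ℤ, ‖fourierCoeffOn hab F n‖ ^ 2 =
      (1 / (4 * R ^ 2)) * ‖∫ t in Set.Ioo (-R) R, (trig R c n t : ℂ) * f t‖ ^ 2 := by
    intro n
    set e : ℝ → ℂ := fun t => Complex.exp (-(freq R n * t : ℝ) * Complex.I) with he
    have hec : Continuous e := by fun_prop
    have heb : ∀ t, ‖e t‖ = 1 := fun t => by
      rw [he]; simp only; rw [← Complex.ofReal_neg, Complex.norm_exp_ofReal_mul_I]
    have h1 : fourierCoeffOn hab F n = (1 / (4 * R) : ℝ) • ∫ t, e t * F t := by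
      rw [fourierCoeffOn_eq_integral, intervalIntegral.integral_of_le hab.le,
        setIntegral_eq_integral_of_forall_compl_eq_zero
        (fun t ht => by rw [hsupp t ht]; simp)]
      congr 1
      · congr 1; ring
      · congr 1; funext t
        rw [fourier_coe_apply, smul_eq_mul]
        congr 1
        simp only [he]
        congr 1
        have hR' : (R : ℂ) ≠ 0 := by exact_mod_cast hR.ne'
        unfold freq
        push_cast
        field_simp
        ring
    have hint : ∀ {p : ℝ → ℂ}, Continuous p → (∀ t, ‖p t‖ ≤ 1) →
        Integrable (fun t => p t * f' t) volume := by
      intro p hp hpb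
      have : Integrable f' volume := by
        rw [hf', integrable_indicator_iff measurableSet_Ioo]
        exact hf.integrable one_le_two
      exact this.bdd_mul hp.aestronglyMeasurable (Eventually.of_forall hpb)
    have h2 : ∫ t, e t * F t = ∫ t, (e t + s * e (-2 * R - t)) * f' t := by
      have i1 : Integrable (fun t => e t * f' t) volume := hint hec fun t => (heb t).le
      have i2 : Integrable (fun t => e (-2 * R - t) * f' t) volume :=
        hint (by fun_prop) fun t => (heb _).le
      have i3 : Integrable (fun t => e t * f' (-2 * R - t)) volume := by
        have := hmp.integrable_comp_of_integrable i2
        simpa [Function.comp_def] using this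
      have e3 : ∫ t, e t * f' (-2 * R - t) = ∫ t, e (-2 * R - t) * f' t := by
        rw [← integral_sub_left_eq_self (fun t => e (-2 * R - t) * f' t) volume (-2 * R)]
        congr 1; funext t; rw [sub_sub_cancel]
      have l : ∀ t, e t * F t = e t * f' t + s * (e t * f' (-2 * R - t)) := fun t => by
        simp only [hF]; ring
      have r : ∀ t, (e t + s * e (-2 * R - t)) * f' t = e t * f' t + s * (e (-2 * R - t) * f' t) :=
        fun t => by ring
      simp_rw [l, r]
      rw [integral_add i1 (i3.const_mul s), integral_add i1 (i2.const_mul s), integral_const_mul,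
        integral_const_mul, e3]
    set θ : ℂ := Complex.exp ((freq R n * R : ℝ) * Complex.I) *
      (if c then 2 else -2 * Complex.I) with hθ
    have hθn : ‖θ‖ = 2 := by
      rw [hθ, norm_mul, Complex.norm_exp_ofReal_mul_I]; split_ifs <;> simp
    have h3 : ∀ t, e t + s * e (-2 * R - t) = θ * (trig R c n t : ℂ) := by
      intro t
      have a1 : e t = Complex.exp ((freq R n * R : ℝ) * Complex.I) *
          Complex.exp (-((freq R n * (t + R) : ℝ) : ℂ) * Complex.I) := by
        simp only [he]; rw [← Complex.exp_add]; congr 1; push_cast; ring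
      have a2 : e (-2 * R - t) = Complex.exp ((freq R n * R : ℝ) * Complex.I) *
          Complex.exp (((freq R n * (t + R) : ℝ) : ℂ) * Complex.I) := by
        simp only [he]; rw [← Complex.exp_add]; congr 1; push_cast; ring
      rw [a1, a2, hθ]
      cases c
      · simp only [hs, trig, Bool.false_eq_true, if_false]
        rw [Complex.ofReal_sin, Complex.sin]
        linear_combination (-Complex.exp ((freq R n * R : ℝ) * Complex.I) *
          (Complex.exp (-((freq R n * (t + R) : ℝ) : ℂ) * Complex.I) -
          Complex.exp (((freq R n * (t + R) : ℝ) : ℂ) * Complex.I))) * (-Complex.I_sq)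
      · simp only [hs, trig, if_true]
        rw [Complex.ofReal_cos, Complex.cos]
        ring
    have h4 : ∫ t, (e t + s * e (-2 * R - t)) * f' t =
        θ * ∫ t in Set.Ioo (-R) R, (trig R c n t : ℂ) * f t := by
      rw [← integral_const_mul, ← integral_indicator measurableSet_Ioo]
      congr 1; funext t
      rw [h3]
      by_cases h : t ∈ Set.Ioo (-R) R <;> simp [hf', h, mul_assoc]
    rw [h1, h2, h4, norm_smul, norm_mul, hθn, Real.norm_eq_abs, abs_of_pos (by positivity)]
    ring
  have key := hasSum_sq_fourierCoeffOn hab (hFL.restrict _)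
  rw [hsq] at key
  simp_rw [hcoef] at key
  have := key.mul_left (4 * R ^ 2)
  have e1 : ∀ x : ℝ, 4 * R ^ 2 * (1 / (4 * R ^ 2) * x) = x := fun x => by field_simp
  have e2 : ∀ x : ℝ, 4 * R ^ 2 * ((R - -3 * R)⁻¹ • (2 * x)) = 2 * R * x := fun x => by
    have : R - -3 * R = 4 * R := by ring
    rw [smul_eq_mul, this]; field_simp
  simp_rw [e1] at this
  rwa [e2] at this

/-! ### Sine and cosine coefficients in the horizontal variables -/

/-- Lebesgue measure on the interval `(-R, R)`. -/
noncomputable abbrev intervalMeasure (R : ℝ) : Measure ℝ := volume.restrict (Set.Ioo (-R) R)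

section Partial

variable {X : Type*} [MeasurableSpace X] {μ : Measure X} [IsFiniteMeasure μ]

/-- The `n`-th sine or cosine coefficient in the first variable. -/
noncomputable def partialCoef (R : ℝ) (c : Bool) (n : ℤ) (f : ℝ × X → ℂ) (x : X) : ℂ :=
  ∫ t in Set.Ioo (-R) R, (trig R c n t : ℂ) * f (t, x)

variable {R : ℝ} {f : ℝ × X → ℂ}

lemma ae_memLp_slice (hf : MemLp f 2 ((intervalMeasure R).prod μ)) :
    ∀ᵐ x ∂μ, MemLp (fun t => f (t, x)) 2 (intervalMeasure R) := by
  have h1 := (hf.norm.integrable_sq).prod_left_ae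
  have h2 : ∀ᵐ x ∂μ, AEStronglyMeasurable (fun t => f (t, x)) (intervalMeasure R) :=
    hf.1.prod_swap.prodMk_left
  filter_upwards [h1, h2] with x hx1 hx2
  exact (memLp_two_iff_integrable_sq_norm hx2).2 hx1

lemma aestronglyMeasurable_partialCoef (hf : AEStronglyMeasurable f ((intervalMeasure R).prod μ))
    (c : Bool) (n : ℤ) : AEStronglyMeasurable (partialCoef R c n f) μ := by
  have h1 : AEStronglyMeasurable (fun p : X × ℝ => (trig R c n p.2 : ℂ) * f p.swap)
      (μ.prod (intervalMeasure R)) := by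
    have ht : AEStronglyMeasurable (fun t => (trig R c n t : ℂ)) (intervalMeasure R) :=
      (Complex.continuous_ofReal.comp (contDiff_trig R c n).continuous).aestronglyMeasurable
    exact ht.comp_snd.mul hf.prod_swap
  exact h1.integral_prod_right'

lemma integrable_sq_slice (hf : MemLp f 2 ((intervalMeasure R).prod μ)) :
    Integrable (fun x => 2 * R * ∫ t in Set.Ioo (-R) R, ‖f (t, x)‖ ^ 2) μ :=
  (hf.norm.integrable_sq.integral_prod_right).const_mul _

lemma ae_hasSum_partialCoef (hR : 0 < R) (hf : MemLp f 2 ((intervalMeasure R).prod μ)) (c : Bool) :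
    ∀ᵐ x ∂μ, HasSum (fun n : ℤ => ‖partialCoef R c n f x‖ ^ 2)
      (2 * R * ∫ t in Set.Ioo (-R) R, ‖f (t, x)‖ ^ 2) := by
  filter_upwards [ae_memLp_slice hf] with x hx
  exact hasSum_sq_integral_trig hR c hx

lemma integrable_sq_partialCoef (hR : 0 < R) (hf : MemLp f 2 ((intervalMeasure R).prod μ))
    (c : Bool) (n : ℤ) : Integrable (fun x => ‖partialCoef R c n f x‖ ^ 2) μ := by
  refine (integrable_sq_slice hf).mono' ((aestronglyMeasurable_partialCoef hf.1 c n).norm.pow 2) ?_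
  filter_upwards [ae_hasSum_partialCoef hR hf c] with x hx
  rw [Real.norm_eq_abs, abs_of_nonneg (sq_nonneg _)]
  exact le_hasSum hx n fun m _ => sq_nonneg _

lemma memLp_partialCoef (hR : 0 < R) (hf : MemLp f 2 ((intervalMeasure R).prod μ))
    (c : Bool) (n : ℤ) : MemLp (partialCoef R c n f) 2 μ :=
  (memLp_two_iff_integrable_sq_norm (aestronglyMeasurable_partialCoef hf.1 c n)).2
    (integrable_sq_partialCoef hR hf c n)

/-- Parseval's identity in the first variable. -/
lemma hasSum_integral_sq_partialCoef (hR : 0 < R) (hf : MemLp f 2 ((intervalMeasure R).prod μ))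
    (c : Bool) : HasSum (fun n : ℤ => ∫ x, ‖partialCoef R c n f x‖ ^ 2 ∂μ)
      (2 * R * ∫ p, ‖f p‖ ^ 2 ∂((intervalMeasure R).prod μ)) := by
  have h := hasSum_integral_of_dominated_convergence
    (F := fun (n : ℤ) x => ‖partialCoef R c n f x‖ ^ 2) (μ := μ)
    (f := fun x => 2 * R * ∫ t in Set.Ioo (-R) R, ‖f (t, x)‖ ^ 2)
    (fun n x => ‖partialCoef R c n f x‖ ^ 2)
    (fun n => (aestronglyMeasurable_partialCoef hf.1 c n).norm.pow 2)
    (fun n => Eventually.of_forall fun x => by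
      rw [Real.norm_eq_abs, abs_of_nonneg (sq_nonneg _)])
    (by filter_upwards [ae_hasSum_partialCoef hR hf c] with x hx using hx.summable)
    ((integrable_sq_slice hf).congr (by
      filter_upwards [ae_hasSum_partialCoef hR hf c] with x hx using hx.tsum_eq.symm))
    (ae_hasSum_partialCoef hR hf c)
  rwa [integral_const_mul, ← integral_prod_symm _ hf.norm.integrable_sq] at h

/-- A quadratic inequality holds if it holds for all coefficients in the first variable. -/
lemma sum_integral_sq_le_zero_of_partialCoef (hR : 0 < R) {κ : Type*} [Fintype κ] (a : κ → ℝ)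
    (c : κ → Bool) {f : κ → ℝ × X → ℂ} (hf : ∀ k, MemLp (f k) 2 ((intervalMeasure R).prod μ))
    (h : ∀ n, ∑ k, a k * ∫ x, ‖partialCoef R (c k) n (f k) x‖ ^ 2 ∂μ ≤ 0) :
    ∑ k, a k * ∫ p, ‖f k p‖ ^ 2 ∂((intervalMeasure R).prod μ) ≤ 0 := by
  have hs : HasSum (fun n : ℤ => ∑ k, a k * ∫ x, ‖partialCoef R (c k) n (f k) x‖ ^ 2 ∂μ)
      (∑ k, a k * (2 * R * ∫ p, ‖f k p‖ ^ 2 ∂((intervalMeasure R).prod μ))) :=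
    hasSum_sum fun k _ => (hasSum_integral_sq_partialCoef hR (hf k) (c k)).mul_left (a k)
  have h1 := hasSum_le h hs hasSum_zero
  have h2 : ∑ k, a k * (2 * R * ∫ p, ‖f k p‖ ^ 2 ∂((intervalMeasure R).prod μ)) =
      2 * R * ∑ k, a k * ∫ p, ‖f k p‖ ^ 2 ∂((intervalMeasure R).prod μ) := by
    rw [Finset.mul_sum]; exact Finset.sum_congr rfl fun k _ => by ring
  rw [h2] at h1
  by_contra! h3
  have : 0 < 2 * R * ∑ k, a k * ∫ p, ‖f k p‖ ^ 2 ∂((intervalMeasure R).prod μ) := by positivity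
  linarith

lemma integral_partialCoef_mul (hf : Integrable f ((intervalMeasure R).prod μ)) (c : Bool) (n : ℤ)
    {b : X → ℂ} (hb : AEStronglyMeasurable b μ) {B : ℝ} (hB : ∀ᵐ x ∂μ, ‖b x‖ ≤ B) :
    ∫ x, b x * partialCoef R c n f x ∂μ =
      ∫ p, ((trig R c n p.1 : ℂ) * b p.2) * f p ∂((intervalMeasure R).prod μ) := by
  have hint : Integrable (fun p : ℝ × X => ((trig R c n p.1 : ℂ) * b p.2) * f p)
      ((intervalMeasure R).prod μ) := by
    refine hf.bdd_mul (c := 1 * B) ?_ ?_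
    · have ht : AEStronglyMeasurable (fun t => (trig R c n t : ℂ)) (intervalMeasure R) :=
        (Complex.continuous_ofReal.comp (contDiff_trig R c n).continuous).aestronglyMeasurable
      exact ht.comp_fst.mul hb.comp_snd
    · have : ∀ᵐ p ∂((intervalMeasure R).prod μ), ‖b p.2‖ ≤ B :=
        Measure.quasiMeasurePreserving_snd.ae hB
      filter_upwards [this] with p hp
      rw [norm_mul, Complex.norm_real, Real.norm_eq_abs]
      exact mul_le_mul (abs_trig_le R c n p.1) hp (norm_nonneg _) zero_le_one
  rw [integral_prod_symm _ hint]
  congr 1; funext x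
  unfold partialCoef
  rw [← integral_const_mul]
  congr 1; funext t
  ring

end Partial

/-- The coordinates, in the order `(y, (x, z))`. -/
noncomputable def coordEquiv : E3 ≃ᵐ ℝ × (ℝ × ℝ) :=
  ((MeasurableEquiv.toLp 2 (Fin 3 → ℝ)).symm.trans
    (MeasurableEquiv.piFinSuccAbove (fun _ : Fin 3 => ℝ) 1)).trans
    ((MeasurableEquiv.refl ℝ).prodCongr (MeasurableEquiv.piFinTwo fun _ => ℝ))

lemma coordEquiv_apply (x : E3) : coordEquiv x = (x 1, (x 0, x 2)) := rfl

lemma measurePreserving_coordEquiv : MeasurePreserving coordEquiv volume volume :=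
  ((EuclideanSpace.volume_preserving_symm_measurableEquiv_toLp (Fin 3)).trans
    (volume_preserving_piFinSuccAbove (fun _ : Fin 3 => ℝ) 1)).trans
    ((MeasurePreserving.id volume).prod (volume_preserving_piFinTwo fun _ => ℝ))

lemma measurePreserving_coordEquiv_cube (R : ℝ) :
    MeasurePreserving coordEquiv (volume.restrict (cube R))
      ((intervalMeasure R).prod ((intervalMeasure R).prod (intervalMeasure R))) := by
  have h := measurePreserving_coordEquiv.restrict_preimage
    (s := Set.Ioo (-R) R ×ˢ (Set.Ioo (-R) R ×ˢ Set.Ioo (-R) R))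
    (measurableSet_Ioo.prod (measurableSet_Ioo.prod measurableSet_Ioo))
  have h1 : coordEquiv ⁻¹' (Set.Ioo (-R) R ×ˢ (Set.Ioo (-R) R ×ˢ Set.Ioo (-R) R)) = cube R := by
    ext x
    simp only [Set.mem_preimage, coordEquiv_apply, Set.mem_prod, cube, Set.mem_ofPred_eq,
      Fin.forall_fin_succ, abs_lt, Set.mem_Ioo]
    simp only [Fin.succ_zero_eq_one, Fin.succ_one_eq_two, IsEmpty.forall_iff, and_true]
    tauto
  rw [h1] at h
  rw [Measure.prod_restrict, Measure.prod_restrict]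
  exact h

/-- The coefficient of `g` with respect to `trig p m x * trig q n y`, as a function of `z`. -/
noncomputable def modeCoef (R : ℝ) (p q : Bool) (m n : ℤ) (g : E3 → ℂ) : ℝ → ℂ :=
  partialCoef R p m (partialCoef R q n (g ∘ coordEquiv.symm))

section Mode

variable {R : ℝ} {g : E3 → ℂ}

lemma memLp_comp_coordEquiv (hg : MemLp g 2 (volume.restrict (cube R))) :
    MemLp (g ∘ coordEquiv.symm) 2
      ((intervalMeasure R).prod ((intervalMeasure R).prod (intervalMeasure R))) :=
  hg.comp_measurePreserving ((measurePreserving_coordEquiv_cube R).symm coordEquiv)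

lemma memLp_modeCoef (hR : 0 < R) (hg : MemLp g 2 (volume.restrict (cube R))) (p q : Bool)
    (m n : ℤ) : MemLp (modeCoef R p q m n g) 2 (intervalMeasure R) :=
  memLp_partialCoef hR (memLp_partialCoef hR (memLp_comp_coordEquiv hg) q n) p m

lemma integral_comp_coordEquiv (h : ℝ × (ℝ × ℝ) → ℂ) :
    ∫ x in cube R, h (coordEquiv x) =
      ∫ p, h p ∂((intervalMeasure R).prod ((intervalMeasure R).prod (intervalMeasure R))) :=
  (measurePreserving_coordEquiv_cube R).integral_comp coordEquiv.measurableEmbedding h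

/-- The product of two trigonometric functions in the horizontal variables and a function of `z`. -/
noncomputable def modeTest (R : ℝ) (p q : Bool) (m n : ℤ) (c : ℝ → ℝ) : Fin 3 → ℝ → ℝ :=
  ![trig R p m, trig R q n, c]

lemma integral_modeCoef_mul (hR : 0 < R) (hg : MemLp g 2 (volume.restrict (cube R))) (p q : Bool)
    (m n : ℤ) {c : ℝ → ℝ} (hc : Continuous c) :
    ∫ z in Set.Ioo (-R) R, (c z : ℂ) * modeCoef R p q m n g z =
      ∫ x in cube R, (prodT (modeTest R p q m n c) x : ℂ) * g x := by
  obtain ⟨B, hB⟩ := (isCompact_Icc (a := -R) (b := R)).exists_bound_of_continuousOn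
    (f := c) hc.continuousOn
  have hg' := memLp_comp_coordEquiv hg
  have hbc : ∀ᵐ z ∂(intervalMeasure R), ‖(c z : ℂ)‖ ≤ B := by
    filter_upwards [ae_restrict_mem measurableSet_Ioo] with z hz
    rw [Complex.norm_real]
    exact hB z (Set.Ioo_subset_Icc_self hz)
  have hcm : AEStronglyMeasurable (fun z => (c z : ℂ)) (intervalMeasure R) :=
    (Complex.continuous_ofReal.comp hc).aestronglyMeasurable
  have htc : Continuous fun t => (trig R p m t : ℂ) :=
    Complex.continuous_ofReal.comp (contDiff_trig R p m).continuous
  have hb : AEStronglyMeasurable (fun s : ℝ × ℝ => (trig R p m s.1 : ℂ) * (c s.2 : ℂ))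
      ((intervalMeasure R).prod (intervalMeasure R)) :=
    htc.aestronglyMeasurable.comp_fst.mul hcm.comp_snd
  unfold modeCoef
  rw [integral_partialCoef_mul ((memLp_partialCoef hR hg' q n).integrable one_le_two) p m hcm hbc,
    integral_partialCoef_mul (B := 1 * B) (hg'.integrable one_le_two) q n hb]
  · rw [← integral_comp_coordEquiv]
    congr 1; funext x
    rw [coordEquiv_apply]
    simp only [Function.comp, prodT, modeTest, Fin.prod_univ_three]
    have : coordEquiv.symm (x 1, (x 0, x 2)) = x := coordEquiv.symm_apply_apply x
    rw [this]
    simp only [Matrix.cons_val_zero, Matrix.cons_val_one, Matrix.cons_val]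
    push_cast
    ring
  · have : ∀ᵐ p ∂((intervalMeasure R).prod (intervalMeasure R)), ‖(c p.2 : ℂ)‖ ≤ B :=
        Measure.quasiMeasurePreserving_snd.ae hbc
    filter_upwards [this] with s hs
    rw [norm_mul, Complex.norm_real, Real.norm_eq_abs]
    exact mul_le_mul (abs_trig_le R p m s.1) hs (norm_nonneg _) zero_le_one

/-- A quadratic inequality with a weight depending on `z` holds if it holds for all coefficients. -/
lemma sum_integral_sq_le_zero_of_modeCoef (hR : 0 < R) {κ : Type*} [Fintype κ] (a : κ → ℝ)
    (p q : κ → Bool) {g : κ → E3 → ℂ} (hg : ∀ k, MemLp (g k) 2 (volume.restrict (cube R)))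
    {w : ℝ → ℝ} (hw : Continuous w) (hw0 : ∀ z, 0 ≤ w z)
    (h : ∀ m n, ∑ k, a k * ∫ z in Set.Ioo (-R) R, w z * ‖modeCoef R (p k) (q k) m n (g k) z‖ ^ 2
      ≤ 0) :
    ∑ k, a k * ∫ x in cube R, w (x 2) * ‖g k x‖ ^ 2 ≤ 0 := by
  -- put the weight into the functions
  set r : ℝ → ℝ := fun z => √(w z) with hr
  have hrc : Continuous r := hw.sqrt
  obtain ⟨B, hB⟩ := (isCompact_Icc (a := -R) (b := R)).exists_bound_of_continuousOn
    (f := r) hrc.continuousOn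
  set g' : κ → E3 → ℂ := fun k x => (r (x 2) : ℂ) * g k x with hg'def
  have hg' : ∀ k, MemLp (g' k) 2 (volume.restrict (cube R)) := by
    intro k
    refine (hg k).of_le_mul (c := B) ?_ ?_
    · refine AEStronglyMeasurable.mul (Continuous.aestronglyMeasurable ?_) (hg k).1
      exact Complex.continuous_ofReal.comp (hrc.comp (by fun_prop))
    · filter_upwards [ae_restrict_mem (measurableSet_cube R)] with x hx
      rw [norm_mul, Complex.norm_real]
      gcongr
      exact hB _ (abs_le.1 (hx 2).le)
  have hsq : ∀ z (c : ℂ), ‖(r z : ℂ) * c‖ ^ 2 = w z * ‖c‖ ^ 2 := by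
    intro z c
    rw [norm_mul, mul_pow, Complex.norm_real, Real.norm_eq_abs, sq_abs, Real.sq_sqrt (hw0 z)]
  have e1 : ∀ k, ∫ x in cube R, w (x 2) * ‖g k x‖ ^ 2 =
      ∫ s, ‖(g' k ∘ coordEquiv.symm) s‖ ^ 2
        ∂((intervalMeasure R).prod ((intervalMeasure R).prod (intervalMeasure R))) := by
    intro k
    rw [← (measurePreserving_coordEquiv_cube R).integral_comp coordEquiv.measurableEmbedding]
    congr 1; funext x
    simp only [Function.comp, MeasurableEquiv.symm_apply_apply, hg'def, hsq]
  have e2 : ∀ k m n z, modeCoef R (p k) (q k) m n (g' k) z =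
      (r z : ℂ) * modeCoef R (p k) (q k) m n (g k) z := by
    intro k m n z
    have inner : ∀ s, partialCoef R (q k) n (g' k ∘ coordEquiv.symm) (s, z) =
        (r z : ℂ) * partialCoef R (q k) n (g k ∘ coordEquiv.symm) (s, z) := by
      intro s
      unfold partialCoef
      rw [← integral_const_mul]
      congr 1; funext t
      have : (coordEquiv.symm (t, s, z)) 2 = z := by
        have := congr_arg (fun q => q.2.2) (coordEquiv.apply_symm_apply (t, s, z))
        rwa [coordEquiv_apply] at this
      simp only [Function.comp, hg'def, this]
      ring
    unfold modeCoef
    rw [partialCoef, partialCoef, ← integral_const_mul]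
    congr 1; funext s
    rw [inner]
    ring
  simp_rw [e1]
  refine sum_integral_sq_le_zero_of_partialCoef hR a q (fun k => memLp_comp_coordEquiv (hg' k))
    fun n => ?_
  refine sum_integral_sq_le_zero_of_partialCoef hR a p
    (fun k => memLp_partialCoef hR (memLp_comp_coordEquiv (hg' k)) (q k) n) fun m => ?_
  refine le_trans (le_of_eq ?_) (h m n)
  refine Finset.sum_congr rfl fun k _ => ?_
  congr 1
  refine integral_congr_ae (Eventually.of_forall fun z => ?_)
  have := e2 k m n z
  unfold modeCoef at this
  simp only [this, hsq]
  rfl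

end Mode

/-! ### The Carleman estimate in the cube -/

lemma ae_eq_zero_of_integral_smooth_complex {R : ℝ} {h : ℝ → ℂ}
    (hh : Integrable h (intervalMeasure R))
    (h0 : ∀ c : ℝ → ℝ, ContDiff ℝ ∞ c → ∫ z in Set.Ioo (-R) R, (c z : ℂ) * h z = 0) :
    h =ᵐ[intervalMeasure R] 0 := by
  have := isOpen_Ioo.ae_eq_zero_of_integral_contDiff_smul_eq_zero (μ := volume)
    (f := h) (U := Set.Ioo (-R) R) (IntegrableOn.locallyIntegrableOn hh) (fun φ h1 _ h3 => ?_)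
  · rw [EventuallyEq, ae_restrict_iff' measurableSet_Ioo]
    exact this
  · rw [← h0 φ h1, setIntegral_eq_integral_of_forall_compl_eq_zero]
    · simp
    · intro x hx
      rw [image_eq_zero_of_notMem_tsupport (fun h' => hx (h3 h'))]; simp

lemma integrable_continuous_mul_complex {R : ℝ} {c : ℝ → ℝ} (hc : Continuous c) {h : ℝ → ℂ}
    (hh : Integrable h (intervalMeasure R)) :
    Integrable (fun z => (c z : ℂ) * h z) (intervalMeasure R) := by
  obtain ⟨B, hB⟩ := (isCompact_Icc (a := -R) (b := R)).exists_bound_of_continuousOn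
    (f := c) hc.continuousOn
  refine hh.bdd_mul (c := B) (Complex.continuous_ofReal.comp hc).aestronglyMeasurable ?_
  filter_upwards [ae_restrict_mem measurableSet_Ioo] with z hz
  rw [Complex.norm_real]; exact hB z (Set.Ioo_subset_Icc_self hz)

lemma integral_re_mul {R : ℝ} {c : ℝ → ℝ} (hc : Continuous c) {h : ℝ → ℂ}
    (hh : Integrable h (intervalMeasure R)) :
    ∫ z in Set.Ioo (-R) R, (h z).re * c z = (∫ z in Set.Ioo (-R) R, (c z : ℂ) * h z).re := by
  have := Complex.reCLM.integral_comp_comm (integrable_continuous_mul_complex hc hh)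
  rw [Complex.reCLM_apply] at this
  rw [← this]
  congr 1; funext z
  simp [mul_comm]

lemma integral_im_mul {R : ℝ} {c : ℝ → ℝ} (hc : Continuous c) {h : ℝ → ℂ}
    (hh : Integrable h (intervalMeasure R)) :
    ∫ z in Set.Ioo (-R) R, (h z).im * c z = (∫ z in Set.Ioo (-R) R, (c z : ℂ) * h z).im := by
  have := Complex.imCLM.integral_comp_comm (integrable_continuous_mul_complex hc hh)
  rw [Complex.imCLM_apply] at this
  rw [← this]
  congr 1; funext z
  simp [mul_comm]

/-- `∫ w |h|²` over the interval, with the Carleman weight `w`. -/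
noncomputable def intervalEnergy (R lam : ℝ) (h : ℝ → ℂ) : ℝ :=
  ∫ z in Set.Ioo (-R) R, carlemanWeight R lam z * ‖h z‖ ^ 2

lemma intervalEnergy_nonneg (R lam : ℝ) (h : ℝ → ℂ) : 0 ≤ intervalEnergy R lam h :=
  integral_nonneg fun z => mul_nonneg (carlemanWeight_pos R lam z).le (sq_nonneg _)

lemma intervalEnergy_eq_re_add_im {R lam : ℝ} {h : ℝ → ℂ} (hh : MemLp h 2 (intervalMeasure R)) :
    intervalEnergy R lam h = (∫ z in Set.Ioo (-R) R, carlemanWeight R lam z * (h z).re ^ 2) +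
      ∫ z in Set.Ioo (-R) R, carlemanWeight R lam z * (h z).im ^ 2 := by
  have hw := continuous_carlemanWeight R lam
  have hr : MemLp (fun z => (h z).re) 2 (intervalMeasure R) := hh.re
  have hi : MemLp (fun z => (h z).im) 2 (intervalMeasure R) := hh.im
  rw [← integral_add (integrable_continuous_mul hw hr.integrable_sq)
    (integrable_continuous_mul hw hi.integrable_sq)]
  unfold intervalEnergy
  congr 1; funext z
  rw [← Complex.normSq_eq_norm_sq, Complex.normSq_apply]
  ring

lemma intervalEnergy_congr {R lam : ℝ} {h h' : ℝ → ℂ} {s : ℝ}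
    (hh : h =ᵐ[intervalMeasure R] fun z => (s : ℂ) * h' z) :
    intervalEnergy R lam h = s ^ 2 * intervalEnergy R lam h' := by
  unfold intervalEnergy
  rw [← integral_const_mul]
  refine integral_congr_ae ?_
  filter_upwards [hh] with z hz
  rw [hz, norm_mul, Complex.norm_real, Real.norm_eq_abs, mul_pow, sq_abs]
  ring

/-- The one-dimensional Carleman estimate for complex valued functions. -/
lemma carleman_interval {R lam mu : ℝ} (hR : 0 < R) (hlam : 1 ≤ lam) (hmu : 0 ≤ mu)
    {y y1 y2 : ℝ → ℂ} (h0 : MemLp y 2 (intervalMeasure R)) (h1 : MemLp y1 2 (intervalMeasure R))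
    (h2 : MemLp y2 2 (intervalMeasure R))
    (hone : ∀ c : ℝ → ℝ, ContDiff ℝ ∞ c → ∫ z in Set.Ioo (-R) R, (c z : ℂ) * y1 z =
      -∫ z in Set.Ioo (-R) R, ((deriv c z : ℝ) : ℂ) * y z)
    (htwo : ∀ c : ℝ → ℝ, ContDiff ℝ ∞ c → c R = 0 → ∫ z in Set.Ioo (-R) R, (c z : ℂ) * y2 z =
      ∫ z in Set.Ioo (-R) R, ((deriv (deriv c) z : ℝ) : ℂ) * y z) :
    lam * (intervalEnergy R lam y + mu ^ 2 * intervalEnergy R lam y + intervalEnergy R lam y1) ≤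
      4 * intervalEnergy R lam (fun z => y2 z - (mu ^ 2 : ℝ) * y z) ∧
    mu ^ 4 * intervalEnergy R lam y + mu ^ 2 * intervalEnergy R lam y1 + intervalEnergy R lam y2 ≤
      (14 + 20 * (2 * R + 1) ^ 2) * lam *
        intervalEnergy R lam (fun z => y2 z - (mu ^ 2 : ℝ) * y z) := by
  have i0 := h0.integrable one_le_two
  have i1 := h1.integrable one_le_two
  have i2 := h2.integrable one_le_two
  have hre : WeakOde R (fun z => (y z).re) (fun z => (y1 z).re) (fun z => (y2 z).re) := by
    refine ⟨h0.re, h1.re, h2.re, fun c hc => ?_, fun c hc hcR => ?_⟩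
    · rw [integral_re_mul hc.continuous i1, integral_re_mul (contDiff_deriv hc).continuous i0,
        hone c hc, Complex.neg_re]
    · rw [integral_re_mul hc.continuous i2,
        integral_re_mul (contDiff_deriv (contDiff_deriv hc)).continuous i0, htwo c hc hcR]
  have him : WeakOde R (fun z => (y z).im) (fun z => (y1 z).im) (fun z => (y2 z).im) := by
    refine ⟨h0.im, h1.im, h2.im, fun c hc => ?_, fun c hc hcR => ?_⟩
    · rw [integral_im_mul hc.continuous i1, integral_im_mul (contDiff_deriv hc).continuous i0,
        hone c hc, Complex.neg_im]
    · rw [integral_im_mul hc.continuous i2,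
        integral_im_mul (contDiff_deriv (contDiff_deriv hc)).continuous i0, htwo c hc hcR]
  obtain ⟨a1, a2⟩ := hre.carleman hR hlam hmu
  obtain ⟨b1, b2⟩ := him.carleman hR hlam hmu
  have hG : MemLp (fun z => y2 z - (mu ^ 2 : ℝ) * y z) 2 (intervalMeasure R) :=
    h2.sub (h0.const_mul _)
  rw [intervalEnergy_eq_re_add_im h0, intervalEnergy_eq_re_add_im h1,
    intervalEnergy_eq_re_add_im h2, intervalEnergy_eq_re_add_im hG]
  simp only [Complex.sub_re, Complex.sub_im, Complex.re_ofReal_mul, Complex.im_ofReal_mul]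
  constructor <;> linarith

lemma prodT_update_const_mul (a : Fin 3 → ℝ → ℝ) (i : Fin 3) (s : ℝ) (b : ℝ → ℝ) (x : E3) :
    prodT (Function.update a i fun t => s * b t) x = s * prodT (Function.update a i b) x := by
  rw [prodT_update, prodT_update, mul_assoc]

lemma update_modeTest_zero (R : ℝ) (p q p' : Bool) (m n : ℤ) (c : ℝ → ℝ) :
    Function.update (modeTest R p q m n c) 0 (trig R p' m) = modeTest R p' q m n c := by
  funext i; fin_cases i <;> rfl

lemma update_modeTest_one (R : ℝ) (p q q' : Bool) (m n : ℤ) (c : ℝ → ℝ) :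
    Function.update (modeTest R p q m n c) 1 (trig R q' n) = modeTest R p q' m n c := by
  funext i; fin_cases i <;> rfl

lemma update_modeTest_two (R : ℝ) (p q : Bool) (m n : ℤ) (c c' : ℝ → ℝ) :
    Function.update (modeTest R p q m n c) 2 c' = modeTest R p q m n c' := by
  funext i; fin_cases i <;> rfl

lemma contDiff_modeTest (R : ℝ) (p q : Bool) (m n : ℤ) {c : ℝ → ℝ} (hc : ContDiff ℝ ∞ c)
    (i : Fin 3) : ContDiff ℝ ∞ (modeTest R p q m n c i) := by
  fin_cases i
  · exact contDiff_trig R p m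
  · exact contDiff_trig R q n
  · exact hc

/-- An identity between coefficients follows from testing with all smooth functions of `z`. -/
lemma modeCoef_ae_eq {R : ℝ} (hR : 0 < R) {F G : E3 → ℂ}
    (hF : MemLp F 2 (volume.restrict (cube R))) (hG : MemLp G 2 (volume.restrict (cube R)))
    {p q p' q' : Bool} {m n : ℤ} {s : ℝ}
    (h : ∀ c : ℝ → ℝ, ContDiff ℝ ∞ c →
      ∫ x in cube R, (prodT (modeTest R p q m n c) x : ℂ) * F x =
      s * ∫ x in cube R, (prodT (modeTest R p' q' m n c) x : ℂ) * G x) :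
    modeCoef R p q m n F =ᵐ[intervalMeasure R] fun z => (s : ℂ) * modeCoef R p' q' m n G z := by
  have iF := (memLp_modeCoef hR hF p q m n).integrable one_le_two
  have iG := ((memLp_modeCoef hR hG p' q' m n).integrable one_le_two)
  have : (fun z => modeCoef R p q m n F z - (s : ℂ) * modeCoef R p' q' m n G z)
      =ᵐ[intervalMeasure R] 0 := by
    refine ae_eq_zero_of_integral_smooth_complex (iF.sub (iG.const_mul _)) fun c hc => ?_
    have e := h c hc
    rw [← integral_modeCoef_mul hR hF p q m n hc.continuous,
      ← integral_modeCoef_mul hR hG p' q' m n hc.continuous, ← integral_const_mul] at e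
    have i1 := integrable_continuous_mul_complex hc.continuous iF
    have i2 := (integrable_continuous_mul_complex hc.continuous iG).const_mul (s : ℂ)
    have e2 : ∀ z, (c z : ℂ) * (modeCoef R p q m n F z - (s : ℂ) * modeCoef R p' q' m n G z) =
        (c z : ℂ) * modeCoef R p q m n F z - s * ((c z : ℂ) * modeCoef R p' q' m n G z) :=
      fun z => by ring
    simp_rw [e2]
    rw [integral_sub i1 i2, e, sub_self]
  filter_upwards [this] with z hz
  exact sub_eq_zero.1 hz

lemma integral_prodT_update_const_mul {R : ℝ} (a : Fin 3 → ℝ → ℝ) (i : Fin 3) (s : ℝ)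
    (b : ℝ → ℝ) (G : E3 → ℂ) :
    ∫ x in cube R, (prodT (Function.update a i fun t => s * b t) x : ℂ) * G x =
      s * ∫ x in cube R, (prodT (Function.update a i b) x : ℂ) * G x := by
  rw [← integral_const_mul]
  congr 1; funext x
  rw [prodT_update_const_mul]; push_cast; ring

/-- `∫ w |f|²` over the cube, with the Carleman weight `w(z)`. -/
noncomputable def cubeEnergy (R lam : ℝ) (f : E3 → ℂ) : ℝ :=
  ∫ x in cube R, carlemanWeight R lam (x 2) * ‖f x‖ ^ 2

/-- A quadratic inequality between energies in the cube may be checked on each horizontal mode. -/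
lemma sum_cubeEnergy_le_zero {R : ℝ} (hR : 0 < R) (lam : ℝ) {κ : Type*} [Fintype κ]
    (a : κ → ℝ) (p q : κ → Bool) {g : κ → E3 → ℂ}
    (hg : ∀ k, MemLp (g k) 2 (volume.restrict (cube R)))
    (h : ∀ m n, ∑ k, a k * intervalEnergy R lam (modeCoef R (p k) (q k) m n (g k)) ≤ 0) :
    ∑ k, a k * cubeEnergy R lam (g k) ≤ 0 :=
  sum_integral_sq_le_zero_of_modeCoef hR a p q hg (continuous_carlemanWeight R lam)
    (fun z => (carlemanWeight_pos R lam z).le) h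

/-- The first and second weak derivatives in `L²` of a function on the cube that vanishes on the
boundary and whose derivative in `z` vanishes on the lower face. -/
structure CauchyData (R : ℝ) (u : E3 → ℂ) (D : Fin 3 → E3 → ℂ) (DD : Fin 3 → Fin 3 → E3 → ℂ) :
    Prop where
  first : ∀ i, IsWeakPartial R i u (D i)
  second : ∀ i j, IsWeakPartial R j (D i) (DD i j)
  vanishes : VanishesOnBoundary R u
  lowerFace : ∀ p ∈ lowerFace R, Tendsto (D 2) (𝓝 p ⊓ ae (volume.restrict (cube R))) (𝓝 0)

namespace CauchyData

variable {R : ℝ} {u : E3 → ℂ} {D : Fin 3 → E3 → ℂ} {DD : Fin 3 → Fin 3 → E3 → ℂ}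

/-- An `x`-derivative turns the sine coefficients into cosine coefficients and produces a factor
`κ_m`. The boundary terms in this and the following identities vanish by the boundary values of `u`
or of the sines. -/
lemma modeCoef_zero (hR : 0 < R) (h : CauchyData R u D DD) (m n : ℤ) :
    modeCoef R true false m n (D 0) =ᵐ[intervalMeasure R]
      fun z => (freq R m : ℂ) * modeCoef R false false m n u z := by
  refine modeCoef_ae_eq hR (h.first 0).memLp_deriv (h.first 0).memLp fun c hc => ?_
  have e := (h.first 0).integral_prodT_of_vanishes hR h.vanishes
    (contDiff_modeTest R true false m n hc)
  have : modeTest R true false m n c 0 = trig R true m := rfl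
  rw [this, deriv_trig_true, integral_prodT_update_const_mul, update_modeTest_zero] at e
  push_cast at e
  linear_combination e

lemma modeCoef_one (hR : 0 < R) (h : CauchyData R u D DD) (m n : ℤ) :
    modeCoef R false true m n (D 1) =ᵐ[intervalMeasure R]
      fun z => (freq R n : ℂ) * modeCoef R false false m n u z := by
  refine modeCoef_ae_eq hR (h.first 1).memLp_deriv (h.first 1).memLp fun c hc => ?_
  have e := (h.first 1).integral_prodT_of_vanishes hR h.vanishes
    (contDiff_modeTest R false true m n hc)
  have : modeTest R false true m n c 1 = trig R true n := rfl
  rw [this, deriv_trig_true, integral_prodT_update_const_mul, update_modeTest_one] at e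
  push_cast at e
  linear_combination e

lemma integral_modeCoef_two (hR : 0 < R) (h : CauchyData R u D DD) (m n : ℤ) (c : ℝ → ℝ)
    (hc : ContDiff ℝ ∞ c) :
    ∫ z in Set.Ioo (-R) R, (c z : ℂ) * modeCoef R false false m n (D 2) z =
      -∫ z in Set.Ioo (-R) R, ((deriv c z : ℝ) : ℂ) * modeCoef R false false m n u z := by
  rw [integral_modeCoef_mul hR (h.first 2).memLp_deriv false false m n hc.continuous,
    integral_modeCoef_mul hR (h.first 2).memLp false false m n (contDiff_deriv hc).continuous]
  have e := (h.first 2).integral_prodT_of_vanishes hR h.vanishes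
    (contDiff_modeTest R false false m n hc)
  rw [update_modeTest_two] at e
  have : modeTest R false false m n c 2 = c := rfl
  rw [this] at e
  rw [e, neg_neg]

lemma modeCoef_zero_zero (hR : 0 < R) (h : CauchyData R u D DD) (m n : ℤ) :
    modeCoef R false false m n (DD 0 0) =ᵐ[intervalMeasure R]
      fun z => ((-freq R m ^ 2 : ℝ) : ℂ) * modeCoef R false false m n u z := by
  refine modeCoef_ae_eq hR (h.second 0 0).memLp_deriv (h.first 0).memLp fun c hc => ?_
  have e := (h.second 0 0).integral_prodT_of_test_vanishes hR
    (contDiff_modeTest R false false m n hc) (trig_false_neg R m) (trig_false_self hR m)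
  have : modeTest R false false m n c 0 = trig R false m := rfl
  rw [this, deriv_trig_false, integral_prodT_update_const_mul, update_modeTest_zero] at e
  have e' := (h.first 0).integral_prodT_of_vanishes hR h.vanishes
    (contDiff_modeTest R true false m n hc)
  have : modeTest R true false m n c 0 = trig R true m := rfl
  rw [this, deriv_trig_true, integral_prodT_update_const_mul, update_modeTest_zero] at e'
  push_cast at e' ⊢
  linear_combination e - freq R m * e'

lemma modeCoef_one_one (hR : 0 < R) (h : CauchyData R u D DD) (m n : ℤ) :
    modeCoef R false false m n (DD 1 1) =ᵐ[intervalMeasure R]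
      fun z => ((-freq R n ^ 2 : ℝ) : ℂ) * modeCoef R false false m n u z := by
  refine modeCoef_ae_eq hR (h.second 1 1).memLp_deriv (h.first 1).memLp fun c hc => ?_
  have e := (h.second 1 1).integral_prodT_of_test_vanishes hR
    (contDiff_modeTest R false false m n hc) (trig_false_neg R n) (trig_false_self hR n)
  have : modeTest R false false m n c 1 = trig R false n := rfl
  rw [this, deriv_trig_false, integral_prodT_update_const_mul, update_modeTest_one] at e
  have e' := (h.first 1).integral_prodT_of_vanishes hR h.vanishes
    (contDiff_modeTest R false true m n hc)
  have : modeTest R false true m n c 1 = trig R true n := rfl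
  rw [this, deriv_trig_true, integral_prodT_update_const_mul, update_modeTest_one] at e'
  push_cast at e' ⊢
  linear_combination e - freq R n * e'

lemma integral_modeCoef_two_two (hR : 0 < R) (h : CauchyData R u D DD) (m n : ℤ) (c : ℝ → ℝ)
    (hc : ContDiff ℝ ∞ c) (hcR : c R = 0) :
    ∫ z in Set.Ioo (-R) R, (c z : ℂ) * modeCoef R false false m n (DD 2 2) z =
      ∫ z in Set.Ioo (-R) R, ((deriv (deriv c) z : ℝ) : ℂ) * modeCoef R false false m n u z := by
  have e' := h.integral_modeCoef_two hR m n (deriv c) (contDiff_deriv hc)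
  rw [integral_modeCoef_mul hR (h.second 2 2).memLp_deriv false false m n hc.continuous]
  rw [integral_modeCoef_mul hR (h.first 2).memLp_deriv false false m n
    (contDiff_deriv hc).continuous] at e'
  have e := (h.second 2 2).integral_prodT_of_lowerFace hR h.lowerFace
    (contDiff_modeTest R false false m n hc) hcR
  rw [update_modeTest_two] at e
  have : modeTest R false false m n c 2 = c := rfl
  rw [this] at e
  linear_combination e - e'

/-- A mixed horizontal derivative has to be expanded in cosines in both variables. -/
lemma modeCoef_zero_one (hR : 0 < R) (h : CauchyData R u D DD) (m n : ℤ) :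
    modeCoef R true true m n (DD 0 1) =ᵐ[intervalMeasure R]
      fun z => ((freq R m * freq R n : ℝ) : ℂ) * modeCoef R false false m n u z := by
  refine modeCoef_ae_eq hR (h.second 0 1).memLp_deriv (h.first 0).memLp fun c hc => ?_
  have e := (h.first 0).integral_prodT_mixed hR (by decide) (h.second 0 1) h.vanishes
    (contDiff_modeTest R true true m n hc)
  have t0 : modeTest R true true m n c 0 = trig R true m := rfl
  have t1 : modeTest R true true m n c 1 = trig R true n := rfl
  rw [t0, t1, deriv_trig_true, deriv_trig_true, integral_prodT_update_const_mul,
    Function.update_comm (by decide), integral_prodT_update_const_mul, update_modeTest_zero,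
    update_modeTest_one] at e
  push_cast at e ⊢
  linear_combination -e

lemma modeCoef_zero_two (hR : 0 < R) (h : CauchyData R u D DD) (m n : ℤ) :
    modeCoef R true false m n (DD 0 2) =ᵐ[intervalMeasure R]
      fun z => (freq R m : ℂ) * modeCoef R false false m n (D 2) z := by
  refine modeCoef_ae_eq hR (h.second 0 2).memLp_deriv (h.first 2).memLp_deriv fun c hc => ?_
  have e := (h.first 0).integral_prodT_mixed hR (by decide) (h.second 0 2) h.vanishes
    (contDiff_modeTest R true false m n hc)
  have t0 : modeTest R true false m n c 0 = trig R true m := rfl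
  have t2 : modeTest R true false m n c 2 = c := rfl
  rw [t0, t2, deriv_trig_true, integral_prodT_update_const_mul,
    update_modeTest_two, update_modeTest_zero] at e
  have e' := (h.first 2).integral_prodT_of_vanishes hR h.vanishes
    (contDiff_modeTest R false false m n hc)
  have t2 : modeTest R false false m n c 2 = c := rfl
  rw [t2, update_modeTest_two] at e'
  rw [← e, e']
  push_cast
  ring

lemma modeCoef_one_two (hR : 0 < R) (h : CauchyData R u D DD) (m n : ℤ) :
    modeCoef R false true m n (DD 1 2) =ᵐ[intervalMeasure R]
      fun z => (freq R n : ℂ) * modeCoef R false false m n (D 2) z := by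
  refine modeCoef_ae_eq hR (h.second 1 2).memLp_deriv (h.first 2).memLp_deriv fun c hc => ?_
  have e := (h.first 1).integral_prodT_mixed hR (by decide) (h.second 1 2) h.vanishes
    (contDiff_modeTest R false true m n hc)
  have t1 : modeTest R false true m n c 1 = trig R true n := rfl
  have t2 : modeTest R false true m n c 2 = c := rfl
  rw [t1, t2, deriv_trig_true, integral_prodT_update_const_mul,
    update_modeTest_two, update_modeTest_one] at e
  have e' := (h.first 2).integral_prodT_of_vanishes hR h.vanishes
    (contDiff_modeTest R false false m n hc)
  have t2 : modeTest R false false m n c 2 = c := rfl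
  rw [t2, update_modeTest_two] at e'
  rw [← e, e']
  push_cast
  ring

lemma memLp_laplacian (h : CauchyData R u D DD) :
    MemLp (fun x => DD 0 0 x + DD 1 1 x + DD 2 2 x) 2 (volume.restrict (cube R)) :=
  ((h.second 0 0).memLp_deriv.add (h.second 1 1).memLp_deriv).add (h.second 2 2).memLp_deriv

/-- The `(m, n)`-th sine coefficient of the Laplacian is `y'' - μ² y`, with `μ² = κ_m² + κ_n²`. -/
lemma modeCoef_laplacian (hR : 0 < R) (h : CauchyData R u D DD) (m n : ℤ) :
    modeCoef R false false m n (fun x => DD 0 0 x + DD 1 1 x + DD 2 2 x) =ᵐ[intervalMeasure R]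
      fun z => modeCoef R false false m n (DD 2 2) z -
        ((√(freq R m ^ 2 + freq R n ^ 2) ^ 2 : ℝ) : ℂ) * modeCoef R false false m n u z := by
  have L0 := (h.second 0 0).memLp_deriv
  have L1 := (h.second 1 1).memLp_deriv
  have L2 := (h.second 2 2).memLp_deriv
  have M0 := (memLp_modeCoef hR L0 false false m n).integrable one_le_two
  have M1 := (memLp_modeCoef hR L1 false false m n).integrable one_le_two
  have M2 := (memLp_modeCoef hR L2 false false m n).integrable one_le_two
  have ML := (memLp_modeCoef hR h.memLp_laplacian false false m n).integrable one_le_two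
  have key : (fun z => modeCoef R false false m n (fun x => DD 0 0 x + DD 1 1 x + DD 2 2 x) z -
      (modeCoef R false false m n (DD 0 0) z + modeCoef R false false m n (DD 1 1) z +
      modeCoef R false false m n (DD 2 2) z)) =ᵐ[intervalMeasure R] 0 := by
    have M012 : Integrable (fun z => modeCoef R false false m n (DD 0 0) z +
      modeCoef R false false m n (DD 1 1) z + modeCoef R false false m n (DD 2 2) z)
      (intervalMeasure R) := (M0.add M1).add M2
    refine ae_eq_zero_of_integral_smooth_complex (ML.sub M012) fun c hc => ?_
    simp_rw [mul_sub, mul_add]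
    have c0 := integrable_continuous_mul_complex hc.continuous M0
    have c1 := integrable_continuous_mul_complex hc.continuous M1
    have c2 := integrable_continuous_mul_complex hc.continuous M2
    have cL := integrable_continuous_mul_complex hc.continuous ML
    have c01 := c0.add c1
    have c012 := c01.add c2
    simp only [Pi.add_def] at c01 c012
    have ha : ∀ i, Continuous (modeTest R false false m n c i) := fun i =>
      (contDiff_modeTest R false false m n hc i).continuous
    have d0 := integrable_prodT_mul (L0.integrable one_le_two) ha
    have d1 := integrable_prodT_mul (L1.integrable one_le_two) ha
    have d2 := integrable_prodT_mul (L2.integrable one_le_two) ha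
    have d01 := d0.add d1
    simp only [Pi.add_def] at d01
    rw [integral_sub cL c012, integral_add c01 c2, integral_add c0 c1,
      integral_modeCoef_mul hR L0 _ _ _ _ hc.continuous,
      integral_modeCoef_mul hR L1 _ _ _ _ hc.continuous,
      integral_modeCoef_mul hR L2 _ _ _ _ hc.continuous,
      integral_modeCoef_mul hR h.memLp_laplacian _ _ _ _ hc.continuous]
    simp_rw [mul_add]
    rw [integral_add d01 d2, integral_add d0 d1, sub_self]
  filter_upwards [key, h.modeCoef_zero_zero hR m n, h.modeCoef_one_one hR m n] with z hz h0 h1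
  rw [Real.sq_sqrt (by positivity)]
  rw [sub_eq_zero.1 hz, h0, h1]
  push_cast
  ring

/-- The one-dimensional Carleman estimate for the `(m, n)`-th mode, with `μ² = κ_m² + κ_n²`. -/
lemma carleman_mode (hR : 0 < R) (h : CauchyData R u D DD) {lam : ℝ} (hlam : 1 ≤ lam) (m n : ℤ) :
    let A := intervalEnergy R lam (modeCoef R false false m n u)
    let A1 := intervalEnergy R lam (modeCoef R false false m n (D 2))
    let A2 := intervalEnergy R lam (modeCoef R false false m n (DD 2 2))
    let G := intervalEnergy R lam (modeCoef R false false m n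
      (fun x => DD 0 0 x + DD 1 1 x + DD 2 2 x))
    lam * (A + (freq R m ^ 2 + freq R n ^ 2) * A + A1) ≤ 4 * G ∧
    (freq R m ^ 2 + freq R n ^ 2) ^ 2 * A + (freq R m ^ 2 + freq R n ^ 2) * A1 + A2 ≤
      (14 + 20 * (2 * R + 1) ^ 2) * lam * G := by
  intro A A1 A2 G
  have hs : √(freq R m ^ 2 + freq R n ^ 2) ^ 2 = freq R m ^ 2 + freq R n ^ 2 :=
    Real.sq_sqrt (by positivity)
  have key := carleman_interval hR hlam (Real.sqrt_nonneg (freq R m ^ 2 + freq R n ^ 2))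
    (memLp_modeCoef hR (h.first 0).memLp false false m n)
    (memLp_modeCoef hR (h.first 2).memLp_deriv false false m n)
    (memLp_modeCoef hR (h.second 2 2).memLp_deriv false false m n)
    (h.integral_modeCoef_two hR m n) (h.integral_modeCoef_two_two hR m n)
  have hG := intervalEnergy_congr (lam := lam) (s := 1) (by
    simpa using h.modeCoef_laplacian hR m n)
  rw [one_pow, one_mul] at hG
  have h4 : √(freq R m ^ 2 + freq R n ^ 2) ^ 4 = (freq R m ^ 2 + freq R n ^ 2) ^ 2 := by
    rw [show (4 : ℕ) = 2 * 2 from rfl, pow_mul, hs]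
  rw [← Complex.ofReal_pow] at hG
  rw [h4, ← hG, hs] at key
  exact key

/-- The Carleman estimate, lower order part. -/
theorem carleman_lower (hR : 0 < R) (h : CauchyData R u D DD) {lam : ℝ} (hlam : 1 ≤ lam) :
    lam * (cubeEnergy R lam u + cubeEnergy R lam (D 0) + cubeEnergy R lam (D 1) +
      cubeEnergy R lam (D 2)) ≤
      4 * cubeEnergy R lam (fun x => DD 0 0 x + DD 1 1 x + DD 2 2 x) := by
  -- `D 0` and `D 1` are expanded in cosines in the variable of differentiation
  have := sum_cubeEnergy_le_zero hR lam ![lam, lam, lam, lam, -4]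
    ![false, true, false, false, false] ![false, false, true, false, false]
    (g := ![u, D 0, D 1, D 2, fun x => DD 0 0 x + DD 1 1 x + DD 2 2 x]) (by
      intro k; fin_cases k
      · exact (h.first 0).memLp
      · exact (h.first 0).memLp_deriv
      · exact (h.first 1).memLp_deriv
      · exact (h.first 2).memLp_deriv
      · exact h.memLp_laplacian) (by
      intro m n
      have e1 := (h.carleman_mode hR hlam m n).1
      have e2 := intervalEnergy_congr (lam := lam) (h.modeCoef_zero hR m n)
      have e3 := intervalEnergy_congr (lam := lam) (h.modeCoef_one hR m n)
      simp only [Fin.sum_univ_five, Matrix.cons_val_zero, Matrix.cons_val_one, Matrix.cons_val]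
      rw [e2, e3]
      linarith)
  simp only [Fin.sum_univ_five, Matrix.cons_val_zero, Matrix.cons_val_one, Matrix.cons_val] at this
  linarith

/-- The Carleman estimate, second order part. -/
theorem carleman_second (hR : 0 < R) (h : CauchyData R u D DD) {lam : ℝ} (hlam : 1 ≤ lam) :
    cubeEnergy R lam (DD 0 0) + cubeEnergy R lam (DD 1 1) + cubeEnergy R lam (DD 2 2) +
      cubeEnergy R lam (DD 0 1) + cubeEnergy R lam (DD 0 2) + cubeEnergy R lam (DD 1 2) ≤
      (14 + 20 * (2 * R + 1) ^ 2) * lam *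
        cubeEnergy R lam (fun x => DD 0 0 x + DD 1 1 x + DD 2 2 x) := by
  have := sum_cubeEnergy_le_zero hR lam
    ![1, 1, 1, 1, 1, 1, -((14 + 20 * (2 * R + 1) ^ 2) * lam)]
    ![false, false, false, true, true, false, false]
    ![false, false, false, true, false, true, false]
    (g := ![DD 0 0, DD 1 1, DD 2 2, DD 0 1, DD 0 2, DD 1 2,
      fun x => DD 0 0 x + DD 1 1 x + DD 2 2 x]) (by
      intro k; fin_cases k
      · exact (h.second 0 0).memLp_deriv
      · exact (h.second 1 1).memLp_deriv
      · exact (h.second 2 2).memLp_deriv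
      · exact (h.second 0 1).memLp_deriv
      · exact (h.second 0 2).memLp_deriv
      · exact (h.second 1 2).memLp_deriv
      · exact h.memLp_laplacian) (by
      intro m n
      have e1 := (h.carleman_mode hR hlam m n).2
      have e2 := intervalEnergy_congr (lam := lam) (h.modeCoef_zero_zero hR m n)
      have e3 := intervalEnergy_congr (lam := lam) (h.modeCoef_one_one hR m n)
      have e4 := intervalEnergy_congr (lam := lam) (h.modeCoef_zero_one hR m n)
      have e5 := intervalEnergy_congr (lam := lam) (h.modeCoef_zero_two hR m n)
      have e6 := intervalEnergy_congr (lam := lam) (h.modeCoef_one_two hR m n)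
      have hA := intervalEnergy_nonneg R lam (modeCoef R false false m n u)
      simp only [Fin.sum_univ_seven, Matrix.cons_val_zero, Matrix.cons_val_one, Matrix.cons_val]
      rw [e2, e3, e4, e5, e6]
      have := mul_nonneg (mul_nonneg (sq_nonneg (freq R m)) (sq_nonneg (freq R n))) hA
      nlinarith)
  simp only [Fin.sum_univ_seven, Matrix.cons_val_zero, Matrix.cons_val_one, Matrix.cons_val] at this
  linarith

end CauchyData

/-! ### Functions with two weak derivatives in `L²` of the cube are bounded -/

lemma convex_cube (R : ℝ) : Convex ℝ (cube R) := by
  intro x hx y hy a b ha hb hab i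
  have h1 := abs_lt.1 (hx i)
  have h2 := abs_lt.1 (hy i)
  simp only [PiLp.add_apply, PiLp.smul_apply, smul_eq_mul]
  rw [abs_lt]
  rcases ha.eq_or_lt with rfl | ha
  · have : b = 1 := by linarith
    subst this; constructor <;> linarith
  · constructor <;> nlinarith

/-- The function `p ↦ s⁻³ θ(x₀ + (p - x₀) / s)`, the dilation of `θ` about `x₀` which preserves
the integral. -/
noncomputable def dilate (x₀ : E3) (θ : E3 → ℝ) (s : ℝ) (p : E3) : ℝ :=
  s⁻¹ ^ 3 * θ (x₀ + s⁻¹ • (p - x₀))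

/-- The function `y ↦ (y - x₀)_j θ(y)`. -/
def moment (x₀ : E3) (j : Fin 3) (θ : E3 → ℝ) (y : E3) : ℝ := (y j - x₀ j) * θ y

/-- The mean `∫ f(p) s⁻³ θ(x₀ + (p - x₀) / s) dp` over the cube. -/
noncomputable def scaledMean (R : ℝ) (x₀ : E3) (θ : E3 → ℝ) (f : E3 → ℂ) (s : ℝ) : ℂ :=
  ∫ p in cube R, (dilate x₀ θ s p : ℂ) * f p

lemma contDiff_moment (x₀ : E3) (j : Fin 3) {θ : E3 → ℝ} (hθ : ContDiff ℝ ∞ θ) :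
    ContDiff ℝ ∞ (moment x₀ j θ) := by
  unfold moment
  exact ((contDiff_piLp_apply (𝕜 := ℝ) (p := 2) (i := j)).sub contDiff_const).mul hθ

lemma tsupport_moment_subset (x₀ : E3) (j : Fin 3) (θ : E3 → ℝ) :
    tsupport (moment x₀ j θ) ⊆ tsupport θ :=
  tsupport_mul_subset_right

lemma contDiff_dilate (x₀ : E3) {θ : E3 → ℝ} (hθ : ContDiff ℝ ∞ θ) (s : ℝ) :
    ContDiff ℝ ∞ (dilate x₀ θ s) := by
  unfold dilate
  exact contDiff_const.mul (hθ.comp (contDiff_const.add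
    ((contDiff_id.sub contDiff_const).const_smul s⁻¹)))

lemma exists_of_dilate_ne_zero {x₀ : E3} {θ : E3 → ℝ} {s : ℝ} (hs : 0 < s) {p : E3}
    (hp : dilate x₀ θ s p ≠ 0) : ∃ y ∈ tsupport θ, x₀ + s • (y - x₀) = p := by
  refine ⟨x₀ + s⁻¹ • (p - x₀), subset_tsupport θ (right_ne_zero_of_mul hp), ?_⟩
  rw [add_sub_cancel_left, smul_smul, mul_inv_cancel₀ hs.ne', one_smul, add_sub_cancel]

lemma tsupport_dilate_subset {x₀ : E3} {θ : E3 → ℝ} (hθ : HasCompactSupport θ) {s : ℝ}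
    (hs : 0 < s) : tsupport (dilate x₀ θ s) ⊆ (fun y => x₀ + s • (y - x₀)) '' tsupport θ := by
  have hc : IsCompact ((fun y => x₀ + s • (y - x₀)) '' tsupport θ) :=
    hθ.isCompact.image (by fun_prop)
  refine closure_minimal ?_ hc.isClosed
  intro p hp
  exact exists_of_dilate_ne_zero hs hp

lemma hasCompactSupport_dilate {x₀ : E3} {θ : E3 → ℝ} (hθ : HasCompactSupport θ) {s : ℝ}
    (hs : 0 < s) : HasCompactSupport (dilate x₀ θ s) :=
  (hθ.isCompact.image (by fun_prop)).of_isClosed_subset (isClosed_tsupport _)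
    (tsupport_dilate_subset hθ hs)

lemma tsupport_dilate_subset_cube {R : ℝ} {x₀ : E3} (hx₀ : x₀ ∈ cube R) {θ : E3 → ℝ}
    (hθ : HasCompactSupport θ) (hθ' : tsupport θ ⊆ cube R) {s : ℝ} (hs : 0 < s) (hs1 : s ≤ 1) :
    tsupport (dilate x₀ θ s) ⊆ cube R := by
  refine (tsupport_dilate_subset hθ hs).trans ?_
  rintro _ ⟨y, hy, rfl⟩
  exact (convex_cube R).add_smul_sub_mem hx₀ (hθ' hy) ⟨hs.le, hs1⟩

lemma fderiv_apply_eq_sum (θ : E3 → ℝ) (y v : E3) :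
    fderiv ℝ θ y v = ∑ j, v j * partialDeriv j θ y := by
  have : v = ∑ j, v j • EuclideanSpace.single j (1 : ℝ) := by
    ext i; simp [Fin.sum_univ_three]; fin_cases i <;> simp
  conv_lhs => rw [this]
  simp only [map_sum, map_smul, smul_eq_mul, partialDeriv]

lemma partialDeriv_dilate (x₀ : E3) {θ : E3 → ℝ} (hθ : ContDiff ℝ ∞ θ) (s : ℝ) (j : Fin 3)
    (p : E3) : partialDeriv j (dilate x₀ θ s) p =
      s⁻¹ ^ 4 * partialDeriv j θ (x₀ + s⁻¹ • (p - x₀)) := by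
  have h1 : HasFDerivAt (fun p : E3 => x₀ + s⁻¹ • (p - x₀))
      (s⁻¹ • ContinuousLinearMap.id ℝ E3) p :=
    (((hasFDerivAt_id p).sub_const x₀).const_smul s⁻¹).const_add x₀
  have h2 := (hθ.differentiable (by simp) (x₀ + s⁻¹ • (p - x₀))).hasFDerivAt
  have h3 := (h2.comp p h1).const_mul (s⁻¹ ^ 3)
  have h4 : HasFDerivAt (dilate x₀ θ s) _ p := h3
  unfold partialDeriv
  rw [h4.fderiv]
  simp
  ring

lemma partialDeriv_moment (x₀ : E3) {θ : E3 → ℝ} (hθ : ContDiff ℝ ∞ θ) (j : Fin 3)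
    (y : E3) : partialDeriv j (moment x₀ j θ) y = θ y + (y j - x₀ j) * partialDeriv j θ y := by
  have h1 : HasFDerivAt (fun y : E3 => y j - x₀ j) (EuclideanSpace.proj j : E3 →L[ℝ] ℝ) y :=
    (EuclideanSpace.proj j : E3 →L[ℝ] ℝ).hasFDerivAt.sub_const _
  have h2 := (hθ.differentiable (by simp) y).hasFDerivAt
  have h4 : HasFDerivAt (moment x₀ j θ) _ y := h1.mul h2
  unfold partialDeriv
  rw [h4.fderiv]
  simp
  ring

/-- The derivative of the dilation with respect to the parameter is a divergence. -/
lemma hasDerivAt_dilate (x₀ : E3) {θ : E3 → ℝ} (hθ : ContDiff ℝ ∞ θ) {s : ℝ} (hs : 0 < s)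
    (p : E3) : HasDerivAt (fun s => dilate x₀ θ s p)
      (-∑ j, partialDeriv j (dilate x₀ (moment x₀ j θ) s) p) s := by
  have h0 := hasDerivAt_inv hs.ne'
  have h1 : HasDerivAt (fun s : ℝ => x₀ + s⁻¹ • (p - x₀)) ((-(s ^ 2)⁻¹) • (p - x₀)) s :=
    (h0.smul_const (p - x₀)).const_add x₀
  have h2 := (hθ.differentiable (by simp) (x₀ + s⁻¹ • (p - x₀))).hasFDerivAt
  have h3 := h2.comp_hasDerivAt s h1
  have h4 := (h0.pow 3).mul h3
  have h5 : HasDerivAt (fun s => dilate x₀ θ s p) _ s := h4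
  convert h5 using 1
  simp only [partialDeriv_dilate x₀ (contDiff_moment x₀ _ hθ), partialDeriv_moment x₀ hθ]
  rw [fderiv_apply_eq_sum]
  simp [Fin.sum_univ_three]
  field_simp
  ring

lemma continuous_partialDeriv {θ : E3 → ℝ} (hθ : ContDiff ℝ ∞ θ) (j : Fin 3) :
    Continuous (partialDeriv j θ) := (contDiff_partialDeriv hθ j).continuous

lemma exists_bound_partialDeriv {θ : E3 → ℝ} (hθ : ContDiff ℝ ∞ θ) (hc : HasCompactSupport θ)
    (j : Fin 3) : ∃ B, ∀ y, ‖partialDeriv j θ y‖ ≤ B :=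
  (continuous_partialDeriv hθ j).bounded_above_of_compact_support
    (hasCompactSupport_partialDeriv hc j)

/-- Since the parameter derivative of the dilation is a divergence, the derivative of a scaled mean
of `f` is a sum of scaled means of the weak derivatives of `f`. -/
lemma hasDerivAt_scaledMean {R : ℝ} {x₀ : E3} (hx₀ : x₀ ∈ cube R) {θ : E3 → ℝ}
    (hθ : ContDiff ℝ ∞ θ) (hc : HasCompactSupport θ) (hθ' : tsupport θ ⊆ cube R)
    {f : E3 → ℂ} {g : Fin 3 → E3 → ℂ} (hf : ∀ j, IsWeakPartial R j f (g j))
    {s : ℝ} (hs : 0 < s) (hs1 : s ≤ 1) :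
    HasDerivAt (scaledMean R x₀ θ f) (∑ j, scaledMean R x₀ (moment x₀ j θ) (g j) s) s := by
  have hcm : ∀ j, HasCompactSupport (moment x₀ j θ) := fun j =>
    hc.isCompact.of_isClosed_subset (isClosed_tsupport _) (tsupport_moment_subset x₀ j θ)
  have hm : ∀ j, ContDiff ℝ ∞ (moment x₀ j θ) := fun j => contDiff_moment x₀ j hθ
  choose B hB using fun j => exists_bound_partialDeriv (hm j) (hcm j) j
  have fi : Integrable f (volume.restrict (cube R)) := (hf 0).integrable
  have hcont : ∀ s, Continuous fun p => ((dilate x₀ θ s p : ℝ) : ℂ) := fun s =>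
    Complex.continuous_ofReal.comp (contDiff_dilate x₀ hθ s).continuous
  have hcont' : ∀ s j, Continuous fun p =>
      ((partialDeriv j (dilate x₀ (moment x₀ j θ) s) p : ℝ) : ℂ) := fun s j =>
    Complex.continuous_ofReal.comp (continuous_partialDeriv (contDiff_dilate x₀ (hm j) s) j)
  obtain ⟨B0, hB0⟩ := (contDiff_dilate x₀ hθ s).continuous.bounded_above_of_compact_support
    (hasCompactSupport_dilate hc hs)
  have key := hasDerivAt_integral_of_dominated_loc_of_deriv_le
    (μ := volume.restrict (cube R)) (F := fun s p => (dilate x₀ θ s p : ℂ) * f p)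
    (F' := fun s p => ((-∑ j, partialDeriv j (dilate x₀ (moment x₀ j θ) s) p : ℝ) : ℂ) * f p)
    (x₀ := s) (s := Set.Ioi (s / 2)) (bound := fun p => ((s / 2)⁻¹ ^ 4 * ∑ j, B j) * ‖f p‖)
    (Ioi_mem_nhds (by linarith))
    (Eventually.of_forall fun t => (hcont t).aestronglyMeasurable.mul fi.aestronglyMeasurable)
    (fi.bdd_mul (c := B0) (hcont s).aestronglyMeasurable
      (Eventually.of_forall fun p => by rw [Complex.norm_real]; exact hB0 p))
    (by
      refine AEStronglyMeasurable.mul ?_ fi.aestronglyMeasurable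
      push_cast
      exact (continuous_finsetSum _ fun j _ => hcont' s j).neg.aestronglyMeasurable)
    (Eventually.of_forall fun p t ht => by
      have ht' : 0 < t := lt_trans (by positivity) ht
      rw [norm_mul, Complex.norm_real]
      refine mul_le_mul_of_nonneg_right ?_ (norm_nonneg _)
      rw [norm_neg, Finset.mul_sum]
      refine (norm_sum_le _ _).trans (Finset.sum_le_sum fun j _ => ?_)
      rw [partialDeriv_dilate x₀ (hm j), norm_mul]
      refine mul_le_mul ?_ (hB j _) (norm_nonneg _) (by positivity)
      rw [Real.norm_of_nonneg (by positivity)]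
      have : t⁻¹ ≤ (s / 2)⁻¹ := inv_anti₀ (by positivity) (le_of_lt ht)
      gcongr)
    (fi.norm.const_mul _)
    (Eventually.of_forall fun p t ht => by
      have ht' : 0 < t := lt_trans (by positivity) ht
      exact ((hasDerivAt_dilate x₀ hθ ht' p).ofReal_comp).mul_const (f p))
  refine key.2.congr_deriv ?_
  symm
  have e : ∀ p, ((-∑ j, partialDeriv j (dilate x₀ (moment x₀ j θ) s) p : ℝ) : ℂ) * f p =
      -∑ j, ((partialDeriv j (dilate x₀ (moment x₀ j θ) s) p : ℝ) : ℂ) * f p := by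
    intro p; push_cast; rw [neg_mul, Finset.sum_mul]
  rw [integral_congr_ae (Eventually.of_forall e)]
  rw [integral_neg, integral_finsetSum, ← Finset.sum_neg_distrib]
  · refine Finset.sum_congr rfl fun j _ => ?_
    rw [(hf j).integral_eq _ (contDiff_dilate x₀ (hm j) s)
      (hasCompactSupport_dilate (hcm j) hs) (tsupport_dilate_subset_cube hx₀ (hcm j)
        ((tsupport_moment_subset x₀ j θ).trans hθ') hs hs1), neg_neg]
    rfl
  · intro j _
    obtain ⟨B1, hB1⟩ := exists_bound_partialDeriv (contDiff_dilate x₀ (hm j) s)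
      (hasCompactSupport_dilate (hcm j) hs) j
    exact fi.bdd_mul (c := B1) (hcont' s j).aestronglyMeasurable
      (Eventually.of_forall fun p => by rw [Complex.norm_real]; exact hB1 p)

lemma integral_comp_dilation (x₀ : E3) (F : E3 → ℝ) {s : ℝ} (hs : 0 < s) :
    ∫ p, F (x₀ + s⁻¹ • (p - x₀)) = s ^ 3 * ∫ y, F y := by
  have h1 := integral_sub_right_eq_self (μ := (volume : Measure E3))
    (fun q => F (x₀ + s⁻¹ • q)) x₀
  rw [h1, Measure.integral_comp_inv_smul volume (fun q => F (x₀ + q)) s,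
    integral_add_left_eq_self, finrank_euclideanSpace_fin, abs_of_pos (by positivity), smul_eq_mul]

/-- The dilation by `s` has `L²`-norm `s^{-3/2} ‖θ‖`. -/
lemma norm_scaledMean_le {R : ℝ} (x₀ : E3) {θ : E3 → ℝ}
    (hθ : ContDiff ℝ ∞ θ) (hc : HasCompactSupport θ)
    {f : E3 → ℂ} (hf : MemLp f 2 (volume.restrict (cube R))) {s : ℝ} (hs : 0 < s) :
    ‖scaledMean R x₀ θ f s‖ ≤ (s * √s)⁻¹ * ((∫ y, θ y ^ 2) + ∫ p in cube R, ‖f p‖ ^ 2) := by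
  have hD := contDiff_dilate x₀ hθ s
  have hDc := hasCompactSupport_dilate (x₀ := x₀) hc hs
  have i1 : Integrable (fun p => dilate x₀ θ s p ^ 2) := by
    refine (hD.pow 2).continuous.integrable_of_hasCompactSupport ?_
    exact hDc.comp_left (g := fun t : ℝ => t ^ 2) (by simp)
  have i2 : Integrable (fun p => ‖f p‖ ^ 2) (volume.restrict (cube R)) :=
    hf.integrable_norm_pow (p := 2) (by simp)
  have e1 : ∫ p, dilate x₀ θ s p ^ 2 = s⁻¹ ^ 3 * ∫ y, θ y ^ 2 := by
    have := integral_comp_dilation x₀ (fun y => θ y ^ 2) hs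
    unfold dilate
    simp_rw [mul_pow]
    rw [integral_const_mul, this]
    field_simp
  have hr := Real.sq_sqrt hs.le
  have hrp := Real.sqrt_pos.2 hs
  calc ‖scaledMean R x₀ θ f s‖ ≤ ∫ p in cube R, ‖(dilate x₀ θ s p : ℂ) * f p‖ :=
        norm_integral_le_integral_norm _
    _ ≤ ∫ p in cube R, ((s * √s) * dilate x₀ θ s p ^ 2 + (s * √s)⁻¹ * ‖f p‖ ^ 2) := by
        -- weighted arithmetic-geometric mean inequality; the weight `s^{3/2}` balances both terms
        refine integral_mono_of_nonneg (Eventually.of_forall fun p => norm_nonneg _)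
          ((i1.integrableOn.const_mul _).add (i2.const_mul _)) (Eventually.of_forall fun p => ?_)
        simp only [norm_mul, Complex.norm_real]
        rw [Real.norm_eq_abs, ← sq_abs (dilate x₀ θ s p)]
        have hq : 0 < s * √s := by positivity
        have : (s * √s) * (s * √s)⁻¹ = 1 := mul_inv_cancel₀ hq.ne'
        set q := s * √s
        have hi : 0 < q⁻¹ := by positivity
        set D := |dilate x₀ θ s p|
        have hD0 : 0 ≤ D := abs_nonneg _
        have : q * D ^ 2 + q⁻¹ * ‖f p‖ ^ 2 - 2 * (D * ‖f p‖) = q⁻¹ * (q * D - ‖f p‖) ^ 2 := by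
          field_simp; ring
        have h2 : 0 ≤ q⁻¹ * (q * D - ‖f p‖) ^ 2 := by positivity
        have h3 : 0 ≤ D * ‖f p‖ := by positivity
        linarith
    _ = (s * √s) * (∫ p in cube R, dilate x₀ θ s p ^ 2) +
          (s * √s)⁻¹ * ∫ p in cube R, ‖f p‖ ^ 2 := by
        rw [integral_add (i1.integrableOn.const_mul _) (i2.const_mul _), integral_const_mul,
          integral_const_mul]
    _ ≤ (s * √s) * (s⁻¹ ^ 3 * ∫ y, θ y ^ 2) + (s * √s)⁻¹ * ∫ p in cube R, ‖f p‖ ^ 2 := by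
        rw [← e1]
        have := setIntegral_le_integral (s := cube R) i1 (Eventually.of_forall fun p => sq_nonneg _)
        gcongr
    _ = _ := by
        have : (s * √s) * s⁻¹ ^ 3 = (s * √s)⁻¹ := by
          field_simp
          rw [hr]
        rw [← mul_assoc, this]; ring

lemma integral_sq_moment_le {R : ℝ} {x₀ : E3} (hx₀ : x₀ ∈ cube R) (j : Fin 3)
    {θ : E3 → ℝ} (hθ : ContDiff ℝ ∞ θ) (hc : HasCompactSupport θ) (hθ' : tsupport θ ⊆ cube R) :
    ∫ y, moment x₀ j θ y ^ 2 ≤ (2 * R) ^ 2 * ∫ y, θ y ^ 2 := by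
  rw [← integral_const_mul]
  refine integral_mono_of_nonneg (Eventually.of_forall fun p => sq_nonneg _) ?_
    (Eventually.of_forall fun y => ?_)
  · refine Integrable.const_mul ?_ _
    refine (hθ.pow 2).continuous.integrable_of_hasCompactSupport ?_
    exact hc.comp_left (g := fun t : ℝ => t ^ 2) (by simp)
  · simp only [moment, mul_pow]
    by_cases hy : y ∈ tsupport θ
    · have h1 := abs_lt.1 (hθ' hy j)
      have h2 := abs_lt.1 (hx₀ j)
      refine mul_le_mul_of_nonneg_right ?_ (sq_nonneg _)
      rw [← mul_pow]
      refine sq_le_sq' ?_ ?_ <;> linarith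
    · rw [image_eq_zero_of_notMem_tsupport hy]; simp

lemma hasDerivAt_neg_two_div_sqrt {t : ℝ} (ht : 0 < t) :
    HasDerivAt (fun t => -2 / √t) ((t * √t)⁻¹) t := by
  have h1 := (Real.hasDerivAt_sqrt ht.ne')
  have hp := Real.sqrt_pos.2 ht
  have h2 := (hasDerivAt_const t (-2 : ℝ)).div h1 hp.ne'
  refine h2.congr_deriv ?_
  have := Real.sq_sqrt ht.le
  field_simp
  rw [this]; ring

/-- A function on `(0, 1/2]` whose second derivative is bounded by `A t^{-3/2}` is bounded. -/
lemma norm_le_of_deriv_two_le {h h1 h2 : ℝ → ℂ} {A : ℝ}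
    (hh : ∀ t, 0 < t → t ≤ 1 → HasDerivAt h (h1 t) t)
    (hh1 : ∀ t, 0 < t → t ≤ 1 → HasDerivAt h1 (h2 t) t)
    (hA : ∀ t, 0 < t → t ≤ 1 → ‖h2 t‖ ≤ A * (t * √t)⁻¹) {s : ℝ} (hs : 0 < s) (hs1 : s ≤ 1) :
    ‖h s‖ ≤ ‖h 1‖ + ‖h1 1‖ + 4 * A := by
  have hA0 : 0 ≤ A := by
    have := (norm_nonneg _).trans (hA 1 one_pos le_rfl)
    simpa using this
  -- `-2 / √t` and `4 √t` are primitives of `t^{-3/2}` and `2 / √t`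
  have step1 : ∀ s, 0 < s → s ≤ 1 → ‖h1 s‖ ≤ ‖h1 1‖ + A * (2 / √s) := by
    intro s hs hs1
    have := image_norm_le_of_norm_deriv_right_le_deriv_boundary' (a := s) (b := 1)
      (f := fun t => h1 t - h1 s) (f' := h2) (B := fun t => A * (-2 / √t) - A * (-2 / √s))
      (B' := fun t => A * (t * √t)⁻¹)
      (fun t ht => ((hh1 t (hs.trans_le ht.1) ht.2).continuousAt.sub
        continuousAt_const).continuousWithinAt)
      (fun t ht => ((hh1 t (hs.trans_le ht.1) ht.2.le).sub_const _).hasDerivWithinAt)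
      (by simp)
      (fun t ht => (((hasDerivAt_neg_two_div_sqrt (hs.trans_le ht.1)).const_mul A).sub_const
        _).continuousAt.continuousWithinAt)
      (fun t ht => (((hasDerivAt_neg_two_div_sqrt (hs.trans_le ht.1)).const_mul A).sub_const
        _).hasDerivWithinAt)
      (fun t ht => hA t (hs.trans_le ht.1) ht.2.le) (Set.right_mem_Icc.2 hs1)
    have e : A * (-2 / √1) - A * (-2 / √s) ≤ A * (2 / √s) := by
      rw [Real.sqrt_one]
      have : A * (-2 / √s) = - (A * (2 / √s)) := by ring
      rw [this]; linarith
    have := norm_sub_norm_le (h1 s) (h1 1)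
    rw [norm_sub_rev] at this
    linarith
  have := image_norm_le_of_norm_deriv_right_le_deriv_boundary' (a := s) (b := 1)
    (f := fun t => h t - h s) (f' := h1)
    (B := fun t => (‖h1 1‖ * t + 4 * A * √t) - (‖h1 1‖ * s + 4 * A * √s))
    (B' := fun t => ‖h1 1‖ + A * (2 / √t))
    (fun t ht => ((hh t (hs.trans_le ht.1) ht.2).continuousAt.sub
      continuousAt_const).continuousWithinAt)
    (fun t ht => ((hh t (hs.trans_le ht.1) ht.2.le).sub_const _).hasDerivWithinAt)
    (by simp)
    (by fun_prop)
    (fun t ht => by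
      have ht0 : 0 < t := hs.trans_le ht.1
      have hp := Real.sqrt_pos.2 ht0
      have := (((hasDerivAt_id t).const_mul ‖h1 1‖).add
        ((Real.hasDerivAt_sqrt ht0.ne').const_mul (4 * A))).sub_const
          (‖h1 1‖ * s + 4 * A * √s)
      refine (this.congr_deriv ?_).hasDerivWithinAt
      field_simp; ring)
    (fun t ht => step1 t (hs.trans_le ht.1) ht.2.le) (Set.right_mem_Icc.2 hs1)
  have e : (‖h1 1‖ * 1 + 4 * A * √1) - (‖h1 1‖ * s + 4 * A * √s) ≤ ‖h1 1‖ + 4 * A := by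
    rw [Real.sqrt_one]
    have : 0 ≤ ‖h1 1‖ * s + 4 * A * √s := by positivity
    linarith
  have := norm_sub_norm_le (h s) (h 1)
  rw [norm_sub_rev] at this
  linarith

/-- A bump function of integral one supported in the cube. -/
lemma exists_unit_bump {R : ℝ} (hR : 0 < R) : ∃ θ : E3 → ℝ, ContDiff ℝ ∞ θ ∧
    HasCompactSupport θ ∧ tsupport θ ⊆ cube R ∧ ∫ y, θ y = 1 := by
  let φ : ContDiffBump (0 : E3) := ⟨R / 4, R / 2, by positivity, by linarith⟩
  refine ⟨φ.normed volume, φ.contDiff_normed, φ.hasCompactSupport_normed, ?_, φ.integral_normed⟩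
  rw [φ.tsupport_normed_eq]
  intro x hx i
  have h1 : ‖x‖ ≤ R / 2 := by simpa using hx
  have h2 := PiLp.norm_apply_le x i
  rw [Real.norm_eq_abs] at h2
  linarith

/-- The scaled means converge to the function, at its Lebesgue points, as the scale tends to
zero. -/
lemma ae_tendsto_scaledMean {R : ℝ} (hR : 0 < R) {θ : E3 → ℝ} (hθ : ContDiff ℝ ∞ θ)
    (hc : HasCompactSupport θ) (hθ' : tsupport θ ⊆ cube R) (h1 : ∫ y, θ y = 1) {f : E3 → ℂ}
    (hf : Integrable f (volume.restrict (cube R))) :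
    ∀ᵐ x₀ ∂volume.restrict (cube R),
      Tendsto (scaledMean R x₀ θ f) (𝓝[>] 0) (𝓝 (f x₀)) := by
  have hL : Integrable ((cube R).indicator f) := by
    rwa [integrable_indicator_iff (measurableSet_cube R)]
  rw [ae_restrict_iff' (measurableSet_cube R)]
  filter_upwards [IsUnifLocDoublingMeasure.ae_tendsto_average_norm_sub volume
    hL.locallyIntegrable 1] with x₀ hx hx₀
  obtain ⟨B, hB⟩ := hθ.continuous.bounded_above_of_compact_support hc
  have hB0 : 0 ≤ B := (norm_nonneg _).trans (hB 0)
  have hδ : Tendsto (fun s : ℝ => 6 * R * s) (𝓝[>] 0) (𝓝[>] 0) := by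
    refine tendsto_nhdsWithin_iff.2 ⟨?_, ?_⟩
    · have : Tendsto (fun s : ℝ => 6 * R * s) (𝓝 0) (𝓝 (6 * R * 0)) := by
        exact (continuous_const.mul continuous_id).tendsto 0
      rw [mul_zero] at this
      exact this.mono_left nhdsWithin_le_nhds
    · filter_upwards [self_mem_nhdsWithin] with s hs
      have : (0 : ℝ) < s := hs
      show 0 < 6 * R * s
      positivity
  have hav := hx (fun _ : ℝ => x₀) (fun s => 6 * R * s) hδ (by
    filter_upwards [self_mem_nhdsWithin] with s hs
    have : (0 : ℝ) < s := hs
    exact Metric.mem_closedBall_self (by positivity))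
  set v := volume.real (Metric.ball (0 : E3) 1)
  have hlim : Tendsto (fun s : ℝ => B * (6 * R) ^ 3 * v *
      ⨍ y in Metric.closedBall x₀ (6 * R * s), ‖(cube R).indicator f y - (cube R).indicator f x₀‖)
      (𝓝[>] 0) (𝓝 0) := by
    simpa using hav.const_mul (B * (6 * R) ^ 3 * v)
  rw [tendsto_iff_norm_sub_tendsto_zero]
  refine squeeze_zero' (Eventually.of_forall fun s => norm_nonneg _) ?_ hlim
  have hev : ∀ᶠ s : ℝ in 𝓝[>] 0, s ∈ Set.Ioo (0 : ℝ) 1 := Ioo_mem_nhdsGT one_pos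
  filter_upwards [hev] with s hs
  have hs0 := hs.1
  have hDc := (contDiff_dilate x₀ hθ s).continuous
  have hDs := hasCompactSupport_dilate (x₀ := x₀) hc hs0
  have hDi : Integrable (dilate x₀ θ s) := hDc.integrable_of_hasCompactSupport hDs
  have hDt := tsupport_dilate_subset_cube hx₀ hc hθ' hs0 hs.2.le
  have hone : ∫ p in cube R, (dilate x₀ θ s p : ℂ) = 1 := by
    rw [integral_complex_ofReal, setIntegral_eq_integral_of_forall_compl_eq_zero]
    · unfold dilate
      rw [integral_const_mul, integral_comp_dilation x₀ θ hs0, h1]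
      have := hs0.ne'
      norm_cast
      field_simp
    · intro p hp
      exact image_eq_zero_of_notMem_tsupport fun h => hp (hDt h)
  obtain ⟨B0, hB0'⟩ := hDc.bounded_above_of_compact_support hDs
  have i1 : Integrable (fun p => (dilate x₀ θ s p : ℂ) * f p) (volume.restrict (cube R)) :=
    hf.bdd_mul (c := B0) (Complex.continuous_ofReal.comp hDc).aestronglyMeasurable
      (Eventually.of_forall fun p => by
        show ‖((dilate x₀ θ s p : ℝ) : ℂ)‖ ≤ _
        rw [Complex.norm_real]; exact hB0' p)
  have i2 : Integrable (fun p => (dilate x₀ θ s p : ℂ) * f x₀) (volume.restrict (cube R)) :=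
    (hDi.ofReal.integrableOn).mul_const _
  have e : scaledMean R x₀ θ f s - f x₀ =
      ∫ p in cube R, (dilate x₀ θ s p : ℂ) * (f p - f x₀) := by
    simp_rw [mul_sub]
    rw [integral_sub i1 i2, integral_mul_const, hone, one_mul]
    rfl
  rw [e]
  have hball : volume.real (Metric.closedBall x₀ (6 * R * s)) = (6 * R * s) ^ 3 * v := by
    rw [Measure.addHaar_real_closedBall volume x₀ (by positivity), finrank_euclideanSpace_fin]
  have hv : 0 < v := ENNReal.toReal_pos (Metric.measure_ball_pos volume _ one_pos).ne'
    measure_ball_lt_top.ne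
  rw [setAverage_eq, hball, smul_eq_mul]
  have hint : IntegrableOn (fun y => ‖(cube R).indicator f y - (cube R).indicator f x₀‖)
      (Metric.closedBall x₀ (6 * R * s)) :=
    (hL.integrableOn.sub (integrableOn_const measure_closedBall_lt_top.ne)).norm
  calc ‖∫ p in cube R, (dilate x₀ θ s p : ℂ) * (f p - f x₀)‖
      ≤ ∫ p in cube R, ‖(dilate x₀ θ s p : ℂ) * (f p - f x₀)‖ := norm_integral_le_integral_norm _
    _ ≤ ∫ p in cube R, (Metric.closedBall x₀ (6 * R * s)).indicator
          (fun p => s⁻¹ ^ 3 * B * ‖(cube R).indicator f p - (cube R).indicator f x₀‖) p := by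
        refine integral_mono_of_nonneg (Eventually.of_forall fun p => norm_nonneg _) ?_ ?_
        · refine Integrable.integrableOn ?_
          rw [integrable_indicator_iff measurableSet_closedBall]
          exact hint.const_mul _
        · rw [EventuallyLE, ae_restrict_iff' (measurableSet_cube R)]
          refine Eventually.of_forall fun p hp => ?_
          simp only [norm_mul, Complex.norm_real]
          by_cases hz : dilate x₀ θ s p = 0
          · rw [hz, norm_zero, zero_mul]
            exact Set.indicator_nonneg (fun q _ => by positivity) _
          · obtain ⟨y, hy, hyp⟩ := exists_of_dilate_ne_zero hs0 hz
            have hm : p ∈ Metric.closedBall x₀ (6 * R * s) := by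
              rw [mem_closedBall_iff_norm, ← hyp, add_sub_cancel_left, norm_smul,
                Real.norm_of_nonneg hs0.le, mul_comm]
              refine mul_le_mul_of_nonneg_right ?_ hs0.le
              have := norm_sub_le y x₀
              have := norm_le_of_mem_cube (hθ' hy)
              have := norm_le_of_mem_cube hx₀
              linarith
            rw [Set.indicator_of_mem hm, Set.indicator_of_mem hp, Set.indicator_of_mem hx₀]
            refine mul_le_mul_of_nonneg_right ?_ (norm_nonneg _)
            rw [dilate, norm_mul, Real.norm_of_nonneg (by positivity)]
            exact mul_le_mul_of_nonneg_left (hB _) (by positivity)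
    _ ≤ ∫ p, (Metric.closedBall x₀ (6 * R * s)).indicator
          (fun p => s⁻¹ ^ 3 * B * ‖(cube R).indicator f p - (cube R).indicator f x₀‖) p := by
        refine setIntegral_le_integral ?_ (Eventually.of_forall fun p =>
          Set.indicator_nonneg (fun q _ => by positivity) _)
        rw [integrable_indicator_iff measurableSet_closedBall]
        exact hint.const_mul _
    _ = s⁻¹ ^ 3 * B * ∫ p in Metric.closedBall x₀ (6 * R * s),
          ‖(cube R).indicator f p - (cube R).indicator f x₀‖ := by
        rw [integral_indicator measurableSet_closedBall, integral_const_mul]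
    _ = _ := by
        have := hs0.ne'
        have := hv.ne'
        field_simp

/-- The Sobolev embedding `H² ⊂ L^∞` in the cube, for functions whose squared norms are bounded
by `B`. -/
theorem exists_ae_norm_le_of_isWeakPartial {R : ℝ} (hR : 0 < R) : ∃ C : ℝ, 0 ≤ C ∧
    ∀ (B : ℝ) (f : E3 → ℂ) (g : Fin 3 → E3 → ℂ) (gg : Fin 3 → Fin 3 → E3 → ℂ),
      (∀ j, IsWeakPartial R j f (g j)) → (∀ j l, IsWeakPartial R l (g j) (gg j l)) →
      ∫ p in cube R, ‖f p‖ ^ 2 ≤ B → (∀ j, ∫ p in cube R, ‖g j p‖ ^ 2 ≤ B) →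
      (∀ j l, ∫ p in cube R, ‖gg j l p‖ ^ 2 ≤ B) →
      ∀ᵐ x ∂volume.restrict (cube R), ‖f x‖ ≤ C * (1 + B) := by
  obtain ⟨θ, hθ, hc, hθ', h1⟩ := exists_unit_bump hR
  set I := ∫ y, θ y ^ 2
  have hI : 0 ≤ I := integral_nonneg fun y => sq_nonneg _
  set K := max 1 (max I (max ((2 * R) ^ 2 * I) ((2 * R) ^ 2 * ((2 * R) ^ 2 * I))))
  refine ⟨(1 + 3 + 36) * K, by positivity, fun B f g gg hf hg bf bg bgg => ?_⟩
  have hB : 0 ≤ B := (integral_nonneg fun y => sq_nonneg _).trans bf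
  filter_upwards [ae_tendsto_scaledMean hR hθ hc hθ' h1 (hf 0).integrable,
    ae_restrict_mem (measurableSet_cube R)] with x₀ hlim hx₀
  have hm : ∀ j, ContDiff ℝ ∞ (moment x₀ j θ) := fun j => contDiff_moment x₀ j hθ
  have hcm : ∀ j, HasCompactSupport (moment x₀ j θ) := fun j =>
    hc.isCompact.of_isClosed_subset (isClosed_tsupport _) (tsupport_moment_subset x₀ j θ)
  have hsm : ∀ j, tsupport (moment x₀ j θ) ⊆ cube R := fun j =>
    (tsupport_moment_subset x₀ j θ).trans hθ'
  have hcmm : ∀ j l, HasCompactSupport (moment x₀ l (moment x₀ j θ)) := fun j l =>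
    (hcm j).isCompact.of_isClosed_subset (isClosed_tsupport _) (tsupport_moment_subset x₀ l _)
  have K1 : 1 ≤ K := le_max_left _ _
  have I0 : I ≤ K := (le_max_left _ _).trans (le_max_right _ _)
  have I1 : ∀ j, ∫ y, moment x₀ j θ y ^ 2 ≤ (2 * R) ^ 2 * I := fun j =>
    integral_sq_moment_le hx₀ j hθ hc hθ'
  have I1' : (2 * R) ^ 2 * I ≤ K :=
    (le_max_left _ _).trans ((le_max_right _ _).trans (le_max_right _ _))
  have I2 : ∀ j l, ∫ y, moment x₀ l (moment x₀ j θ) y ^ 2 ≤ K := fun j l =>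
    ((integral_sq_moment_le hx₀ l (hm j) (hcm j) (hsm j)).trans
      (mul_le_mul_of_nonneg_left (I1 j) (sq_nonneg _))).trans
      ((le_max_right _ _).trans ((le_max_right _ _).trans (le_max_right _ _)))
  have hKB : K + B ≤ K * (1 + B) := by nlinarith
  have b0 : ‖scaledMean R x₀ θ f 1‖ ≤ K * (1 + B) := by
    have := norm_scaledMean_le x₀ hθ hc (hf 0).memLp one_pos
    simp only [Real.sqrt_one, mul_one, inv_one, one_mul] at this
    linarith
  have b1 : ‖∑ j, scaledMean R x₀ (moment x₀ j θ) (g j) 1‖ ≤ 3 * (K * (1 + B)) := by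
    have : ∀ j ∈ Finset.univ, ‖scaledMean R x₀ (moment x₀ j θ) (g j) 1‖ ≤ K * (1 + B) := by
      intro j _
      have := norm_scaledMean_le x₀ (hm j) (hcm j) (hf j).memLp_deriv one_pos
      simp only [Real.sqrt_one, mul_one, inv_one, one_mul] at this
      have := I1 j
      have := bg j
      linarith
    have := norm_sum_le_of_le _ this
    simpa using this
  have b2 : ∀ s, 0 < s → s ≤ 1 →
      ‖∑ j, ∑ l, scaledMean R x₀ (moment x₀ l (moment x₀ j θ)) (gg j l) s‖ ≤
        9 * (K * (1 + B)) * (s * √s)⁻¹ := by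
    intro s hs hs1
    have : ∀ j ∈ Finset.univ, ‖∑ l, scaledMean R x₀ (moment x₀ l (moment x₀ j θ)) (gg j l) s‖ ≤
        3 * (K * (1 + B) * (s * √s)⁻¹) := by
      intro j _
      have : ∀ l ∈ Finset.univ, ‖scaledMean R x₀ (moment x₀ l (moment x₀ j θ)) (gg j l) s‖ ≤
          K * (1 + B) * (s * √s)⁻¹ := by
        intro l _
        have h3 := norm_scaledMean_le x₀ (contDiff_moment x₀ l (hm j)) (hcmm j l)
          (hg j l).memLp_deriv hs
        refine h3.trans ?_
        rw [mul_comm]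
        refine mul_le_mul_of_nonneg_right ?_ (by positivity)
        have := I2 j l
        have := bgg j l
        linarith
      have := norm_sum_le_of_le _ this
      simpa using this
    have := norm_sum_le_of_le _ this
    refine this.trans (le_of_eq ?_)
    simp
    ring
  -- three first and nine second derivatives, the latter with the factor `4` from integration
  have hbound : ∀ s, 0 < s → s ≤ 1 → ‖scaledMean R x₀ θ f s‖ ≤ (1 + 3 + 36) * K * (1 + B) := by
    intro s hs hs1
    have := norm_le_of_deriv_two_le
      (fun t ht ht1 => hasDerivAt_scaledMean hx₀ hθ hc hθ' hf ht ht1)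
      (fun t ht ht1 => HasDerivAt.fun_sum fun j _ =>
        hasDerivAt_scaledMean hx₀ (hm j) (hcm j) (hsm j) (hg j) ht ht1) b2 hs hs1
    linarith
  refine le_of_tendsto hlim.norm ?_
  filter_upwards [Ioo_mem_nhdsGT (one_pos : (0 : ℝ) < 1)] with s hs
  exact hbound s hs.1 hs.2.le

/-! ### The nonlinearity is locally Lipschitz in the gradients -/

lemma contDiff_gramSchmidtPhi (a : ℝ) (n : ℕ) : ContDiff ℝ ∞ (gramSchmidtPhi a n) := by
  induction n using Nat.strong_induction_on with
  | _ n ih =>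
    have e : gramSchmidtPhi a n = fun α =>
        phi n α - ∑ i : Fin n, ip a (phi n) (gramSchmidtPhi a i) /
          ip a (gramSchmidtPhi a i) (gramSchmidtPhi a i) * gramSchmidtPhi a i α := by
      funext α; rw [gramSchmidtPhi]
    rw [e]
    refine ContDiff.sub ?_ (ContDiff.sum fun i _ => contDiff_const.mul (ih i i.2))
    unfold phi
    exact (contDiff_id.pow n).mul Real.contDiff_exp

lemma contDiff_Psi (a : ℝ) (n : ℕ) : ContDiff ℝ ∞ (Psi a n) := by
  unfold Psi
  exact (contDiff_gramSchmidtPhi a n).div_const _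

lemma continuous_Psi (a : ℝ) (n : ℕ) : Continuous (Psi a n) := (contDiff_Psi a n).continuous

lemma continuous_deriv_Psi (a : ℝ) (n : ℕ) : Continuous (deriv (Psi a n)) :=
  (contDiff_deriv (contDiff_Psi a n)).continuous

/-- The pairs `(α, x)` with `x` above the plane of the sources. -/
def aboveSource (d : ℝ) : Set (ℝ × E3) := {q | 0 < q.2 2 + d}

lemma continuous_source (d : ℝ) : Continuous (source d) := by
  unfold source
  refine (PiLp.continuous_toLp 2 _).comp (continuous_pi fun i => ?_)
  fin_cases i
  · exact continuous_id
  · exact continuous_const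
  · exact continuous_const

lemma norm_sub_source_ne_zero {d : ℝ} {q : ℝ × E3} (hq : q ∈ aboveSource d) :
    ((‖q.2 - source d q.1‖ : ℝ) : ℂ) ≠ 0 := by
  have hq' : 0 < q.2 2 + d := hq
  have h := PiLp.norm_apply_le (q.2 - source d q.1) 2
  have e : (q.2 - source d q.1) 2 = q.2 2 + d := by simp [source]
  rw [e, Real.norm_of_nonneg hq'.le] at h
  exact Complex.ofReal_ne_zero.2 (hq'.trans_le h).ne'

lemma continuousOn_tildeX (k d : ℝ) (i : Fin 3) :
    ContinuousOn (fun q : ℝ × E3 => tildeX k d q.1 q.2 i) (aboveSource d) := by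
  have hs := continuous_source d
  have h0 : Continuous fun q : ℝ × E3 => q.2 - source d q.1 := by fun_prop
  have h1 : Continuous fun q : ℝ × E3 => ((‖q.2 - source d q.1‖ : ℝ) : ℂ) := by fun_prop
  have h2 : Continuous fun q : ℝ × E3 => (((q.2 - source d q.1) i : ℝ) : ℂ) :=
    Complex.continuous_ofReal.comp ((EuclideanSpace.proj i : E3 →L[ℝ] ℝ).continuous.comp h0)
  unfold tildeX
  refine ContinuousOn.sub ?_ ?_
  · exact (continuous_const.mul h2).continuousOn.div h1.continuousOn
      fun q hq => norm_sub_source_ne_zero hq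
  · exact h2.continuousOn.div (h1.pow 2).continuousOn
      fun q hq => pow_ne_zero 2 (norm_sub_source_ne_zero hq)

lemma continuousOn_hatX (k d : ℝ) (i : Fin 3) :
    ContinuousOn (fun q : ℝ × E3 => hatX k d q.1 q.2 i) (aboveSource d) := by
  have hs := continuous_source d
  have h0 : Continuous fun q : ℝ × E3 => q.2 - source d q.1 := by fun_prop
  have h1 : Continuous fun q : ℝ × E3 => ((‖q.2 - source d q.1‖ : ℝ) : ℂ) := by fun_prop
  unfold hatX
  refine ContinuousOn.sub ?_ ?_
  · refine ContinuousOn.mul (continuousOn_const.div (h1.pow 3).continuousOn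
      fun q hq => pow_ne_zero 3 (norm_sub_source_ne_zero hq)) (Continuous.continuousOn ?_)
    refine Complex.continuous_ofReal.comp ?_
    fin_cases i <;> simp <;> fun_prop
  · refine ContinuousOn.mul (continuousOn_const.div (h1.pow 4).continuousOn
      fun q hq => pow_ne_zero 4 (norm_sub_source_ne_zero hq)) (Continuous.continuousOn ?_)
    refine Complex.continuous_ofReal.comp ?_
    fin_cases i <;> simp <;> fun_prop

lemma mem_aboveSource {R d : ℝ} (hd : R < d) {x : E3} (hx : x ∈ cube R) (α : ℝ) :
    (α, x) ∈ aboveSource d := by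
  have := abs_lt.1 (hx 2)
  show 0 < x 2 + d
  linarith

lemma intervalIntegrable_weight_mul {R a d : ℝ} (hd : R < d) {w : ℝ → ℝ} (hw : Continuous w)
    {X : ℝ → E3 → ℂ} (hX : ContinuousOn (fun q : ℝ × E3 => X q.1 q.2) (aboveSource d))
    {x : E3} (hx : x ∈ cube R) :
    IntervalIntegrable (fun α => (w α : ℂ) * X α x) volume (-a) a := by
  have : Continuous fun α => X α x :=
    hX.comp_continuous (f := fun α : ℝ => (α, x)) (by fun_prop) fun α => mem_aboveSource hd hx α
  exact ((Complex.continuous_ofReal.comp hw).mul this).intervalIntegrable _ _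

lemma exists_bound_integral_weight_mul {R a d : ℝ} (hd : R < d) {w : ℝ → ℝ}
    (hw : Continuous w) {X : ℝ → E3 → ℂ}
    (hX : ContinuousOn (fun q : ℝ × E3 => X q.1 q.2) (aboveSource d)) :
    ∃ B : ℝ, ∀ x ∈ cube R, ‖∫ α in (-a)..a, (w α : ℂ) * X α x‖ ≤ B := by
  have hK : IsCompact (Set.uIcc (-a) a ×ˢ closure (cube R)) :=
    isCompact_uIcc.prod (isBounded_cube R).isCompact_closure
  have hsub : Set.uIcc (-a) a ×ˢ closure (cube R) ⊆ aboveSource d := by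
    rintro ⟨α, x⟩ ⟨-, hx⟩
    have h1 : closure (cube R) ⊆ {x : E3 | -R ≤ x 2} := by
      refine closure_minimal (fun y hy => (abs_lt.1 (hy 2)).1.le) ?_
      exact isClosed_le continuous_const (EuclideanSpace.proj 2 : E3 →L[ℝ] ℝ).continuous
    have h2 : -R ≤ x 2 := h1 hx
    show 0 < x 2 + d
    linarith
  obtain ⟨B, hB⟩ := hK.exists_bound_of_continuousOn
    (f := fun q : ℝ × E3 => (w q.1 : ℂ) * X q.1 q.2)
    (((Complex.continuous_ofReal.comp (hw.comp continuous_fst)).continuousOn).mul (hX.mono hsub))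
  refine ⟨B * |a - -a|, fun x hx => intervalIntegral.norm_integral_le_of_norm_le_const ?_⟩
  intro α hα
  exact hB (α, x) ⟨Set.uIoc_subset_uIcc hα, subset_closure hx⟩

lemma integral_mul_bdot {R a d : ℝ} (hd : R < d) {w : ℝ → ℝ} (hw : Continuous w)
    {X : ℝ → E3 → Fin 3 → ℂ}
    (hX : ∀ i, ContinuousOn (fun q : ℝ × E3 => X q.1 q.2 i) (aboveSource d))
    {x : E3} (hx : x ∈ cube R) (p : Fin 3 → ℂ) :
    ∫ α in (-a)..a, (w α : ℂ) * bdot p (X α x) =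
      ∑ i, p i * ∫ α in (-a)..a, (w α : ℂ) * X α x i := by
  unfold bdot
  simp_rw [← intervalIntegral.integral_const_mul]
  rw [← intervalIntegral.integral_finsetSum]
  · congr 1; funext α
    rw [Finset.mul_sum]
    exact Finset.sum_congr rfl fun i _ => by ring
  · intro i _
    exact (intervalIntegrable_weight_mul hd hw (X := fun α x => X α x i) (hX i) hx).const_mul _

lemma bdot_comm (p q : Fin 3 → ℂ) : bdot p q = bdot q p :=
  Finset.sum_congr rfl fun _ _ => mul_comm _ _

lemma norm_bdot_sub_bdot_le {p q p' q' : Fin 3 → ℂ} {L : ℝ} (hp : ∀ i, ‖p i‖ ≤ L)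
    (hq' : ∀ i, ‖q' i‖ ≤ L) :
    ‖bdot q p - bdot q' p'‖ ≤ L * ((∑ i, ‖q i - q' i‖) + ∑ i, ‖p i - p' i‖) := by
  unfold bdot
  rw [← Finset.sum_sub_distrib, ← Finset.sum_add_distrib, Finset.mul_sum]
  refine norm_sum_le_of_le _ fun i _ => ?_
  have : q i * p i - q' i * p' i = (q i - q' i) * p i + q' i * (p i - p' i) := by ring
  rw [this]
  refine (norm_add_le _ _).trans ?_
  rw [norm_mul, norm_mul]
  have h1 := mul_le_mul_of_nonneg_left (hp i) (norm_nonneg (q i - q' i))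
  have h2 := mul_le_mul_of_nonneg_right (hq' i) (norm_nonneg (p i - p' i))
  linarith

/-- A linear term of the nonlinearity with bounded coefficients. -/
lemma norm_sum_coef_sub_le {N : ℕ} {T : Fin N → Fin 3 → ℂ} {B : ℝ} (hT : ∀ n i, ‖T n i‖ ≤ B)
    (P Q : Fin N → Fin 3 → ℂ) :
    ‖(∑ n, ∑ i, P n i * T n i) - ∑ n, ∑ i, Q n i * T n i‖ ≤ B * ∑ n, ∑ i, ‖P n i - Q n i‖ := by
  rw [← Finset.sum_sub_distrib, Finset.mul_sum]
  refine norm_sum_le_of_le _ fun n _ => ?_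
  rw [← Finset.sum_sub_distrib, Finset.mul_sum]
  refine norm_sum_le_of_le _ fun i _ => ?_
  rw [← sub_mul, norm_mul, mul_comm]
  exact mul_le_mul_of_nonneg_right (hT n i) (norm_nonneg _)

lemma exists_fNonlin_lipschitz {R a d : ℝ} (k : ℝ) (hd : R < d) (N : ℕ) :
    ∃ C : ℝ, 0 ≤ C ∧ ∀ x ∈ cube R, ∀ (L : ℝ) (P Q : Fin N → Fin 3 → ℂ), 0 ≤ L →
      (∀ n i, ‖P n i‖ ≤ L) → (∀ n i, ‖Q n i‖ ≤ L) → ∀ m,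
      ‖fNonlin a d k x P m - fNonlin a d k x Q m‖ ≤
        C * (1 + L) * ∑ n, ∑ i, ‖P n i - Q n i‖ := by
  have w1 : ∀ m n, Continuous fun α => Psi a m α * deriv (Psi a n) α := fun m n =>
    (continuous_Psi a m).mul (continuous_deriv_Psi a n)
  have w2 : ∀ m n, Continuous fun α => Psi a m α * Psi a n α := fun m n =>
    (continuous_Psi a m).mul (continuous_Psi a n)
  choose BT hBT using fun (q : Fin N × Fin N × Fin 3) =>
    exists_bound_integral_weight_mul (a := a) hd (w1 q.1 q.2.1)
      (X := fun α x => tildeX k d α x q.2.2) (continuousOn_tildeX k d q.2.2)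
  choose BH hBH using fun (q : Fin N × Fin N × Fin 3) =>
    exists_bound_integral_weight_mul (a := a) hd (w2 q.1 q.2.1)
      (X := fun α x => hatX k d α x q.2.2) (continuousOn_hatX k d q.2.2)
  let c : Fin N → Fin N → Fin N → ℂ := fun m n l =>
    ((∫ α in (-a)..a, Psi a m α * Psi a n α * deriv (Psi a l) α : ℝ) : ℂ)
  obtain ⟨B1, hB1⟩ := (Set.finite_range BT).bddAbove
  obtain ⟨B2, hB2⟩ := (Set.finite_range BH).bddAbove
  obtain ⟨B3, hB3⟩ := (Set.finite_range fun q : Fin N × Fin N × Fin N =>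
    ‖c q.1 q.2.1 q.2.2‖).bddAbove
  set B := max 0 (max B1 (max B2 B3))
  have hB0 : 0 ≤ B := le_max_left _ _
  have b1 : B1 ≤ B := (le_max_left _ _).trans (le_max_right _ _)
  have b2 : B2 ≤ B := (le_max_left _ _).trans ((le_max_right _ _).trans (le_max_right _ _))
  have b3 : B3 ≤ B := (le_max_right _ _).trans ((le_max_right _ _).trans (le_max_right _ _))
  refine ⟨4 * B * (N ^ 2 + 1), by positivity, fun x hx L P Q hL hP hQ m => ?_⟩
  set S := ∑ n, ∑ i, ‖P n i - Q n i‖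
  have hS : ∀ n, ∑ i, ‖P n i - Q n i‖ ≤ S := fun n =>
    Finset.single_le_sum (f := fun n => ∑ i, ‖P n i - Q n i‖)
      (fun n _ => Finset.sum_nonneg fun i _ => norm_nonneg _) (Finset.mem_univ n)
  have hS0 : 0 ≤ S := Finset.sum_nonneg fun n _ => Finset.sum_nonneg fun i _ => norm_nonneg _
  have expand : ∀ P : Fin N → Fin 3 → ℂ, fNonlin a d k x P m =
      2 * (∑ n, ∑ l, bdot (P n) (P l) * c m n l) +
      2 * (∑ n, ∑ i, P n i * ∫ α in (-a)..a,
        ((Psi a m α * deriv (Psi a n) α : ℝ) : ℂ) * tildeX k d α x i) +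
      2 * (∑ n, ∑ i, P n i * ∫ α in (-a)..a,
        ((Psi a m α * Psi a n α : ℝ) : ℂ) * hatX k d α x i) := by
    intro P
    unfold fNonlin
    congr 1
    · congr 2
      refine Finset.sum_congr rfl fun n _ => ?_
      exact integral_mul_bdot hd (w1 m n) (continuousOn_tildeX k d) hx (P n)
    · congr 1
      refine Finset.sum_congr rfl fun n _ => ?_
      rw [← integral_mul_bdot hd (w2 m n) (continuousOn_hatX k d) hx (P n)]
      simp_rw [bdot_comm (P n)]
  rw [expand P, expand Q]
  have t2 := norm_sum_coef_sub_le (B := B) (T := fun n i => ∫ α in (-a)..a,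
      ((Psi a m α * deriv (Psi a n) α : ℝ) : ℂ) * tildeX k d α x i) (fun n i =>
    (hBT (m, n, i) x hx).trans ((hB1 ⟨_, rfl⟩).trans b1)) P Q
  have t3 := norm_sum_coef_sub_le (B := B) (T := fun n i => ∫ α in (-a)..a,
      ((Psi a m α * Psi a n α : ℝ) : ℂ) * hatX k d α x i) (fun n i =>
    (hBH (m, n, i) x hx).trans ((hB2 ⟨_, rfl⟩).trans b2)) P Q
  have t1 : ‖(∑ n, ∑ l, bdot (P n) (P l) * c m n l) - ∑ n, ∑ l, bdot (Q n) (Q l) * c m n l‖ ≤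
      N * (N * (2 * B * L * S)) := by
    have : ∀ n ∈ Finset.univ, ‖(∑ l, bdot (P n) (P l) * c m n l) -
        ∑ l, bdot (Q n) (Q l) * c m n l‖ ≤ N * (2 * B * L * S) := by
      intro n _
      have : ∀ l ∈ Finset.univ, ‖bdot (P n) (P l) * c m n l - bdot (Q n) (Q l) * c m n l‖ ≤
          2 * B * L * S := by
        intro l _
        rw [← sub_mul, norm_mul]
        have h1 := norm_bdot_sub_bdot_le (q := P n) (p' := Q l) (hP l) (hQ n)
        have h2 : ‖c m n l‖ ≤ B := (hB3 ⟨(m, n, l), rfl⟩).trans b3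
        have h3 : ‖bdot (P n) (P l) - bdot (Q n) (Q l)‖ ≤ L * (S + S) :=
          h1.trans (mul_le_mul_of_nonneg_left (add_le_add (hS n) (hS l)) hL)
        calc _ ≤ L * (S + S) * B := mul_le_mul h3 h2 (norm_nonneg _) (by positivity)
          _ = _ := by ring
      have := norm_sum_le_of_le _ this
      rw [Finset.sum_sub_distrib] at this
      simpa using this
    have := norm_sum_le_of_le _ this
    rw [Finset.sum_sub_distrib] at this
    simpa using this
  have comb : ∀ A1 A2 A3 D1 D2 D3 : ℂ, ‖(2 * A1 + 2 * A2 + 2 * A3) - (2 * D1 + 2 * D2 + 2 * D3)‖ ≤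
      2 * ‖A1 - D1‖ + 2 * ‖A2 - D2‖ + 2 * ‖A3 - D3‖ := by
    intro A1 A2 A3 D1 D2 D3
    have : (2 * A1 + 2 * A2 + 2 * A3) - (2 * D1 + 2 * D2 + 2 * D3) =
      2 * (A1 - D1) + 2 * (A2 - D2) + 2 * (A3 - D3) := by ring
    rw [this]
    refine (norm_add₃_le).trans ?_
    simp
  refine (comb _ _ _ _ _ _).trans ?_
  have h0 : 0 ≤ B * L * S := by positivity
  have h1 : 0 ≤ B * S * N ^ 2 := by positivity
  nlinarith

/-- On bounded sets of gradients, the nonlinearity is Lipschitz, uniformly in the cube. -/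
theorem exists_KNonlin_lipschitz {R a d : ℝ} (k : ℝ) (hd : R < d) (N : ℕ) :
    ∃ C : ℝ, 0 ≤ C ∧ ∀ x ∈ cube R, ∀ (L : ℝ) (P Q : Fin N → Fin 3 → ℂ), 0 ≤ L →
      (∀ n i, ‖P n i‖ ≤ L) → (∀ n i, ‖Q n i‖ ≤ L) → ∀ m,
      ‖KNonlin a d k x P m - KNonlin a d k x Q m‖ ≤
        C * (1 + L) * ∑ n, ∑ i, ‖P n i - Q n i‖ := by
  obtain ⟨C, hC, h⟩ := exists_fNonlin_lipschitz (a := a) k hd N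
  refine ⟨(∑ m, ∑ m', ‖((((matS a N)⁻¹ m m' : ℝ)) : ℂ)‖) * C,
    mul_nonneg (Finset.sum_nonneg fun _ _ => Finset.sum_nonneg fun _ _ => norm_nonneg _) hC,
    fun x hx L P Q hL hP hQ m => ?_⟩
  have h1 := h x hx L P Q hL hP hQ
  set S := ∑ n, ∑ i, ‖P n i - Q n i‖
  have hS0 : 0 ≤ S := Finset.sum_nonneg fun n _ => Finset.sum_nonneg fun i _ => norm_nonneg _
  have e : KNonlin a d k x P m - KNonlin a d k x Q m =
      ∑ m', (((matS a N)⁻¹ m m' : ℝ) : ℂ) * (fNonlin a d k x P m' - fNonlin a d k x Q m') := by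
    simp only [KNonlin, Matrix.mulVec, dotProduct, Matrix.map_apply, mul_sub,
      Finset.sum_sub_distrib]
  rw [e]
  calc _ ≤ ∑ m', ‖(((matS a N)⁻¹ m m' : ℝ) : ℂ)‖ * (C * (1 + L) * S) := by
        refine norm_sum_le_of_le _ fun m' _ => ?_
        rw [norm_mul]
        exact mul_le_mul_of_nonneg_left (h1 m') (norm_nonneg _)
    _ = (∑ m', ‖(((matS a N)⁻¹ m m' : ℝ) : ℂ)‖) * (C * (1 + L) * S) := by rw [Finset.sum_mul]
    _ ≤ (∑ m, ∑ m', ‖(((matS a N)⁻¹ m m' : ℝ) : ℂ)‖) * (C * (1 + L) * S) := by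
        refine mul_le_mul_of_nonneg_right ?_ (by positivity)
        exact Finset.single_le_sum (f := fun m => ∑ m', ‖(((matS a N)⁻¹ m m' : ℝ) : ℂ)‖)
          (fun m _ => Finset.sum_nonneg fun _ _ => norm_nonneg _) (Finset.mem_univ m)
    _ = _ := by ring

/-! ### Stability for the linearized inequality -/

section Energy

variable {R lam : ℝ} {f : E3 → ℂ}

lemma one_le_carlemanWeight (hlam : 0 ≤ lam) (z : ℝ) : 1 ≤ carlemanWeight R lam z := by
  unfold carlemanWeight
  exact Real.one_le_exp (by positivity)

lemma carlemanWeight_le (hlam : 0 ≤ lam) {x : E3} (hx : x ∈ cube R) :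
    carlemanWeight R lam (x 2) ≤ carlemanWeight R lam (-R) := by
  have h := abs_lt.1 (hx 2)
  unfold carlemanWeight
  refine Real.exp_le_exp.2 (mul_le_mul_of_nonneg_left ?_ (by positivity))
  exact pow_le_pow_left₀ (by linarith) (by linarith) 2

lemma integrable_carlemanWeight_mul (hlam : 0 ≤ lam)
    (hf : MemLp f 2 (volume.restrict (cube R))) :
    Integrable (fun x : E3 => carlemanWeight R lam (x 2) * ‖f x‖ ^ 2)
      (volume.restrict (cube R)) := by
  have hc : Continuous fun x : E3 => carlemanWeight R lam (x 2) :=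
    (continuous_carlemanWeight R lam).comp (EuclideanSpace.proj 2 : E3 →L[ℝ] ℝ).continuous
  refine (hf.integrable_norm_pow (p := 2) (by simp)).bdd_mul (c := carlemanWeight R lam (-R))
    hc.aestronglyMeasurable ?_
  filter_upwards [ae_restrict_mem (measurableSet_cube R)] with x hx
  rw [Real.norm_of_nonneg (carlemanWeight_pos R lam _).le]
  exact carlemanWeight_le hlam hx

lemma cubeEnergy_nonneg (R lam : ℝ) (f : E3 → ℂ) : 0 ≤ cubeEnergy R lam f :=
  integral_nonneg fun _ => mul_nonneg (carlemanWeight_pos R lam _).le (sq_nonneg _)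

lemma integral_sq_le_cubeEnergy (hlam : 0 ≤ lam) (hf : MemLp f 2 (volume.restrict (cube R))) :
    ∫ x in cube R, ‖f x‖ ^ 2 ≤ cubeEnergy R lam f := by
  refine integral_mono (hf.integrable_norm_pow (p := 2) (by simp))
    (integrable_carlemanWeight_mul hlam hf) fun x => ?_
  exact le_mul_of_one_le_left (sq_nonneg _) (one_le_carlemanWeight hlam _)

lemma cubeEnergy_le_integral_sq (hlam : 0 ≤ lam) (hf : MemLp f 2 (volume.restrict (cube R))) :
    cubeEnergy R lam f ≤ carlemanWeight R lam (-R) * ∫ x in cube R, ‖f x‖ ^ 2 := by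
  rw [← integral_const_mul]
  refine integral_mono_ae (integrable_carlemanWeight_mul hlam hf)
    ((hf.integrable_norm_pow (p := 2) (by simp)).const_mul _) ?_
  filter_upwards [ae_restrict_mem (measurableSet_cube R)] with x hx
  exact mul_le_mul_of_nonneg_right (carlemanWeight_le hlam hx) (sq_nonneg _)

lemma cubeEnergy_congr {g : E3 → ℂ} (h : f =ᵐ[volume.restrict (cube R)] g) :
    cubeEnergy R lam f = cubeEnergy R lam g := by
  refine integral_congr_ae ?_
  filter_upwards [h] with x hx
  rw [hx]

end Energy

lemma multiIndices_two_cases : ∀ β ∈ multiIndices 2, β = 0 ∨ (∃ i, β = Pi.single i 1) ∨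
    ∃ i j, i ≤ j ∧ β = Pi.single i 1 + Pi.single j 1 := by
  decide

lemma single_mem_multiIndices (i : Fin 3) {m : ℕ} (hm : 1 ≤ m) :
    (Pi.single i 1 : Fin 3 → ℕ) ∈ multiIndices m := by
  rw [mem_multiIndices]; simpa using hm

lemma single_add_single_mem_multiIndices (i j : Fin 3) {m : ℕ} (hm : 2 ≤ m) :
    (Pi.single i 1 + Pi.single j 1 : Fin 3 → ℕ) ∈ multiIndices m := by
  rw [mem_multiIndices]; simpa [Finset.sum_add_distrib] using hm

lemma single_add_single_add_single_mem_multiIndices (i j l : Fin 3) :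
    (Pi.single i 1 + Pi.single j 1 + Pi.single l 1 : Fin 3 → ℕ) ∈ multiIndices 3 := by
  rw [mem_multiIndices]; simp [Finset.sum_add_distrib]

lemma integral_sq_weakDeriv_le {m : ℕ} {Ω : Set E3} {β : Fin 3 → ℕ} (hβ : β ∈ multiIndices m)
    (u : E3 → ℂ) : ∫ x in Ω, ‖weakDeriv Ω β u x‖ ^ 2 ≤ normSqH m Ω u :=
  Finset.single_le_sum (f := fun β => ∫ x in Ω, ‖weakDeriv Ω β u x‖ ^ 2)
    (fun _ _ => integral_nonneg fun _ => sq_nonneg _) hβ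

lemma normSqH_nonneg (m : ℕ) (Ω : Set E3) (u : E3 → ℂ) : 0 ≤ normSqH m Ω u :=
  Finset.sum_nonneg fun _ _ => integral_nonneg fun _ => sq_nonneg _

lemma weakLaplacian_apply (Ω : Set E3) (u : E3 → ℂ) (x : E3) : weakLaplacian Ω u x =
    weakDeriv Ω (Pi.single 0 1 + Pi.single 0 1) u x +
      weakDeriv Ω (Pi.single 1 1 + Pi.single 1 1) u x +
      weakDeriv Ω (Pi.single 2 1 + Pi.single 2 1) u x := by
  simp only [weakLaplacian, Fin.sum_univ_three, ← Pi.single_add]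

lemma MemH.cauchyData {R : ℝ} {u : E3 → ℂ} (hu : MemH 2 (cube R) u)
    (hv : VanishesOnBoundary R u)
    (hl : ∀ p ∈ lowerFace R, Tendsto (weakPartial (cube R) 2 u)
      (𝓝 p ⊓ ae (volume.restrict (cube R))) (𝓝 0)) :
    CauchyData R u (fun i => weakPartial (cube R) i u)
      (fun i j => weakDeriv (cube R) (Pi.single i 1 + Pi.single j 1) u) where
  first i := by
    have := hu.isWeakPartial 0 i (by rw [zero_add]; exact single_mem_multiIndices i one_le_two)
    rw [zero_add] at this
    exact this.congr (hu.weakDeriv_zero_order (isOpen_cube R)) EventuallyEq.rfl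
  second i j := hu.isWeakPartial _ j (single_add_single_mem_multiIndices i j le_rfl)
  vanishes := hv
  lowerFace := hl

/-- For functions with vanishing Cauchy data, all derivatives of order at most two are controlled
by the weighted Laplacian, as the weight is at least one. -/
lemma MemH.normSqH_le_cubeEnergy {R : ℝ} (hR : 0 < R) {u : E3 → ℂ} (hu : MemH 2 (cube R) u)
    (hv : VanishesOnBoundary R u)
    (hl : ∀ p ∈ lowerFace R, Tendsto (weakPartial (cube R) 2 u)
      (𝓝 p ⊓ ae (volume.restrict (cube R))) (𝓝 0)) {lam : ℝ} (hlam : 1 ≤ lam) :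
    normSqH 2 (cube R) u ≤ (multiIndices 2).card *
      ((4 + (14 + 20 * (2 * R + 1) ^ 2) * lam) *
        cubeEnergy R lam (weakLaplacian (cube R) u)) := by
  have hc := hu.cauchyData hv hl
  have h1 := hc.carleman_lower hR hlam
  have h2 := hc.carleman_second hR hlam
  have e : (fun x => weakDeriv (cube R) (Pi.single 0 1 + Pi.single 0 1) u x +
      weakDeriv (cube R) (Pi.single 1 1 + Pi.single 1 1) u x +
      weakDeriv (cube R) (Pi.single 2 1 + Pi.single 2 1) u x) = weakLaplacian (cube R) u := by
    funext x; rw [weakLaplacian_apply]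
  simp only [e] at h1 h2
  set 𝓔 := cubeEnergy R lam (weakLaplacian (cube R) u)
  have hE : 0 ≤ 𝓔 := cubeEnergy_nonneg _ _ _
  have hn := cubeEnergy_nonneg R lam
  have hlam0 : 0 ≤ lam := by linarith
  have key : ∀ β ∈ multiIndices 2, cubeEnergy R lam (weakDeriv (cube R) β u) ≤
      (4 + (14 + 20 * (2 * R + 1) ^ 2) * lam) * 𝓔 := by
    have hfirst : ∀ g, cubeEnergy R lam g ≤ cubeEnergy R lam u +
        cubeEnergy R lam (weakPartial (cube R) 0 u) +
        cubeEnergy R lam (weakPartial (cube R) 1 u) +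
        cubeEnergy R lam (weakPartial (cube R) 2 u) →
        cubeEnergy R lam g ≤ (4 + (14 + 20 * (2 * R + 1) ^ 2) * lam) * 𝓔 := by
      intro g hg
      have a1 : cubeEnergy R lam g ≤ lam * cubeEnergy R lam g :=
        le_mul_of_one_le_left (hn g) hlam
      have a2 := mul_le_mul_of_nonneg_left hg hlam0
      have a3 : 0 ≤ (14 + 20 * (2 * R + 1) ^ 2) * lam * 𝓔 := by positivity
      linarith
    have hsecond : ∀ g, cubeEnergy R lam g ≤
        (14 + 20 * (2 * R + 1) ^ 2) * lam * 𝓔 →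
        cubeEnergy R lam g ≤ (4 + (14 + 20 * (2 * R + 1) ^ 2) * lam) * 𝓔 := by
      intro g hg
      linarith
    have n0 := hn u
    have n1 := fun i => hn (weakPartial (cube R) i u)
    have n2 := fun i j => hn (weakDeriv (cube R) (Pi.single i 1 + Pi.single j 1) u)
    intro β hβ
    rcases multiIndices_two_cases β hβ with rfl | ⟨i, rfl⟩ | ⟨i, j, hij, rfl⟩
    · refine hfirst _ ?_
      rw [cubeEnergy_congr (hu.weakDeriv_zero_order (isOpen_cube R))]
      have := n1 0; have := n1 1; have := n1 2
      linarith
    · refine hfirst _ ?_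
      show cubeEnergy R lam (weakPartial (cube R) i u) ≤ _
      have := n1 0; have := n1 1; have := n1 2
      fin_cases i <;> simp only [Fin.zero_eta, Fin.mk_one, Fin.reduceFinMk] <;> linarith
    · refine hsecond _ (le_trans ?_ h2)
      have := n2 0 0; have := n2 1 1; have := n2 2 2
      have := n2 0 1; have := n2 0 2; have := n2 1 2
      fin_cases i <;> fin_cases j <;>
        first
        | (exfalso; revert hij; decide)
        | (simp only [Fin.zero_eta, Fin.mk_one, Fin.reduceFinMk]; linarith)
  unfold normSqH
  rw [← nsmul_eq_mul]
  refine Finset.sum_le_card_nsmul _ _ _ fun β hβ => ?_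
  exact (integral_sq_le_cubeEnergy hlam0 (hu.memLp_weakDeriv (isOpen_cube R) hβ)).trans (key β hβ)

lemma sq_sum_sum_le {N : ℕ} (b : Fin N → Fin 3 → ℝ) :
    (∑ n, ∑ i, b n i) ^ 2 ≤ 3 * N * ∑ n, ∑ i, b n i ^ 2 := by
  have h1 := sq_sum_le_card_mul_sum_sq (s := Finset.univ) (f := fun n => ∑ i, b n i)
  have h2 : ∀ n ∈ Finset.univ, (∑ i, b n i) ^ 2 ≤ 3 * ∑ i, b n i ^ 2 := fun n _ => by
    simpa using sq_sum_le_card_mul_sum_sq (s := Finset.univ) (f := b n)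
  have h3 := Finset.sum_le_sum h2
  rw [← Finset.mul_sum] at h3
  simp only [Finset.card_univ, Fintype.card_fin] at h1
  calc _ ≤ _ := h1
    _ ≤ N * (3 * ∑ n, ∑ i, b n i ^ 2) := mul_le_mul_of_nonneg_left h3 (Nat.cast_nonneg N)
    _ = _ := by ring

/-- Functions with vanishing Cauchy data whose Laplacian is bounded by their gradients and by
derivatives of `Φ` are bounded by `Φ` in `H²`. -/
theorem exists_stability_of_laplacian_le {R : ℝ} (hR : 0 < R) (N : ℕ) (c : ℝ) :
    ∃ C : ℝ, 0 ≤ C ∧ ∀ U Φ : Fin N → E3 → ℂ,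
      (∀ j, MemH 2 (cube R) (U j)) → (∀ j, MemH 2 (cube R) (Φ j)) →
      (∀ j, VanishesOnBoundary R (U j)) →
      (∀ j, ∀ p ∈ lowerFace R, Tendsto (weakPartial (cube R) 2 (U j))
        (𝓝 p ⊓ ae (volume.restrict (cube R))) (𝓝 0)) →
      (∀ᵐ x ∂volume.restrict (cube R), ∀ j, ‖weakLaplacian (cube R) (U j) x‖ ≤
        c * ((∑ n, ∑ i, ‖weakPartial (cube R) i (U n) x‖) +
          ∑ n, ∑ i, ‖weakPartial (cube R) i (Φ n) x‖) + ‖weakLaplacian (cube R) (Φ j) x‖) →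
      ∑ j, normSqH 2 (cube R) (U j) ≤ C * ∑ j, normSqH 2 (cube R) (Φ j) := by
  set κ : ℝ := 3 * (c ^ 2 * (3 * N)) + 9
  have hκ : 0 < κ := by positivity
  -- `lam ≥ 8 N κ` is what is needed to absorb the gradients of `U` into the left hand side
  set lam : ℝ := 1 + 8 * N * κ
  have hlam : 1 ≤ lam := by
    have : 0 ≤ 8 * N * κ := by positivity
    linarith
  have hlam0 : 0 ≤ lam := by linarith
  set w := carlemanWeight R lam (-R)
  have hw : 0 < w := carlemanWeight_pos _ _ _
  refine ⟨(multiIndices 2).card * ((4 + (14 + 20 * (2 * R + 1) ^ 2) * lam) *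
    (12 * N * κ * w)), by positivity, fun U Φ hU hΦ hv hl hae => ?_⟩
  set Y := ∑ j, normSqH 2 (cube R) (Φ j)
  have hY : ∀ j, normSqH 2 (cube R) (Φ j) ≤ Y := fun j =>
    Finset.single_le_sum (f := fun j => normSqH 2 (cube R) (Φ j))
      (fun j _ => normSqH_nonneg _ _ _) (Finset.mem_univ j)
  have hY0 : 0 ≤ Y := Finset.sum_nonneg fun j _ => normSqH_nonneg _ _ _
  set ν := volume.restrict (cube R)
  have mU : ∀ n i, MemLp (weakPartial (cube R) i (U n)) 2 ν := fun n i =>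
    (hU n).memLp_weakDeriv (isOpen_cube R) (single_mem_multiIndices i one_le_two)
  have mΦ : ∀ n i, MemLp (weakPartial (cube R) i (Φ n)) 2 ν := fun n i =>
    (hΦ n).memLp_weakDeriv (isOpen_cube R) (single_mem_multiIndices i one_le_two)
  have dΦ : ∀ n i, MemLp (weakDeriv (cube R) (Pi.single i 1 + Pi.single i 1) (Φ n)) 2 ν :=
    fun n i => (hΦ n).memLp_weakDeriv (isOpen_cube R)
      (single_add_single_mem_multiIndices i i le_rfl)
  have iU := fun n i => integrable_carlemanWeight_mul hlam0 (mU n i)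
  have iΦ := fun n i => integrable_carlemanWeight_mul hlam0 (mΦ n i)
  have jΦ := fun n i => integrable_carlemanWeight_mul hlam0 (dΦ n i)
  -- the weighted energy of the Laplacian
  have main : ∀ j, cubeEnergy R lam (weakLaplacian (cube R) (U j)) ≤
      κ * ((∑ n, ∑ i, cubeEnergy R lam (weakPartial (cube R) i (U n))) +
        (∑ n, ∑ i, cubeEnergy R lam (weakPartial (cube R) i (Φ n))) +
        ∑ i, cubeEnergy R lam (weakDeriv (cube R) (Pi.single i 1 + Pi.single i 1) (Φ j))) := by
    intro j
    have e : κ * ((∑ n, ∑ i, cubeEnergy R lam (weakPartial (cube R) i (U n))) +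
        (∑ n, ∑ i, cubeEnergy R lam (weakPartial (cube R) i (Φ n))) +
        ∑ i, cubeEnergy R lam (weakDeriv (cube R) (Pi.single i 1 + Pi.single i 1) (Φ j))) =
        ∫ x in cube R, κ * ((∑ n, ∑ i, carlemanWeight R lam (x 2) *
            ‖weakPartial (cube R) i (U n) x‖ ^ 2) +
          (∑ n, ∑ i, carlemanWeight R lam (x 2) * ‖weakPartial (cube R) i (Φ n) x‖ ^ 2) +
          ∑ i, carlemanWeight R lam (x 2) *
            ‖weakDeriv (cube R) (Pi.single i 1 + Pi.single i 1) (Φ j) x‖ ^ 2) := by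
      have s1 : Integrable (fun x : E3 => ∑ n, ∑ i, carlemanWeight R lam (x 2) *
          ‖weakPartial (cube R) i (U n) x‖ ^ 2) ν :=
        integrable_finsetSum _ fun n _ => integrable_finsetSum _ fun i _ => iU n i
      have s2 : Integrable (fun x : E3 => ∑ n, ∑ i, carlemanWeight R lam (x 2) *
          ‖weakPartial (cube R) i (Φ n) x‖ ^ 2) ν :=
        integrable_finsetSum _ fun n _ => integrable_finsetSum _ fun i _ => iΦ n i
      have s3 : Integrable (fun x : E3 => ∑ i, carlemanWeight R lam (x 2) *
            ‖weakDeriv (cube R) (Pi.single i 1 + Pi.single i 1) (Φ j) x‖ ^ 2) ν :=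
        integrable_finsetSum _ fun i _ => jΦ j i
      have s12 := s1.add s2
      simp only [Pi.add_def] at s12
      rw [integral_const_mul, integral_add s12 s3, integral_add s1 s2,
        integral_finsetSum _ fun n _ => integrable_finsetSum _ fun i _ => iU n i,
        integral_finsetSum _ fun n _ => integrable_finsetSum _ fun i _ => iΦ n i,
        integral_finsetSum _ fun i _ => jΦ j i]
      simp_rw [integral_finsetSum _ fun i _ => iU _ i, integral_finsetSum _ fun i _ => iΦ _ i]
      rfl
    rw [e]
    refine integral_mono_of_nonneg (Eventually.of_forall fun x =>
      mul_nonneg (carlemanWeight_pos R lam _).le (sq_nonneg _)) ?_ ?_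
    · refine Integrable.const_mul (Integrable.add (Integrable.add ?_ ?_) ?_) _
      · exact integrable_finsetSum _ fun n _ => integrable_finsetSum _ fun i _ => iU n i
      · exact integrable_finsetSum _ fun n _ => integrable_finsetSum _ fun i _ => iΦ n i
      · exact integrable_finsetSum _ fun i _ => jΦ j i
    · filter_upwards [hae] with x hx
      have hx := hx j
      set W := carlemanWeight R lam (x 2)
      have hW : 0 < W := carlemanWeight_pos _ _ _
      simp_rw [← Finset.mul_sum, ← mul_add]
      rw [mul_left_comm]
      refine mul_le_mul_of_nonneg_left ?_ hW.le
      have t1 := sq_sum_sum_le fun n i => ‖weakPartial (cube R) i (U n) x‖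
      have t2 := sq_sum_sum_le fun n i => ‖weakPartial (cube R) i (Φ n) x‖
      have t3 : ‖weakLaplacian (cube R) (Φ j) x‖ ^ 2 ≤
          3 * ∑ i, ‖weakDeriv (cube R) (Pi.single i 1 + Pi.single i 1) (Φ j) x‖ ^ 2 := by
        have a1 : ‖weakLaplacian (cube R) (Φ j) x‖ ≤
            ∑ i, ‖weakDeriv (cube R) (Pi.single i 1 + Pi.single i 1) (Φ j) x‖ := by
          rw [weakLaplacian_apply, Fin.sum_univ_three]
          exact norm_add₃_le
        have a2 := sq_sum_le_card_mul_sum_sq (s := Finset.univ) (f := fun i : Fin 3 =>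
          ‖weakDeriv (cube R) (Pi.single i 1 + Pi.single i 1) (Φ j) x‖)
        simp only [Finset.card_univ, Fintype.card_fin, Nat.cast_ofNat] at a2
        exact (pow_le_pow_left₀ (norm_nonneg _) a1 2).trans a2
      set X1 := ∑ n, ∑ i, ‖weakPartial (cube R) i (U n) x‖
      set X2 := ∑ n, ∑ i, ‖weakPartial (cube R) i (Φ n) x‖
      set X3 := ‖weakLaplacian (cube R) (Φ j) x‖
      set Z1 := ∑ n, ∑ i, ‖weakPartial (cube R) i (U n) x‖ ^ 2
      set Z2 := ∑ n, ∑ i, ‖weakPartial (cube R) i (Φ n) x‖ ^ 2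
      set Z3 := ∑ i, ‖weakDeriv (cube R) (Pi.single i 1 + Pi.single i 1) (Φ j) x‖ ^ 2
      have z1 : 0 ≤ Z1 :=
        Finset.sum_nonneg fun _ _ => Finset.sum_nonneg fun _ _ => sq_nonneg _
      have z2 : 0 ≤ Z2 :=
        Finset.sum_nonneg fun _ _ => Finset.sum_nonneg fun _ _ => sq_nonneg _
      have z3 : 0 ≤ Z3 := Finset.sum_nonneg fun _ _ => sq_nonneg _
      have b1 := pow_le_pow_left₀ (norm_nonneg _) hx 2
      have b2 : (c * (X1 + X2) + X3) ^ 2 ≤ 3 * (c ^ 2 * X1 ^ 2 + c ^ 2 * X2 ^ 2 + X3 ^ 2) := by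
        nlinarith [sq_nonneg (c * X1 - c * X2), sq_nonneg (c * X1 - X3), sq_nonneg (c * X2 - X3)]
      have b3 := mul_le_mul_of_nonneg_left t1 (sq_nonneg c)
      have b4 := mul_le_mul_of_nonneg_left t2 (sq_nonneg c)
      have b5 : 0 ≤ c ^ 2 * (3 * N) * Z3 := by positivity
      calc _ ≤ _ := b1.trans b2
        _ ≤ 3 * (c ^ 2 * (3 * N * Z1) + c ^ 2 * (3 * N * Z2) + 3 * Z3) := by linarith
        _ ≤ κ * (Z1 + Z2 + Z3) := by
          simp only [κ]
          linarith
  -- the part coming from `Φ`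
  have hΦ1 : (∑ n, ∑ i, cubeEnergy R lam (weakPartial (cube R) i (Φ n))) ≤ 3 * w * Y := by
    have : ∀ n ∈ Finset.univ, ∑ i, cubeEnergy R lam (weakPartial (cube R) i (Φ n)) ≤
        3 * w * normSqH 2 (cube R) (Φ n) := by
      intro n _
      have : ∀ i ∈ Finset.univ, cubeEnergy R lam (weakPartial (cube R) i (Φ n)) ≤
          w * normSqH 2 (cube R) (Φ n) := fun i _ =>
        (cubeEnergy_le_integral_sq hlam0 (mΦ n i)).trans (mul_le_mul_of_nonneg_left
          (integral_sq_weakDeriv_le (single_mem_multiIndices i one_le_two) (Φ n)) hw.le)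
      have := Finset.sum_le_card_nsmul _ _ _ this
      simpa [mul_assoc] using this
    have := Finset.sum_le_sum this
    rwa [← Finset.mul_sum] at this
  have hΦ2 : ∀ j, ∑ i, cubeEnergy R lam
      (weakDeriv (cube R) (Pi.single i 1 + Pi.single i 1) (Φ j)) ≤ 3 * w * Y := by
    intro j
    have : ∀ i ∈ Finset.univ, cubeEnergy R lam
        (weakDeriv (cube R) (Pi.single i 1 + Pi.single i 1) (Φ j)) ≤ w * Y := fun i _ =>
      (cubeEnergy_le_integral_sq hlam0 (dΦ j i)).trans (mul_le_mul_of_nonneg_left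
        ((integral_sq_weakDeriv_le (single_add_single_mem_multiIndices i i le_rfl) (Φ j)).trans
          (hY j)) hw.le)
    have := Finset.sum_le_card_nsmul _ _ _ this
    simpa [mul_assoc] using this
  set 𝓔 := ∑ j, cubeEnergy R lam (weakLaplacian (cube R) (U j))
  -- the gradients of `U` are absorbed for large `lam`
  have hgrad : lam * (∑ n, ∑ i, cubeEnergy R lam (weakPartial (cube R) i (U n))) ≤ 4 * 𝓔 := by
    rw [Finset.mul_sum, Finset.mul_sum]
    refine Finset.sum_le_sum fun n _ => ?_
    have h1 := ((hU n).cauchyData (hv n) (hl n)).carleman_lower hR hlam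
    have e : (fun x => weakDeriv (cube R) (Pi.single 0 1 + Pi.single 0 1) (U n) x +
        weakDeriv (cube R) (Pi.single 1 1 + Pi.single 1 1) (U n) x +
        weakDeriv (cube R) (Pi.single 2 1 + Pi.single 2 1) (U n) x) =
        weakLaplacian (cube R) (U n) := by
      funext x; rw [weakLaplacian_apply]
    simp only [e] at h1
    rw [Fin.sum_univ_three]
    have := mul_nonneg hlam0 (cubeEnergy_nonneg R lam (U n))
    linarith
  set 𝓖 := ∑ n, ∑ i, cubeEnergy R lam (weakPartial (cube R) i (U n))
  have hG0 : 0 ≤ 𝓖 :=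
    Finset.sum_nonneg fun _ _ => Finset.sum_nonneg fun _ _ => cubeEnergy_nonneg _ _ _
  have hE : 𝓔 ≤ N * (κ * (𝓖 + 6 * w * Y)) := by
    have : ∀ j ∈ Finset.univ, cubeEnergy R lam (weakLaplacian (cube R) (U j)) ≤
        κ * (𝓖 + 6 * w * Y) := fun j _ =>
      (main j).trans (mul_le_mul_of_nonneg_left (by have := hΦ2 j; linarith) hκ.le)
    have := Finset.sum_le_card_nsmul _ _ _ this
    simpa using this
  have hE' : 𝓔 ≤ 12 * N * κ * w * Y := by
    have : lam * 𝓖 = 𝓖 + 8 * N * κ * 𝓖 := by simp only [lam]; ring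
    have : 8 * (N * κ * 𝓖) ≤ 4 * 𝓔 := by linarith
    have : N * (κ * (𝓖 + 6 * w * Y)) = N * κ * 𝓖 + 6 * (N * κ * w * Y) := by ring
    linarith
  calc ∑ j, normSqH 2 (cube R) (U j) ≤ ∑ j, (multiIndices 2).card *
        ((4 + (14 + 20 * (2 * R + 1) ^ 2) * lam) *
          cubeEnergy R lam (weakLaplacian (cube R) (U j))) :=
        Finset.sum_le_sum fun j _ => (hU j).normSqH_le_cubeEnergy hR (hv j) (hl j) hlam
    _ = (multiIndices 2).card * ((4 + (14 + 20 * (2 * R + 1) ^ 2) * lam) * 𝓔) := by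
        rw [← Finset.mul_sum, ← Finset.mul_sum]
    _ ≤ (multiIndices 2).card * ((4 + (14 + 20 * (2 * R + 1) ^ 2) * lam) *
          (12 * N * κ * w * Y)) := by gcongr
    _ = _ := by ring

/-! ### Lipschitz stability -/

lemma normHVec_sq (m : ℕ) {N : ℕ} (Ω : Set E3) (U : Fin N → E3 → ℂ) :
    normHVec m Ω U ^ 2 = ∑ j, normSqH m Ω (U j) :=
  Real.sq_sqrt (Finset.sum_nonneg fun _ _ => normSqH_nonneg _ _ _)

lemma normSqH_le_normHVec_sq (m : ℕ) {N : ℕ} (Ω : Set E3) (U : Fin N → E3 → ℂ) (j : Fin N) :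
    normSqH m Ω (U j) ≤ normHVec m Ω U ^ 2 := by
  rw [normHVec_sq]
  exact Finset.single_le_sum (f := fun j => normSqH m Ω (U j))
    (fun _ _ => normSqH_nonneg _ _ _) (Finset.mem_univ j)

/-- The gradients of the functions in `G(M)` are bounded by a constant, almost everywhere. -/
lemma exists_gradient_bound {R : ℝ} (hR : 0 < R) (N : ℕ) (M : ℝ) :
    ∃ L : ℝ, 0 ≤ L ∧ ∀ V : Fin N → E3 → ℂ, InBallG R M V →
      ∀ᵐ x ∂volume.restrict (cube R), ∀ n i, ‖weakPartial (cube R) i (V n) x‖ ≤ L := by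
  obtain ⟨C, hC, h⟩ := exists_ae_norm_le_of_isWeakPartial hR
  refine ⟨C * (1 + M ^ 2), by positivity, fun V hV => ?_⟩
  rw [ae_all_iff]
  intro n
  rw [ae_all_iff]
  intro i
  have hn : normSqH 3 (cube R) (V n) ≤ M ^ 2 :=
    (normSqH_le_normHVec_sq 3 (cube R) V n).trans
      (pow_le_pow_left₀ (Real.sqrt_nonneg _) hV.2.le 2)
  refine h (M ^ 2) _ (fun j => weakDeriv (cube R) (Pi.single i 1 + Pi.single j 1) (V n))
    (fun j l => weakDeriv (cube R) (Pi.single i 1 + Pi.single j 1 + Pi.single l 1) (V n))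
    (fun j => (hV.1 n).isWeakPartial _ j (single_add_single_mem_multiIndices i j (by norm_num)))
    (fun j l => (hV.1 n).isWeakPartial _ l (single_add_single_add_single_mem_multiIndices i j l))
    ((integral_sq_weakDeriv_le (single_mem_multiIndices i (by norm_num)) _).trans hn)
    (fun j => (integral_sq_weakDeriv_le
      (single_add_single_mem_multiIndices i j (by norm_num)) _).trans hn)
    (fun j l => (integral_sq_weakDeriv_le
      (single_add_single_add_single_mem_multiIndices i j l) _).trans hn)

lemma weakDeriv_sub_sub_ae_eq {R : ℝ} {m : ℕ} {v v' f f' : E3 → ℂ} (hv : MemH m (cube R) v)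
    (hv' : MemH m (cube R) v') (hf : MemH m (cube R) f) (hf' : MemH m (cube R) f')
    {β : Fin 3 → ℕ} (hβ : β ∈ multiIndices m) :
    ∀ᵐ x ∂volume.restrict (cube R), weakDeriv (cube R) β (v - v' - (f - f')) x =
      (weakDeriv (cube R) β v x - weakDeriv (cube R) β v' x) -
        weakDeriv (cube R) β (f - f') x := by
  have ho := isOpen_cube R
  filter_upwards [(hv.sub ho hv').weakDeriv_sub ho (hf.sub ho hf') hβ,
    hv.weakDeriv_sub ho hv' hβ] with x h1 h2
  rw [h1, Pi.sub_apply, h2, Pi.sub_apply]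

lemma normSqH_add_le {R : ℝ} {m : ℕ} {w φ : E3 → ℂ} (hw : MemH m (cube R) w)
    (hφ : MemH m (cube R) φ) :
    normSqH m (cube R) w ≤ 2 * normSqH m (cube R) (w - φ) + 2 * normSqH m (cube R) φ := by
  have ho := isOpen_cube R
  unfold normSqH
  rw [Finset.mul_sum, Finset.mul_sum, ← Finset.sum_add_distrib]
  refine Finset.sum_le_sum fun β hβ => ?_
  have i0 := (hw.memLp_weakDeriv ho hβ).integrable_norm_pow (p := 2) (by simp)
  have i1 := ((hw.sub ho hφ).memLp_weakDeriv ho hβ).integrable_norm_pow (p := 2) (by simp)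
  have i2 := (hφ.memLp_weakDeriv ho hβ).integrable_norm_pow (p := 2) (by simp)
  rw [← integral_const_mul, ← integral_const_mul, ← integral_add (i1.const_mul 2) (i2.const_mul 2)]
  refine integral_mono_ae i0 ((i1.const_mul 2).add (i2.const_mul 2)) ?_
  filter_upwards [hw.weakDeriv_sub ho hφ hβ] with x hx
  simp only [hx, Pi.sub_apply]
  set p := weakDeriv (cube R) β w x
  set q := weakDeriv (cube R) β φ x
  have h1 : ‖p‖ ≤ ‖p - q‖ + ‖q‖ := by simpa using norm_add_le (p - q) q
  have h2 := pow_le_pow_left₀ (norm_nonneg p) h1 2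
  nlinarith [sq_nonneg (‖p - q‖ - ‖q‖)]

/-- Lipschitz stability. The difference of the solutions, corrected by the difference of the
extensions of the boundary data, has vanishing Cauchy data, and its Laplacian is bounded by
gradients because the nonlinearity is Lipschitz on the bounded set of gradients of functions in
`G(M)`. -/
theorem exists_lipschitz_stability {R a d : ℝ} (k : ℝ) (hR : 0 < R) (hd : R < d) (N : ℕ) (M : ℝ) :
    ∃ C : ℝ, 0 < C ∧
      ∀ V₁ V₂ F₁ F₂ ψ₀₁ ψ₀₂ ψ₁₁ ψ₁₂ : Fin N → E3 → ℂ,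
        SolvesSystem R a d k V₁ → SolvesSystem R a d k V₂ →
        HasBoundaryData R V₁ ψ₀₁ ψ₁₁ → HasBoundaryData R V₂ ψ₀₂ ψ₁₂ →
        HasBoundaryData R F₁ ψ₀₁ ψ₁₁ → HasBoundaryData R F₂ ψ₀₂ ψ₁₂ →
        InBallG R M V₁ → InBallG R M V₂ → InBallG R M F₁ → InBallG R M F₂ →
        normHVec 2 (cube R) (V₁ - V₂) ≤ C * normHVec 2 (cube R) (F₁ - F₂) := by
  obtain ⟨L, hL, hgrad⟩ := exists_gradient_bound hR N M
  obtain ⟨C₁, hC₁, hK⟩ := exists_KNonlin_lipschitz (a := a) k hd N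
  obtain ⟨C₂, hC₂, hstab⟩ := exists_stability_of_laplacian_le hR N (C₁ * (1 + L))
  refine ⟨√(2 * C₂ + 2), by positivity, ?_⟩
  intro V₁ V₂ F₁ F₂ ψ₀₁ ψ₀₂ ψ₁₁ ψ₁₂ s₁ s₂ bV₁ bV₂ bF₁ bF₂ gV₁ gV₂ gF₁ gF₂
  have ho := isOpen_cube R
  let U : Fin N → E3 → ℂ := fun j => V₁ j - V₂ j - (F₁ j - F₂ j)
  have hle : 2 ≤ 3 := by norm_num
  have hV₁ : ∀ j, MemH 2 (cube R) (V₁ j) := fun j => (gV₁.1 j).mono hle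
  have hV₂ : ∀ j, MemH 2 (cube R) (V₂ j) := fun j => (gV₂.1 j).mono hle
  have hF₁ : ∀ j, MemH 2 (cube R) (F₁ j) := fun j => (gF₁.1 j).mono hle
  have hF₂ : ∀ j, MemH 2 (cube R) (F₂ j) := fun j => (gF₂.1 j).mono hle
  have hsub := fun j β hβ => weakDeriv_sub_sub_ae_eq (hV₁ j) (hV₂ j) (hF₁ j) (hF₂ j) (β := β) hβ
  have key := hstab U (F₁ - F₂)
    (fun j => ((hV₁ j).sub ho (hV₂ j)).sub ho ((hF₁ j).sub ho (hF₂ j)))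
    (fun j => (hF₁ j).sub ho (hF₂ j))
    (fun j p hp => by
      have := (((bV₁ j).1 p hp).sub ((bV₂ j).1 p hp)).sub (((bF₁ j).1 p hp).sub ((bF₂ j).1 p hp))
      rwa [sub_self] at this)
    (fun j p hp => by
      have t := (((bV₁ j).2 p hp).sub ((bV₂ j).2 p hp)).sub
        (((bF₁ j).2 p hp).sub ((bF₂ j).2 p hp))
      rw [sub_self] at t
      refine t.congr' (EventuallyEq.filter_mono ?_ inf_le_right)
      filter_upwards [hsub j _ (single_mem_multiIndices 2 one_le_two),
        (hF₁ j).weakDeriv_sub ho (hF₂ j) (single_mem_multiIndices 2 one_le_two)] with x h1 h2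
      rw [h2, Pi.sub_apply] at h1
      exact h1.symm)
    (by
      have e1 : ∀ᵐ x ∂volume.restrict (cube R), ∀ n i, weakPartial (cube R) i (U n) x =
          (weakPartial (cube R) i (V₁ n) x - weakPartial (cube R) i (V₂ n) x) -
            weakPartial (cube R) i (F₁ n - F₂ n) x :=
        ae_all_iff.2 fun n => ae_all_iff.2 fun i =>
          hsub n _ (single_mem_multiIndices i one_le_two)
      have e2 : ∀ᵐ x ∂volume.restrict (cube R), ∀ n i,
          weakDeriv (cube R) (Pi.single i 1 + Pi.single i 1) (U n) x =
          (weakDeriv (cube R) (Pi.single i 1 + Pi.single i 1) (V₁ n) x -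
            weakDeriv (cube R) (Pi.single i 1 + Pi.single i 1) (V₂ n) x) -
            weakDeriv (cube R) (Pi.single i 1 + Pi.single i 1) (F₁ n - F₂ n) x :=
        ae_all_iff.2 fun n => ae_all_iff.2 fun i =>
          hsub n _ (single_add_single_mem_multiIndices i i le_rfl)
      filter_upwards [s₁, s₂, hgrad V₁ gV₁, hgrad V₂ gV₂, e1, e2,
        ae_restrict_mem (measurableSet_cube R)] with x q₁ q₂ b₁ b₂ h1 h2 hx j
      have hKx := hK x hx L (fun n i => weakPartial (cube R) i (V₁ n) x)
        (fun n i => weakPartial (cube R) i (V₂ n) x) hL b₁ b₂ j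
      have hlap : weakLaplacian (cube R) (U j) x =
          (weakLaplacian (cube R) (V₁ j) x - weakLaplacian (cube R) (V₂ j) x) -
            weakLaplacian (cube R) ((F₁ - F₂) j) x := by
        rw [weakLaplacian_apply, weakLaplacian_apply, weakLaplacian_apply, weakLaplacian_apply,
          h2 j 0, h2 j 1, h2 j 2, Pi.sub_apply]
        ring
      have hlap' : weakLaplacian (cube R) (V₁ j) x - weakLaplacian (cube R) (V₂ j) x =
          -(KNonlin a d k x (fun n i => weakPartial (cube R) i (V₁ n) x) j -
            KNonlin a d k x (fun n i => weakPartial (cube R) i (V₂ n) x) j) := by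
        linear_combination q₁ j - q₂ j
      rw [hlap]
      refine (norm_sub_le _ _).trans (add_le_add ?_ le_rfl)
      rw [hlap', norm_neg]
      refine hKx.trans (mul_le_mul_of_nonneg_left ?_ (by positivity))
      rw [← Finset.sum_add_distrib]
      refine Finset.sum_le_sum fun n _ => ?_
      rw [← Finset.sum_add_distrib]
      refine Finset.sum_le_sum fun i _ => ?_
      have : weakPartial (cube R) i (V₁ n) x - weakPartial (cube R) i (V₂ n) x =
          weakPartial (cube R) i (U n) x + weakPartial (cube R) i ((F₁ - F₂) n) x := by
        rw [h1 n i, Pi.sub_apply]; ring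
      rw [this]
      exact norm_add_le _ _)
  have hnn : 0 ≤ √(2 * C₂ + 2) * normHVec 2 (cube R) (F₁ - F₂) :=
    mul_nonneg (Real.sqrt_nonneg _) (Real.sqrt_nonneg _)
  refine le_of_abs_le (abs_le_of_sq_le_sq ?_ hnn)
  rw [mul_pow, Real.sq_sqrt (by positivity), normHVec_sq, normHVec_sq]
  have : ∀ j ∈ Finset.univ, normSqH 2 (cube R) ((V₁ - V₂) j) ≤
      2 * normSqH 2 (cube R) (U j) + 2 * normSqH 2 (cube R) ((F₁ - F₂) j) := fun j _ =>
    normSqH_add_le ((hV₁ j).sub ho (hV₂ j)) ((hF₁ j).sub ho (hF₂ j))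
  have := Finset.sum_le_sum this
  rw [Finset.sum_add_distrib, ← Finset.mul_sum, ← Finset.mul_sum] at this
  linarith

lemma normHVec_sub_self {R : ℝ} {m N : ℕ} {V : Fin N → E3 → ℂ} (hV : MemHVec m (cube R) V) :
    normHVec m (cube R) (V - V) = 0 := by
  have ho := isOpen_cube R
  unfold normHVec
  rw [Real.sqrt_eq_zero']
  refine le_of_eq (Finset.sum_eq_zero fun j _ => Finset.sum_eq_zero fun β hβ => ?_)
  refine integral_eq_zero_of_ae ?_
  filter_upwards [(hV j).weakDeriv_sub ho (hV j) hβ] with x hx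
  rw [Pi.sub_apply, hx]
  simp

lemma ae_eq_of_normHVec_sub_eq_zero {R : ℝ} {m N : ℕ} {V W : Fin N → E3 → ℂ}
    (hV : MemHVec m (cube R) V) (hW : MemHVec m (cube R) W)
    (h : normHVec m (cube R) (V - W) = 0) (j : Fin N) :
    V j =ᵐ[volume.restrict (cube R)] W j := by
  have ho := isOpen_cube R
  have hVW := (hV j).sub ho (hW j)
  have h0 : (0 : Fin 3 → ℕ) ∈ multiIndices m := mem_multiIndices.2 (by simp)
  have h1 : ∫ x in cube R, ‖weakDeriv (cube R) 0 (V j - W j) x‖ ^ 2 = 0 := by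
    refine le_antisymm ?_ (integral_nonneg fun _ => sq_nonneg _)
    have := (integral_sq_weakDeriv_le h0 ((V - W) j)).trans
      (normSqH_le_normHVec_sq m (cube R) (V - W) j)
    rwa [h, zero_pow two_ne_zero] at this
  rw [integral_eq_zero_iff_of_nonneg (fun _ => sq_nonneg _)
    ((hVW.memLp_weakDeriv ho h0).integrable_norm_pow (p := 2) (by simp))] at h1
  filter_upwards [h1, hVW.weakDeriv_zero_order ho] with x h2 h3
  have h4 : weakDeriv (cube R) 0 (V j - W j) x = 0 := by simpa using h2
  rw [h3, Pi.sub_apply] at h4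
  exact sub_eq_zero.1 h4

end HelmholtzCIP

theorem theorem3p2 (R a d k : ℝ) (hR : 0 < R) (ha : 0 < a) (hd : R < d) (hk : 0 < k)
    (N : ℕ) (hN : 1 ≤ N) :
    (∀ M : ℝ, 0 < M → ∃ C : ℝ, 0 < C ∧
      ∀ V₁ V₂ F₁ F₂ ψ₀₁ ψ₀₂ ψ₁₁ ψ₁₂ : Fin N → E3 → ℂ,
        SolvesSystem R a d k V₁ → SolvesSystem R a d k V₂ →
        HasBoundaryData R V₁ ψ₀₁ ψ₁₁ → HasBoundaryData R V₂ ψ₀₂ ψ₁₂ →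
        HasBoundaryData R F₁ ψ₀₁ ψ₁₁ → HasBoundaryData R F₂ ψ₀₂ ψ₁₂ →
        InBallG R M V₁ → InBallG R M V₂ → InBallG R M F₁ → InBallG R M F₂ →
        normHVec 2 (cube R) (V₁ - V₂) ≤ C * normHVec 2 (cube R) (F₁ - F₂)) ∧
    (∀ V₁ V₂ ψ₀ ψ₁ : Fin N → E3 → ℂ,
      MemHVec 3 (cube R) V₁ → MemHVec 3 (cube R) V₂ →
      SolvesSystem R a d k V₁ → SolvesSystem R a d k V₂ →
      HasBoundaryData R V₁ ψ₀ ψ₁ → HasBoundaryData R V₂ ψ₀ ψ₁ →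
      ∀ j, V₁ j =ᵐ[MeasureTheory.volume.restrict (cube R)] V₂ j) := by
  refine ⟨fun M _ => exists_lipschitz_stability k hR hd N M, ?_⟩
  intro V₁ V₂ ψ₀ ψ₁ hV₁ hV₂ s₁ s₂ b₁ b₂
  obtain ⟨C, -, h⟩ := exists_lipschitz_stability (a := a) k hR hd N
    (max (normHVec 3 (cube R) V₁) (normHVec 3 (cube R) V₂) + 1)
  have g₁ : InBallG R (max (normHVec 3 (cube R) V₁) (normHVec 3 (cube R) V₂) + 1) V₁ :=
    ⟨hV₁, lt_of_le_of_lt (le_max_left _ _) (lt_add_one _)⟩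
  have g₂ : InBallG R (max (normHVec 3 (cube R) V₁) (normHVec 3 (cube R) V₂) + 1) V₂ :=
    ⟨hV₂, lt_of_le_of_lt (le_max_right _ _) (lt_add_one _)⟩
  have hle : 2 ≤ 3 := by norm_num
  have m₁ : MemHVec 2 (cube R) V₁ := fun j => (hV₁ j).mono hle
  have m₂ : MemHVec 2 (cube R) V₂ := fun j => (hV₂ j).mono hle
  -- both solutions have the boundary data of `V₁`, which serves as extension for both
  have key := h V₁ V₂ V₁ V₁ ψ₀ ψ₀ ψ₁ ψ₁ s₁ s₂ b₁ b₂ b₁ b₁ g₁ g₂ g₁ g₁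
  rw [normHVec_sub_self m₁, mul_zero] at key
  exact ae_eq_of_normHVec_sub_eq_zero m₁ m₂ (le_antisymm key (Real.sqrt_nonneg _))
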